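/- Let $m\ge 3$ and $0<2\alpha<1$, and write $\mathbb R^m_+=\{x\in\mathbb R^m: x_1>0\}$. Let $$q_1(x,\xi)=k_1\,(r^2)^{-\alpha-\frac{m-2}{2}}\,F\!\left(\alpha+\tfrac{m-2}{2},\alpha;2\alpha;1-\tfrac{r_1^2}{r^2}\right),\qquad k_1=\frac{\Gamma(\alpha)\,\Gamma\!\left(\alpha+\frac{m-2}{2}\right)}{4^{1-\alpha}\pi^{m/2}\Gamma(2\alpha)},$$ where $r^2=\sum_{i=1}^m(x_i-\xi_i)^2$, $r_1^2=(x_1+\xi_1)^2+\sum_{i=2}^m(x_i-\xi_i)^2$ and $F$ is the Gauss hypergeometric function, continued analytically from $(-1,1)$ to $(-\infty,1)$. This is a fundamental solution of $\sum_{i=1}^m u_{x_ix_i}+\frac{2\alpha}{x_1}u_{x_1}=0$. Let $\Omega\subset\mathbb R^m_+$ be a bounded domain whose boundary is $\overline{\Gamma_1}\cup\Gamma$, where $\Gamma_1$ is a relatively open part of the hyperplane $x_1=0$ and $\Gamma\subset\mathbb R^m_+$ is a Lyapunov surface that approaches the hyperplane under a right angle. That is: near each of its points $\Gamma$ is a $C^1$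 hypersurface with $\Omega$ on one side, with outer unit normal $n$; there are constants $a,\lambda>0$ such that the angle between $n(x)$ and $n(y)$ is at most $a|x-y|^\lambda$ for all $x,y\in\Gamma$; and $n_1(x)\to 0$ as $x\in\Gamma$ tends to a point of $\overline\Gamma$ on the hyperplane $x_1=0$. For $\mu_1\in C(\overline\Gamma)$ consider the double-layer potential $$w^{(1)}(x)=\int_\Gamma \xi_1^{2\alpha}\,\mu_1(\xi)\,\frac{\partial q_1(\xi,x)}{\partial n_\xi}\,d_\xi\Gamma$$ and the kernel $K_1(s,t)=s_1^{2\alpha}\,\frac{\partial q_1(s,t)}{\partial n_s}$, with respect to the surface area on $\Gamma$. Then the integral defining $w^{(1)}(x)$ converges absolutely for every $x\in\mathbb R^m_+\setminus\Gamma$, and for every $t\in\Gamma$ the integral $\int_\Gamma\mu_1(s)K_1(s,t)\,d_s\Gamma$ converges absolutely and $$\lim_{\Omega\ni x\to t}w^{(1)}(x)=-\tfrac12\mu_1(t)+\int_\Gamma\mu_1(s)K_1(s,t)\,d_s\Gamma,$$ $$\lim_{\mathbb R^m_+\setminus\overline\Omega\,\ni x\to t}w^{(1)}(x)=\tfrac12\mu_1(t)+\int_\Gamma\mu_1(s)K_1(s,t)\,d_s\Gamma.$$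 -/

import Mathlib

open MeasureTheory Set Filter Topology

namespace DoubleLayer

/-- The Gauss hypergeometric function `F(a, b; c; z)` for `0 < b < c` and real `z < 1`, through
Euler's integral
`F(a, b; c; z) = Γ(c) / (Γ(b) Γ(c - b)) ∫₀¹ t ^ (b - 1) (1 - t) ^ (c - b - 1) (1 - z t) ^ (-a) dt`.
The series `∑ (a)ₙ (b)ₙ / (n! (c)ₙ) zⁿ` only converges for `|z| < 1`, and the fundamental solution
needs all `z ≤ 0`. The two theorems `gaussHypergeometric_eq_series` and
`gaussHypergeometric_analyticOnNhd` below show that this is the analytic continuation of the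
sum of the series from `(-1, 1)` to `(-∞, 1)`. -/
noncomputable def gaussHypergeometric (a b c z : ℝ) : ℝ :=
  Real.Gamma c / (Real.Gamma b * Real.Gamma (c - b)) *
    ∫ t in (0 : ℝ)..1, t ^ (b - 1) * (1 - t) ^ (c - b - 1) * (1 - z * t) ^ (-a)

theorem integrable_betaWeight {u v : ℝ} (hu : 0 < u) (hv : 0 < v) :
    IntegrableOn (fun t : ℝ => t ^ (u - 1) * (1 - t) ^ (v - 1)) (Ioc 0 1) := by
  have h := Complex.betaIntegral_convergent (u := u) (v := v) (by simpa) (by simpa)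
  rw [intervalIntegrable_iff_integrableOn_Ioc_of_le zero_le_one] at h
  refine (IntegrableOn.congr_fun h.re (fun t ht => ?_) measurableSet_Ioc)
  have h1 : (0:ℝ) ≤ 1 - t := by linarith [ht.2]
  have e1 := Complex.ofReal_cpow ht.1.le (u - 1)
  have e2 := Complex.ofReal_cpow h1 (v - 1)
  push_cast at e1 e2
  simp only [RCLike.re_to_complex]
  rw [← e1, ← e2]
  norm_cast

theorem integral_betaWeight {u v : ℝ} (hu : 0 < u) (hv : 0 < v) :
    ∫ t in Ioc (0 : ℝ) 1, t ^ (u - 1) * (1 - t) ^ (v - 1) =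
      Real.Gamma u * Real.Gamma v / Real.Gamma (u + v) := by
  have := ProbabilityTheory.beta_eq_betaIntegralReal u v hu hv
  rw [ProbabilityTheory.beta] at this
  rw [this, Complex.betaIntegral, intervalIntegral.integral_of_le zero_le_one,
    ← RCLike.re_to_complex, ← integral_re]
  · refine setIntegral_congr_fun measurableSet_Ioc (fun t ht => ?_)
    have h1 : (0:ℝ) ≤ 1 - t := by linarith [ht.2]
    have e1 := Complex.ofReal_cpow ht.1.le (u - 1)
    have e2 := Complex.ofReal_cpow h1 (v - 1)
    push_cast at e1 e2
    simp only [RCLike.re_to_complex]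
    rw [← e1, ← e2]
    norm_cast
  · have h := Complex.betaIntegral_convergent (u := u) (v := v) (by simpa) (by simpa)
    rwa [intervalIntegrable_iff_integrableOn_Ioc_of_le zero_le_one] at h

theorem Gamma_add_nat_ascPochhammer {u : ℝ} (hu : 0 < u) (n : ℕ) :
    Real.Gamma (u + n) = (ascPochhammer ℝ n).eval u * Real.Gamma u := by
  induction n with
  | zero => simp
  | succ n ih =>
    have : u + (n + 1 : ℕ) = (u + n) + 1 := by push_cast; ring
    rw [this, Real.Gamma_add_one (by positivity), ih, ascPochhammer_succ_eval]
    ring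

theorem hasSum_one_sub_rpow_neg (a : ℝ) {y : ℝ} (hy : |y| < 1) :
    HasSum (fun n : ℕ => ((n.factorial : ℝ)⁻¹ * (ascPochhammer ℝ n).eval a) * y ^ n)
      ((1 - y) ^ (-a)) := by
  have h := (Real.one_div_one_sub_rpow_hasFPowerSeriesOnBall_zero a).hasSum (y := y)
    (by simpa [enorm_eq_nnnorm] using! hy)
  have h1 : 0 ≤ 1 - y := by linarith [(abs_lt.1 hy).2]
  simp only [zero_add] at h
  rw [Real.rpow_neg h1, ← one_div]
  have e : (fun n : ℕ => ((n.factorial : ℝ)⁻¹ * (ascPochhammer ℝ n).eval a) * y ^ n) = fun n =>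
      (FormalMultilinearSeries.ofScalars ℝ (fun n => Ring.choose (a + n - 1) n) n) fun _ => y := by
    funext n
    simp only [FormalMultilinearSeries.ofScalars_apply_eq, Ring.choose_eq_smul,
      Polynomial.descPochhammer_smeval_eq_ascPochhammer, Polynomial.ascPochhammer_smeval_cast,
      Polynomial.ascPochhammer_smeval_eq_eval, smul_eq_mul]
    rw [show a + n - 1 - n + 1 = a by ring]
  rw [e]
  exact h

/-- On `(-1, 1)` the function is the sum of the hypergeometric series. -/
theorem gaussHypergeometric_eq_series {a b c z : ℝ} (hb : 0 < b) (hbc : b < c) (hz : |z| < 1) :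
    gaussHypergeometric a b c z = ₂F₁ a b c z := by
  have hcb : 0 < c - b := by linarith
  set k : ℕ → ℝ := fun n => (n.factorial : ℝ)⁻¹ * (ascPochhammer ℝ n).eval a with hk
  let f : ℕ → ℝ → ℝ := fun n t => k n * z ^ n * (t ^ (b + n - 1) * (1 - t) ^ (c - b - 1))
  have hbn : ∀ n : ℕ, 0 < b + n := fun n => by positivity
  have hf_int : ∀ n, IntegrableOn (f n) (Ioc 0 1) := fun n =>
    (integrable_betaWeight (hbn n) hcb).const_mul _
  have hnorm : ∀ n, ∫ t in Ioc (0 : ℝ) 1, ‖f n t‖ ≤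
      |k n * z ^ n| * ∫ t in Ioc (0 : ℝ) 1, t ^ (b - 1) * (1 - t) ^ (c - b - 1) := by
    intro n
    rw [← integral_const_mul]
    refine setIntegral_mono_on (hf_int n).norm ((integrable_betaWeight hb hcb).const_mul _)
      measurableSet_Ioc (fun t ht => ?_)
    have h1 : (0:ℝ) ≤ 1 - t := by linarith [ht.2]
    have h2 := Real.rpow_nonneg h1 (c - b - 1)
    have h3 := Real.rpow_nonneg ht.1.le (b + n - 1)
    simp only [f, norm_mul, Real.norm_eq_abs, abs_of_nonneg h2, abs_of_nonneg h3, abs_mul]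
    gcongr _ * (?_ * _)
    exact Real.rpow_le_rpow_of_exponent_ge ht.1 ht.2 (by linarith [Nat.cast_nonneg (α := ℝ) n])
  have hs : Summable fun n => |k n * z ^ n| := (hasSum_one_sub_rpow_neg a hz).summable.abs
  have key := hasSum_integral_of_summable_integral_norm (μ := volume.restrict (Ioc (0:ℝ) 1))
    (F := f) hf_int (Summable.of_nonneg_of_le (fun n => integral_nonneg fun _ => norm_nonneg _)
      hnorm (hs.mul_right _))
  have hint : ∫ t in Ioc (0 : ℝ) 1, ∑' n, f n t =
      ∫ t in Ioc (0 : ℝ) 1, t ^ (b - 1) * (1 - t) ^ (c - b - 1) * (1 - z * t) ^ (-a) := by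
    refine setIntegral_congr_fun measurableSet_Ioc (fun t ht => ?_)
    have hzt : |z * t| < 1 := by
      rw [abs_mul, abs_of_pos ht.1]
      exact lt_of_le_of_lt (mul_le_of_le_one_right (abs_nonneg _) ht.2) hz
    have := ((hasSum_one_sub_rpow_neg a hzt).mul_left (t ^ (b - 1) * (1 - t) ^ (c - b - 1))).tsum_eq
    show ∑' n, f n t = _
    rw [← this]
    refine tsum_congr fun n => ?_
    simp only [f, hk]
    rw [show b + n - 1 = (b - 1) + n by ring, Real.rpow_add_natCast ht.1.ne']
    ring
  rw [hint] at key
  have hΓb := (Real.Gamma_pos_of_pos hb).ne'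
  have hΓc := (Real.Gamma_pos_of_pos (hb.trans hbc)).ne'
  have hΓcb := (Real.Gamma_pos_of_pos hcb).ne'
  rw [gaussHypergeometric, intervalIntegral.integral_of_le zero_le_one,
    ordinaryHypergeometric_eq_tsum, ← (key.mul_left _).tsum_eq]
  refine tsum_congr fun n => ?_
  simp only [f]
  rw [integral_const_mul, integral_betaWeight (hbn n) hcb,
    show b + n + (c - b) = c + n by ring, Gamma_add_nat_ascPochhammer hb,
    Gamma_add_nat_ascPochhammer (hb.trans hbc)]
  have hpc : (ascPochhammer ℝ n).eval c ≠ 0 := (ascPochhammer_pos n c (hb.trans hbc)).ne'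
  simp only [hk, smul_eq_mul]
  field_simp

/-- The function is real analytic on `(-∞, 1)`. -/
theorem gaussHypergeometric_analyticOnNhd {a b c : ℝ} (hb : 0 < b) (hbc : b < c) :
    AnalyticOnNhd ℝ (gaussHypergeometric a b c) (Iio 1) := by
  have hcb : 0 < c - b := by linarith
  let w : ℝ → ℝ := fun t => t ^ (b - 1) * (1 - t) ^ (c - b - 1)
  have hw : IntegrableOn w (Ioc 0 1) := integrable_betaWeight hb hcb
  let S : Set ℂ := {z | 1 - z ∈ Complex.slitPlane}
  have hS : IsOpen S := Complex.isOpen_slitPlane.preimage (by fun_prop)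
  have hslit : ∀ z ∈ S, ∀ t ∈ Icc (0 : ℝ) 1, 1 - z * t ∈ Complex.slitPlane := by
    intro z hz t ht
    have hz : 0 < 1 - z.re ∨ z.im ≠ 0 := by simpa [S, Complex.mem_slitPlane_iff] using hz
    have : 0 < 1 - z.re * t ∨ z.im * t ≠ 0 := by
      rcases ht.1.eq_or_lt with h0 | h0
      · left; simp [← h0]
      · rcases hz with h | h
        · left; nlinarith [ht.2]
        · right; positivity
    simpa [Complex.mem_slitPlane_iff] using this
  let G : ℂ → ℂ := fun z => ∫ t in Ioc (0 : ℝ) 1, (w t : ℂ) * (1 - z * t) ^ (-a : ℂ)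
  have hcont : ∀ (z : ℂ) (e : ℂ), z ∈ S → ContinuousOn (fun t : ℝ => (1 - z * t) ^ e) (Icc 0 1) := by
    intro z e hz
    exact ContinuousOn.cpow (by fun_prop) continuousOn_const (hslit z hz)
  have hGmeas : ∀ (z : ℂ) (e : ℂ), z ∈ S → AEStronglyMeasurable
      (fun t : ℝ => (w t : ℂ) * (1 - z * t) ^ e) (volume.restrict (Ioc 0 1)) := by
    intro z e hz
    exact (Complex.continuous_ofReal.comp_aestronglyMeasurable hw.1).mul
      (((hcont z e hz).mono Ioc_subset_Icc_self).aestronglyMeasurable measurableSet_Ioc)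
  have hbd : ∀ K ⊆ S, IsCompact K → ∀ e : ℂ, ∃ C, ∀ z ∈ K, ∀ t ∈ Icc (0 : ℝ) 1,
      ‖(1 - z * t) ^ e‖ ≤ C := by
    intro K hK hKc e
    obtain ⟨C, hC⟩ := (hKc.prod (isCompact_Icc (a := (0 : ℝ)) (b := 1))).exists_bound_of_continuousOn
      (f := fun p : ℂ × ℝ => (1 - p.1 * p.2) ^ e)
      (ContinuousOn.cpow (by fun_prop) continuousOn_const
        (fun p hp => hslit p.1 (hK hp.1) p.2 hp.2))
    exact ⟨C, fun z hz t ht => hC (z, t) ⟨hz, ht⟩⟩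
  have hG : DifferentiableOn ℂ G S := by
    intro z₀ hz₀
    obtain ⟨ε, hε, hball⟩ := Metric.nhds_basis_closedBall.mem_iff.1 (hS.mem_nhds hz₀)
    obtain ⟨C, hC⟩ := hbd _ hball (isCompact_closedBall z₀ ε) (-a - 1)
    obtain ⟨C₀, hC₀⟩ := hbd {z₀} (by simpa using hz₀) isCompact_singleton (-a)
    have := hasDerivAt_integral_of_dominated_loc_of_deriv_le (μ := volume.restrict (Ioc (0 : ℝ) 1))
      (F := fun z t => (w t : ℂ) * (1 - z * t) ^ (-a : ℂ))
      (F' := fun z t => (w t : ℂ) * ((-a * (1 - z * t) ^ (-a - 1 : ℂ)) * (-t)))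
      (bound := fun t => |w t| * (|a| * C)) (x₀ := z₀) (s := Metric.ball z₀ ε)
      (Metric.ball_mem_nhds z₀ hε) ?_ ?_ ?_ ?_ ?_ ?_
    · exact this.2.differentiableAt.differentiableWithinAt
    · filter_upwards [hS.mem_nhds hz₀] with z hz using hGmeas z _ hz
    · refine Integrable.mono' (hw.abs.mul_const C₀) (hGmeas z₀ _ hz₀) ?_
      refine ae_restrict_of_forall_mem measurableSet_Ioc fun t ht => ?_
      rw [norm_mul, Complex.norm_real, Real.norm_eq_abs]
      gcongr
      exact hC₀ z₀ rfl t (Ioc_subset_Icc_self ht)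
    · have h1 := (hGmeas z₀ (-a - 1) hz₀).mul
        (Continuous.aestronglyMeasurable (f := fun t : ℝ => (a : ℂ) * t)
          (μ := volume.restrict (Ioc (0 : ℝ) 1)) (by fun_prop))
      refine h1.congr (Filter.Eventually.of_forall fun t => ?_)
      simp only [Pi.mul_apply]
      ring
    · refine ae_restrict_of_forall_mem measurableSet_Ioc fun t ht z hz => ?_
      have h1 := hC z (Metric.ball_subset_closedBall hz) t (Ioc_subset_Icc_self ht)
      have h2 : |t| ≤ 1 := by rw [abs_of_pos ht.1]; exact ht.2
      simp only [norm_mul, norm_neg, Complex.norm_real, Real.norm_eq_abs]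
      have hC0 : 0 ≤ C := (norm_nonneg _).trans h1
      gcongr |w t| * ?_
      calc |a| * _ * |t| ≤ |a| * C * 1 := by gcongr
        _ = |a| * C := mul_one _
    · exact hw.abs.mul_const _
    · refine ae_restrict_of_forall_mem measurableSet_Ioc fun t ht z hz => ?_
      have h1 : HasDerivAt (fun z : ℂ => 1 - z * t) (-(t : ℂ)) z := by
        simpa using ((hasDerivAt_id z).mul_const (t : ℂ)).const_sub 1
      exact (h1.cpow_const (hslit z (hball (Metric.ball_subset_closedBall hz)) t
        (Ioc_subset_Icc_self ht))).const_mul _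
  intro x hx
  have hxS : ((x : ℝ) : ℂ) ∈ S := by
    left
    simpa using hx
  have hGx : AnalyticAt ℝ G (Complex.ofRealCLM x) :=
    (hG.analyticAt (hS.mem_nhds hxS)).restrictScalars
  have hre : AnalyticAt ℝ (fun y : ℝ => Complex.reCLM (G (Complex.ofRealCLM y))) x :=
    (Complex.reCLM.analyticAt _).comp (hGx.comp (Complex.ofRealCLM.analyticAt x))
  have hmul : AnalyticAt ℝ (fun y : ℝ => Real.Gamma c / (Real.Gamma b * Real.Gamma (c - b)) *
      Complex.reCLM (G (Complex.ofRealCLM y))) x := analyticAt_const.mul hre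
  refine hmul.congr ?_
  filter_upwards [isOpen_Iio.mem_nhds hx] with y hy
  rw [gaussHypergeometric, intervalIntegral.integral_of_le zero_le_one]
  congr 1
  have : G (Complex.ofRealCLM y) =
      ((∫ t in Ioc (0 : ℝ) 1, w t * (1 - y * t) ^ (-a) : ℝ) : ℂ) := by
    rw [← integral_complex_ofReal]
    refine setIntegral_congr_fun measurableSet_Ioc (fun t ht => ?_)
    have hy' : y < 1 := hy
    have h0 : 0 ≤ 1 - y * t := by nlinarith [ht.1, ht.2]
    simp only [Complex.ofRealCLM_apply]
    push_cast [Complex.ofReal_cpow h0]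
    rfl
  rw [this]
  simp [w]

/-- `m`-dimensional Euclidean space. The coordinate `x₁` of the mathematical text is `x 0`. -/
abbrev Space (m : ℕ) : Type := EuclideanSpace ℝ (Fin m)

section Kernel

variable {m : ℕ} [NeZero m]

/-- The open half-space `x₁ > 0`. -/
def halfSpace (m : ℕ) [NeZero m] : Set (Space m) := {x | 0 < x 0}

/-- The hyperplane `x₁ = 0`. -/
def hyperplane (m : ℕ) [NeZero m] : Set (Space m) := {x | x 0 = 0}

/-- `r² = ∑ᵢ (xᵢ - ξᵢ)²`. -/
noncomputable def rSq (x ξ : Space m) : ℝ := ∑ i, (x i - ξ i) ^ 2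

/-- `r₁² = (x₁ + ξ₁)² + ∑_{i ≥ 2} (xᵢ - ξᵢ)²`. -/
noncomputable def r₁Sq (x ξ : Space m) : ℝ :=
  (x 0 + ξ 0) ^ 2 + ∑ i ∈ Finset.univ.erase 0, (x i - ξ i) ^ 2

/-- The normalizing constant
`k₁ = Γ(α) Γ(α + (m - 2) / 2) / (4 ^ (1 - α) π ^ (m / 2) Γ(2 α))`. -/
noncomputable def k₁ (m : ℕ) (α : ℝ) : ℝ :=
  Real.Gamma α * Real.Gamma (α + ((m : ℝ) - 2) / 2) /
    ((4 : ℝ) ^ (1 - α) * Real.pi ^ ((m : ℝ) / 2) * Real.Gamma (2 * α))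

/-- The fundamental solution
`q₁(x, ξ) = k₁ (r²) ^ (-α - (m - 2) / 2) F(α + (m - 2) / 2, α; 2 α; 1 - r₁² / r²)`
of `∑ᵢ u_{xᵢ xᵢ} + (2 α / x₁) u_{x₁} = 0`. -/
noncomputable def q₁ (α : ℝ) (x ξ : Space m) : ℝ :=
  k₁ m α * rSq x ξ ^ (-α - ((m : ℝ) - 2) / 2) *
    gaussHypergeometric (α + ((m : ℝ) - 2) / 2) α (2 * α) (1 - r₁Sq x ξ / rSq x ξ)

/-- The kernel `K₁(s, t) = s₁ ^ (2 α) ∂q₁(s, t) / ∂n_s`, where the normal derivative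
`∑ᵢ cos(n, sᵢ) ∂/∂sᵢ` is taken in the variable `s` along the unit normal `n s`. -/
noncomputable def K₁ (α : ℝ) (n : Space m → Space m) (s t : Space m) : ℝ :=
  s 0 ^ (2 * α) * fderiv ℝ (fun ξ => q₁ α ξ t) s (n s)

/-- The area measure on hypersurfaces: the `(m - 1)`-dimensional Hausdorff measure, normalized so
that it is Lebesgue measure on hyperplanes. -/
noncomputable def surfaceMeasure (m : ℕ) : Measure (Space m) := μHE[m - 1]

/-- The double-layer potential with density `μ` on the surface `Γ` with normal field `n`,
`w(x) = ∫_Γ ξ₁ ^ (2 α) μ(ξ) ∂q₁(ξ, x) / ∂n_ξ d_ξ Γ`. -/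
noncomputable def doubleLayer (α : ℝ) (Γ : Set (Space m)) (n : Space m → Space m)
    (μ : Space m → ℝ) (x : Space m) : ℝ :=
  ∫ ξ in Γ, ξ 0 ^ (2 * α) * μ ξ * fderiv ℝ (fun η => q₁ α η x) ξ (n ξ) ∂(surfaceMeasure m)

end Kernel

/-- `v` is the outer unit normal at `p` of the boundary of the open set `Ω`, which near `p` is a
hypersurface of class `C¹` with `Ω` on one side of it: near `p` the set `Ω` is the set of points
`p + y + s v`, with `y` orthogonal to `v`, for which `s < φ y`. Here `φ` is a real function
of class `C¹` near `0` on the hyperplane orthogonal to `v`, and `φ` and its derivative vanish at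
`0`. -/
def IsOuterUnitNormal {m : ℕ} (Ω : Set (Space m)) (p v : Space m) : Prop :=
  ‖v‖ = 1 ∧ ∃ φ : (ℝ ∙ v)ᗮ → ℝ, ContDiffAt ℝ 1 φ 0 ∧ φ 0 = 0 ∧ fderiv ℝ φ 0 = 0 ∧
    ∀ᶠ x in 𝓝 p, x ∈ Ω ↔ inner ℝ v (x - p) < φ ((ℝ ∙ v)ᗮ.orthogonalProjectionOnto (x - p))

/-- `Ω` is a bounded domain in the half-space `x₁ > 0` whose boundary consists of the closure of
an open part `Γ₁` of the hyperplane `x₁ = 0` and of a Lyapunov surface `Γ` in the half-space that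
approaches the hyperplane under a right angle; `n` is the outer unit normal on `Γ`. -/
structure IsLyapunovDomain {m : ℕ} [NeZero m] (Ω Γ₁ Γ : Set (Space m))
    (n : Space m → Space m) : Prop where
  isOpen : IsOpen Ω
  isConnected : IsConnected Ω
  isBounded : Bornology.IsBounded Ω
  subset_halfSpace : Ω ⊆ halfSpace m
  isOpen_flatPart : ∃ U : Set (Space m), IsOpen U ∧ Γ₁ = U ∩ hyperplane m
  surface_subset : Γ ⊆ halfSpace m
  frontier_eq : frontier Ω = closure Γ₁ ∪ Γ
  /-- There is a definite normal at each point of `Γ`. -/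
  normal : ∀ p ∈ Γ, IsOuterUnitNormal Ω p (n p)
  /-- The angle between the normals at two points at distance `r` is at most `a r ^ l`. -/
  lyapunov : ∃ a > (0 : ℝ), ∃ l > (0 : ℝ), ∀ x ∈ Γ, ∀ y ∈ Γ,
    InnerProductGeometry.angle (n x) (n y) ≤ a * dist x y ^ l
  /-- Where `Γ` approaches the hyperplane `x₁ = 0`, its normal becomes parallel to it. -/
  rightAngle : ∀ p ∈ closure Γ ∩ hyperplane m, Tendsto (fun x => n x 0) (𝓝[Γ] p) (𝓝 0)

end DoubleLayer

open DoubleLayer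

open scoped NNReal ENNReal

namespace DoubleLayer

/-! Euler's integral writes `q₁` as a superposition over `τ` in `(0, 1)` of the functions `(r² + 4
x₁ ξ₁ τ) ^ (-(α + (m - 2) / 2))`. Differentiating under the integral and applying Pfaff's
transformation to pull out the singular power of `r²` shows that the kernel is `-c s₁ ^ (2α) (⟨s -
x, n⟩ |s - x| ^ (-m) Φ₀ + 2 x₁ n₁ |s - x| ^ (2 - m) Φ₁)` with factors `Φ₀`, `Φ₁` that stay
continuous up to the pole (`fderiv_q₁_apply`, `continuousAt_kernelFactor`). The first term is the
classical double-layer kernel of the Laplacian times a continuous factor, and the second is weakly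
singular.

Near `t ∈ Γ` the surface is a `C^{1,l}` graph over the tangent hyperplane (`exists_graphChart`). In
graph coordinates `⟨s - x, n⟩`, multiplied by the area density, is minus the height of `x` above the
graph plus a Taylor remainder of order `1 + l` (`inner_point_sub`). The remainder and the second
term give weakly singular integrals that are continuous across the surface
(`tendsto_integral_weaklySingular`). The height term is a Poisson-type integral: after rescaling by
the height it concentrates at `t` (`tendsto_integral_poisson`), with a sign given by the side of
approach. Its mass is `1/2` in absolute value, by the choice of `k₁`
(`kernelConst_mul_kernelFactor`). For `x = t` the height is zero, so the direct value consists of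
the weakly singular terms alone and the jump is what the height term leaves.

The rest of `Γ` stays away from `t` and contributes continuously, by dominated convergence
(`tendsto_integral_far`). Since `Γ` may reach the hyperplane, where no graph is available, this
needs two global facts: `Γ` has finite area, because chords of the surface are nearly orthogonal to
nearby normals (`surfaceMeasure_lt_top`), and `s₁ ^ (2α) μ Φⱼ` is bounded on the compact set
`closure Γ` (`exists_bound_weightedFactor`). Surface integrals pass to graph coordinates by an area
formula for `C¹` immersions (`euclideanHausdorffMeasure_image_eq_lintegral`). -/

/-! ### Euler's integral and the gradient of the fundamental solution -/

/-- Pfaff's transformation, by the substitution `τ = A v / (A + B (1 - v))`, which maps `(0, 1)`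
onto itself. It exposes the power `A ^ (β - c)`; when `c - β - γ ≥ 0` the integrand that remains is
harmless as `A → 0`. -/
theorem integral_euler_moebius {β γ c A B : ℝ} (hA : 0 < A) (hB : 0 ≤ B) :
    ∫ τ in Ioo (0 : ℝ) 1, τ ^ (β - 1) * (1 - τ) ^ (γ - 1) * (A + B * τ) ^ (-c) =
      A ^ (β - c) * (A + B) ^ (γ - c) *
        ∫ v in Ioo (0 : ℝ) 1, v ^ (β - 1) * (1 - v) ^ (γ - 1) *
          (A + B * (1 - v)) ^ (c - β - γ) := by
  have hD : ∀ v ∈ Ioo (0 : ℝ) 1, 0 < A + B * (1 - v) := fun v hv => by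
    nlinarith [hv.1, hv.2, mul_nonneg hB (sub_nonneg.2 hv.2.le)]
  let f : ℝ → ℝ := fun v => A * v / (A + B * (1 - v))
  have hf : ∀ v ∈ Ioo (0 : ℝ) 1,
      HasDerivWithinAt f (A * (A + B) / (A + B * (1 - v)) ^ 2) (Ioo 0 1) v := by
    intro v hv
    have h1 : HasDerivAt (fun v : ℝ => A * v) A v := by
      simpa using (hasDerivAt_id v).const_mul A
    have h2 : HasDerivAt (fun v : ℝ => A + B * (1 - v)) (-B) v := by
      simpa using (((hasDerivAt_id v).const_sub 1).const_mul B).const_add A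
    have := (h1.div h2 (hD v hv).ne').hasDerivWithinAt (s := Ioo (0 : ℝ) 1)
    convert! this using 1
    ring
  have himg : f '' Ioo 0 1 = Ioo 0 1 := by
    ext τ
    constructor
    · rintro ⟨v, hv, rfl⟩
      refine ⟨div_pos (mul_pos hA hv.1) (hD v hv), ?_⟩
      simp only [f]
      rw [div_lt_one (hD v hv)]
      nlinarith [hv.1, hv.2]
    · rintro ⟨h0, h1⟩
      have hE : 0 < A + B * τ := by positivity
      -- The inverse Möbius map.
      refine ⟨(A + B) * τ / (A + B * τ), ⟨by positivity, ?_⟩, ?_⟩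
      · rw [div_lt_one hE]; nlinarith
      · have : A + B * (1 - (A + B) * τ / (A + B * τ)) = A * (A + B) / (A + B * τ) := by
          field_simp; ring
        simp only [f]
        rw [this]
        field_simp
  have hinj : InjOn f (Ioo 0 1) := by
    intro v hv w hw h
    simp only [f] at h
    rw [div_eq_div_iff (hD v hv).ne' (hD w hw).ne'] at h
    have : A * (A + B) * (v - w) = 0 := by linarith
    have h3 : A * (A + B) ≠ 0 := by positivity
    have := (mul_eq_zero.1 this).resolve_left h3
    linarith
  have key := integral_image_eq_integral_abs_deriv_smul measurableSet_Ioo hf hinj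
    (fun τ => τ ^ (β - 1) * (1 - τ) ^ (γ - 1) * (A + B * τ) ^ (-c))
  rw [himg] at key
  rw [key, ← integral_const_mul]
  refine setIntegral_congr_fun measurableSet_Ioo fun v hv => ?_
  have hd := hD v hv
  have hv0 := hv.1
  have hv1 : 0 < 1 - v := by linarith [hv.2]
  have hAB : 0 < A + B := by linarith
  have e1 : 1 - f v = (A + B) * (1 - v) / (A + B * (1 - v)) := by
    simp only [f]; field_simp; ring
  have e2 : A + B * f v = A * (A + B) / (A + B * (1 - v)) := by
    simp only [f]; field_simp; ring
  have e3 : |A * (A + B) / (A + B * (1 - v)) ^ 2| = A * (A + B) / (A + B * (1 - v)) ^ 2 :=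
    abs_of_nonneg (by positivity)
  simp only [smul_eq_mul]
  rw [e1, e2, e3]
  simp only [f]
  generalize A + B * (1 - v) = D at hd
  generalize 1 - v = u at hv1
  generalize A + B = S at hAB
  rw [Real.div_rpow (by positivity) hd.le, Real.div_rpow (by positivity) hd.le,
    Real.div_rpow (by positivity) hd.le, Real.mul_rpow hA.le hv0.le, Real.mul_rpow hAB.le hv1.le,
    Real.mul_rpow hA.le hAB.le]
  have hA' : A ^ (β - c) = A ^ (β - 1) * A ^ (-c) * A := by
    rw [← Real.rpow_add hA, ← Real.rpow_add_one hA.ne']; congr 1; ring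
  have hS' : S ^ (γ - c) = S ^ (γ - 1) * S ^ (-c) * S := by
    rw [← Real.rpow_add hAB, ← Real.rpow_add_one hAB.ne']; congr 1; ring
  have hD' : D ^ (c - β - γ) = (D ^ (β - 1) * D ^ (γ - 1) * D ^ (-c) * D ^ 2)⁻¹ := by
    rw [← Real.rpow_add hd, ← Real.rpow_add hd, ← Real.rpow_natCast, ← Real.rpow_add hd,
      ← Real.rpow_neg hd.le]
    congr 1; push_cast; ring
  rw [hA', hS', hD']
  field_simp

/-- The regular factor in Euler's integral after the Möbius substitution of
`integral_euler_moebius`. Absolute values make it continuous on the whole plane. -/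
noncomputable def eulerFactor (β γ e A B : ℝ) : ℝ :=
  ∫ v in Ioo (0 : ℝ) 1, v ^ (β - 1) * (1 - v) ^ (γ - 1) * (|A| + |B| * (1 - v)) ^ e

/-- Since `e ≥ 0`, the last factor is locally bounded even where its base vanishes, so a multiple of
the beta weight dominates. In particular the factor is continuous at `A = 0`, the pole of the
kernel. -/
theorem continuous_eulerFactor {β γ e : ℝ} (hβ : 0 < β) (hγ : 0 < γ) (he : 0 ≤ e) :
    Continuous fun p : ℝ × ℝ => eulerFactor β γ e p.1 p.2 := by
  have hw : IntegrableOn (fun v : ℝ => v ^ (β - 1) * (1 - v) ^ (γ - 1)) (Ioo 0 1) :=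
    (integrable_betaWeight hβ hγ).mono_set Ioo_subset_Ioc_self
  have hc : ∀ p : ℝ × ℝ, Continuous fun v : ℝ => (|p.1| + |p.2| * (1 - v)) ^ e := fun p =>
    Continuous.rpow_const (by fun_prop) fun _ => Or.inr he
  rw [continuous_iff_continuousAt]
  intro p₀
  have hnear : ∀ᶠ p : ℝ × ℝ in 𝓝 p₀, |p.1| + |p.2| < |p₀.1| + |p₀.2| + 1 :=
    (Continuous.tendsto (f := fun p : ℝ × ℝ => |p.1| + |p.2|) (by fun_prop) p₀).eventually_lt_const
      (by linarith)
  refine continuousAt_of_dominated (bound := fun v => v ^ (β - 1) * (1 - v) ^ (γ - 1) *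
    (|p₀.1| + |p₀.2| + 1) ^ e) ?_ ?_ (hw.mul_const _) ?_
  · exact Eventually.of_forall fun p => hw.1.mul (hc p).aestronglyMeasurable
  · filter_upwards [hnear] with p hp
    refine ae_restrict_of_forall_mem measurableSet_Ioo fun v hv => ?_
    have h1 : 0 ≤ 1 - v := by linarith [hv.2]
    have h2 : 0 ≤ |p.1| + |p.2| * (1 - v) := by positivity
    have h0 := hv.1.le
    rw [Real.norm_of_nonneg (by positivity)]
    refine mul_le_mul_of_nonneg_left (Real.rpow_le_rpow h2 ?_ he) (by positivity)
    have : |p.2| * (1 - v) ≤ |p.2| := mul_le_of_le_one_right (abs_nonneg _) (by linarith [hv.1])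
    linarith
  · refine ae_restrict_of_forall_mem measurableSet_Ioo fun v hv => ?_
    exact continuousAt_const.mul (ContinuousAt.rpow_const (by fun_prop) (Or.inr he))

/-- At `A = 0` the factor `(B (1 - v)) ^ e` merges with the weight into a beta integral. This value
fixes the size of the jump. -/
theorem eulerFactor_zero_left {β γ e B : ℝ} (hβ : 0 < β) (hγe : 0 < γ + e) (hB : 0 < B) :
    eulerFactor β γ e 0 B =
      B ^ e * (Real.Gamma β * Real.Gamma (γ + e) / Real.Gamma (β + (γ + e))) := by
  rw [eulerFactor, ← integral_betaWeight hβ hγe, integral_Ioc_eq_integral_Ioo,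
    ← integral_const_mul]
  refine setIntegral_congr_fun measurableSet_Ioo fun v hv => ?_
  have h1 : 0 < 1 - v := by linarith [hv.2]
  simp only [abs_zero, zero_add, abs_of_pos hB]
  rw [Real.mul_rpow hB.le h1.le, show γ + e - 1 = (γ - 1) + e by ring, Real.rpow_add h1]
  ring

/-- The regular factors of the kernel: for `j = 0` of the Laplacian part, for `j = 1` of the
remainder. -/
noncomputable def kernelFactor (m : ℕ) (α : ℝ) (j : ℝ) (A B : ℝ) : ℝ :=
  (|A| + |B|) ^ (-((m : ℝ) / 2)) * eulerFactor (α + j) α ((m : ℝ) / 2 - j - α) A B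

/-- Only the negative power of `|A| + |B|` excludes the origin. For `A = |s - x|²` and `B = 4 s₁ x₁`
with `x₁ > 0` the origin is never reached, since `A = 0` forces `B = 4 x₁²`. -/
theorem continuousAt_kernelFactor {m : ℕ} {α j : ℝ} (hα : 0 < α) (hj : 0 ≤ j)
    (hjm : j + α ≤ (m : ℝ) / 2) {p : ℝ × ℝ} (hp : p ≠ 0) :
    ContinuousAt (fun p : ℝ × ℝ => kernelFactor m α j p.1 p.2) p := by
  refine ContinuousAt.mul (ContinuousAt.rpow_const (by fun_prop) (Or.inl ?_))
    (continuous_eulerFactor (by linarith) hα (by linarith)).continuousAt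
  intro h
  have h1 := abs_nonneg p.1
  have h2 := abs_nonneg p.2
  exact hp (Prod.ext (abs_eq_zero.1 (by linarith)) (abs_eq_zero.1 (by linarith)))

theorem integral_euler_eq_kernelFactor {m : ℕ} {α j A B : ℝ} (hA : 0 < A) (hB : 0 ≤ B) :
    ∫ τ in Ioo (0 : ℝ) 1, τ ^ (α + j - 1) * (1 - τ) ^ (α - 1) *
        (A + B * τ) ^ (-(α + (m : ℝ) / 2)) =
      A ^ (j - (m : ℝ) / 2) * kernelFactor m α j A B := by
  rw [integral_euler_moebius hA hB, kernelFactor, eulerFactor, abs_of_pos hA, abs_of_nonneg hB]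
  rw [show α + j - (α + (m : ℝ) / 2) = j - m / 2 by ring,
    show α - (α + (m : ℝ) / 2) = -(m / 2) by ring,
    show α + (m : ℝ) / 2 - (α + j) - α = m / 2 - j - α by ring]
  ring

theorem rSq_eq_norm_sq {m : ℕ} (x ξ : Space m) : rSq x ξ = ‖x - ξ‖ ^ 2 := by
  rw [EuclideanSpace.norm_sq_eq]
  simp [rSq, sq_abs]

theorem r₁Sq_eq {m : ℕ} [NeZero m] (x ξ : Space m) : r₁Sq x ξ = ‖x - ξ‖ ^ 2 + 4 * x 0 * ξ 0 := by
  rw [← rSq_eq_norm_sq, rSq, r₁Sq, ← Finset.add_sum_erase _ _ (Finset.mem_univ (0 : Fin m))]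
  ring

/-- As `r₁² = r² + 4 x₁ ξ₁`, the base `1 - z τ` of Euler's integral equals `(r² + 4 x₁ ξ₁ τ) / r²`,
and the powers of `r²` cancel. -/
theorem q₁_eq_integral {m : ℕ} [NeZero m] {α : ℝ} {x ξ : Space m} (hx : 0 ≤ x 0) (hξ : 0 ≤ ξ 0)
    (hne : x ≠ ξ) :
    q₁ α x ξ = k₁ m α * (Real.Gamma (2 * α) / (Real.Gamma α * Real.Gamma α)) *
      ∫ τ in Ioo (0 : ℝ) 1, τ ^ (α - 1) * (1 - τ) ^ (α - 1) *
        (‖x - ξ‖ ^ 2 + 4 * x 0 * ξ 0 * τ) ^ (-(α + ((m : ℝ) - 2) / 2)) := by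
  have hr : 0 < ‖x - ξ‖ := norm_pos_iff.2 (sub_ne_zero.2 hne)
  rw [q₁, gaussHypergeometric, intervalIntegral.integral_of_le zero_le_one,
    integral_Ioc_eq_integral_Ioo, show 2 * α - α = α by ring, r₁Sq_eq, rSq_eq_norm_sq,
    mul_assoc (k₁ m α), mul_assoc (k₁ m α)]
  congr 1
  rw [mul_left_comm, ← integral_const_mul]
  congr 1
  refine setIntegral_congr_fun measurableSet_Ioo fun τ hτ => ?_
  have h0 : 0 ≤ 4 * x 0 * ξ 0 * τ := mul_nonneg (by positivity) hτ.1.le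
  have e : 1 - (1 - (‖x - ξ‖ ^ 2 + 4 * x 0 * ξ 0) / ‖x - ξ‖ ^ 2) * τ =
      (‖x - ξ‖ ^ 2 + 4 * x 0 * ξ 0 * τ) / ‖x - ξ‖ ^ 2 := by
    field_simp; ring
  simp only []
  rw [e, Real.div_rpow (by positivity) (by positivity),
    show -α - ((m : ℝ) - 2) / 2 = -(α + ((m : ℝ) - 2) / 2) by ring]
  have : (‖x - ξ‖ ^ 2) ^ (-(α + ((m : ℝ) - 2) / 2)) ≠ 0 := (Real.rpow_pos_of_pos (by positivity) _).ne'
  field_simp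

set_option maxHeartbeats 1000000 in
-- Differentiation under the integral. The derivative of `4 ξ₁ x₁ τ` brings down a factor `τ`, which
-- raises the first beta exponent from `α` to `α + 1`; this is the term that will be less singular.
theorem hasFDerivAt_integral_euler {m : ℕ} [NeZero m] {α a : ℝ} (hα : 0 < α) (ha : 0 < a)
    {s x : Space m} (hs : 0 < s 0) (hx : 0 < x 0) (hne : s ≠ x) :
    HasFDerivAt (fun ξ : Space m => ∫ τ in Ioo (0 : ℝ) 1, τ ^ (α - 1) * (1 - τ) ^ (α - 1) *
        (‖ξ - x‖ ^ 2 + 4 * ξ 0 * x 0 * τ) ^ (-a))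
      ((-(2 * a) * ∫ τ in Ioo (0 : ℝ) 1, τ ^ (α - 1) * (1 - τ) ^ (α - 1) *
          (‖s - x‖ ^ 2 + 4 * s 0 * x 0 * τ) ^ (-(a + 1))) • innerSL ℝ (s - x) +
        (-(4 * a * x 0) * ∫ τ in Ioo (0 : ℝ) 1, τ ^ (α + 1 - 1) * (1 - τ) ^ (α - 1) *
          (‖s - x‖ ^ 2 + 4 * s 0 * x 0 * τ) ^ (-(a + 1))) •
            (EuclideanSpace.proj 0 : Space m →L[ℝ] ℝ)) s := by
  let w : ℝ → ℝ := fun τ => τ ^ (α - 1) * (1 - τ) ^ (α - 1)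
  have hw : IntegrableOn w (Ioo 0 1) :=
    (integrable_betaWeight hα hα).mono_set Ioo_subset_Ioc_self
  let b : Space m → ℝ → ℝ := fun ξ τ => ‖ξ - x‖ ^ 2 + 4 * ξ 0 * x 0 * τ
  -- Half the distance to the pole: on the ball of radius `d` the base of the power is at least `d ^
  -- 2`, which gives one majorant for all `ξ`.
  set d := ‖s - x‖ / 2 with hd
  have hd0 : 0 < d := by
    have := norm_pos_iff.2 (sub_ne_zero.2 hne)
    positivity
  let U : Set (Space m) := {ξ | 0 < ξ 0} ∩ Metric.ball s d
  have hU : U ∈ 𝓝 s := by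
    refine inter_mem ((isOpen_lt continuous_const (by fun_prop)).mem_nhds hs)
      (Metric.ball_mem_nhds s hd0)
  have hdist : ∀ ξ ∈ U, d ≤ ‖ξ - x‖ ∧ ‖ξ - x‖ ≤ 3 * d := by
    rintro ξ ⟨-, hξ⟩
    rw [mem_ball_iff_norm] at hξ
    have h1 : ‖s - x‖ ≤ ‖ξ - x‖ + ‖ξ - s‖ := by
      have := norm_sub_le (ξ - x) (ξ - s); rwa [sub_sub_sub_cancel_left] at this
    have h2 : ‖ξ - x‖ ≤ ‖ξ - s‖ + ‖s - x‖ := norm_sub_le_norm_sub_add_norm_sub ξ s x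
    have : ‖s - x‖ = 2 * d := by rw [hd]; ring
    constructor <;> linarith
  have hb : ∀ ξ ∈ U, ∀ τ ∈ Ioo (0 : ℝ) 1, d ^ 2 ≤ b ξ τ := by
    intro ξ hξ τ hτ
    have h1 := (hdist ξ hξ).1
    have h2 : 0 < ξ 0 := hξ.1
    have h3 : 0 ≤ 4 * ξ 0 * x 0 * τ := by have := hτ.1; positivity
    have : d ^ 2 ≤ ‖ξ - x‖ ^ 2 := by gcongr
    simp only [b]; linarith
  have hbpos : ∀ ξ ∈ U, ∀ τ ∈ Ioo (0 : ℝ) 1, 0 < b ξ τ := fun ξ hξ τ hτ =>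
    lt_of_lt_of_le (by positivity) (hb ξ hξ τ hτ)
  have hsU : s ∈ U := mem_of_mem_nhds hU
  have hmeas : ∀ ξ ∈ U, ∀ e : ℝ, AEStronglyMeasurable (fun τ => b ξ τ ^ e)
      (volume.restrict (Ioo 0 1)) := by
    intro ξ hξ e
    refine ContinuousOn.aestronglyMeasurable ?_ measurableSet_Ioo
    exact ContinuousOn.rpow_const (by simp only [b]; fun_prop) fun τ hτ =>
      Or.inl (hbpos ξ hξ τ hτ).ne'
  have hbd : ∀ ξ ∈ U, ∀ e : ℝ, 0 ≤ e → ∀ τ ∈ Ioo (0 : ℝ) 1, b ξ τ ^ (-e) ≤ (d ^ 2) ^ (-e) :=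
    fun ξ hξ e he τ hτ =>
      Real.rpow_le_rpow_of_nonpos (by positivity) (hb ξ hξ τ hτ) (by linarith)
  have hint : ∀ ξ ∈ U, ∀ e : ℝ, 0 ≤ e →
      IntegrableOn (fun τ => w τ * b ξ τ ^ (-e)) (Ioo 0 1) := by
    intro ξ hξ e he
    refine Integrable.mono' (hw.norm.mul_const ((d ^ 2) ^ (-e))) (hw.1.mul (hmeas ξ hξ _)) ?_
    refine ae_restrict_of_forall_mem measurableSet_Ioo fun τ hτ => ?_
    rw [norm_mul, Real.norm_of_nonneg (Real.rpow_nonneg (hbpos ξ hξ τ hτ).le _)]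
    exact mul_le_mul_of_nonneg_left (hbd ξ hξ e he τ hτ) (norm_nonneg _)
  have hint1 : ∀ ξ ∈ U, ∀ e : ℝ, 0 ≤ e →
      IntegrableOn (fun τ => w τ * b ξ τ ^ (-e) * τ) (Ioo 0 1) := by
    intro ξ hξ e he
    refine Integrable.mono' (hint ξ hξ e he).norm ((hint ξ hξ e he).1.mul
      aestronglyMeasurable_id) ?_
    refine ae_restrict_of_forall_mem measurableSet_Ioo fun τ hτ => ?_
    rw [norm_mul, Real.norm_of_nonneg hτ.1.le]
    exact mul_le_of_le_one_right (norm_nonneg _) hτ.2.le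
  let F' : Space m → ℝ → Space m →L[ℝ] ℝ := fun ξ τ =>
    (w τ * b ξ τ ^ (-(a + 1))) • ((-(2 * a)) • innerSL ℝ (ξ - x)) +
      (w τ * b ξ τ ^ (-(a + 1)) * τ) • ((-(4 * a * x 0)) • EuclideanSpace.proj 0)
  have hF'int : ∀ ξ ∈ U, Integrable (F' ξ) (volume.restrict (Ioo 0 1)) := by
    intro ξ hξ
    have h1 := (hint ξ hξ (a + 1) (by linarith)).smul_const
      ((-(2 * a)) • innerSL ℝ (ξ - x) : Space m →L[ℝ] ℝ)
    have h2 := (hint1 ξ hξ (a + 1) (by linarith)).smul_const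
      ((-(4 * a * x 0)) • EuclideanSpace.proj 0 : Space m →L[ℝ] ℝ)
    exact h1.add h2
  have hproj : ‖(EuclideanSpace.proj 0 : Space m →L[ℝ] ℝ)‖ ≤ 1 := by
    refine ContinuousLinearMap.opNorm_le_bound _ zero_le_one fun y => ?_
    simpa using PiLp.norm_apply_le y 0
  have key := hasFDerivAt_integral_of_dominated_of_fderiv_le
    (μ := volume.restrict (Ioo (0 : ℝ) 1)) (F := fun ξ τ => w τ * b ξ τ ^ (-a)) (F' := F')
    (x₀ := s) (s := U)
    (bound := fun τ => ‖w τ‖ * ((d ^ 2) ^ (-(a + 1)) * (2 * a * (3 * d) + 4 * a * x 0)))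
    hU (by filter_upwards [hU] with ξ hξ using hw.1.mul (hmeas ξ hξ _)) (hint s hsU a ha.le)
    (hF'int s hsU).1 ?_ (hw.norm.mul_const _) ?_
  · convert! key using 1
    simp only [F']
    rw [integral_add ((hint s hsU _ (by linarith)).smul_const _)
      ((hint1 s hsU _ (by linarith)).smul_const _), integral_smul_const, integral_smul_const,
      smul_smul, smul_smul]
    congr 2
    · rw [mul_comm]
    · rw [mul_comm]
      congr 1
      refine setIntegral_congr_fun measurableSet_Ioo fun τ hτ => ?_
      have : τ ^ (α + 1 - 1) = τ ^ (α - 1) * τ := by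
        rw [← Real.rpow_add_one hτ.1.ne']; congr 1; ring
      simp only [w, b]
      rw [this]; ring
  · refine ae_restrict_of_forall_mem measurableSet_Ioo fun τ hτ ξ hξ => ?_
    have h1 := hbd ξ hξ (a + 1) (by linarith) τ hτ
    have h2 := Real.rpow_nonneg (hbpos ξ hξ τ hτ).le (-(a + 1))
    have h3 := (hdist ξ hξ).2
    have e : F' ξ τ = (w τ * b ξ τ ^ (-(a + 1))) • ((-(2 * a)) • innerSL ℝ (ξ - x) +
        (τ * (-(4 * a * x 0))) • EuclideanSpace.proj 0) := by
      simp only [F', smul_add, smul_smul, mul_assoc]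
    rw [e, norm_smul, norm_mul, mul_assoc, Real.norm_of_nonneg h2]
    refine mul_le_mul_of_nonneg_left (mul_le_mul h1 ?_ (norm_nonneg _) (by positivity))
      (norm_nonneg _)
    refine (norm_add_le _ _).trans (add_le_add ?_ ?_)
    · rw [norm_smul, innerSL_apply_norm, norm_neg, Real.norm_of_nonneg (by positivity)]
      gcongr
    · rw [norm_smul, norm_mul, norm_neg, Real.norm_of_nonneg hτ.1.le,
        Real.norm_of_nonneg (by positivity)]
      calc τ * (4 * a * x 0) * _ ≤ 1 * (4 * a * x 0) * 1 := by
            have := hτ.2.le; gcongr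
        _ = _ := by ring
  · refine ae_restrict_of_forall_mem measurableSet_Ioo fun τ hτ ξ hξ => ?_
    have h1 : HasFDerivAt (fun ξ : Space m => ‖ξ - x‖ ^ 2) ((2 : ℝ) • innerSL ℝ (ξ - x)) ξ := by
      have := ((hasFDerivAt_id ξ).sub_const x).norm_sq
      convert! this using 1
      ext y; simp
    have h2 : HasFDerivAt (fun ξ : Space m => 4 * ξ 0 * x 0 * τ)
        ((4 * x 0 * τ) • (EuclideanSpace.proj 0 : Space m →L[ℝ] ℝ)) ξ := by
      have := (EuclideanSpace.proj 0 : Space m →L[ℝ] ℝ).hasFDerivAt (x := ξ) |>.const_smul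
        (4 * x 0 * τ)
      refine this.congr_of_eventuallyEq (Eventually.of_forall fun y => ?_)
      simp; ring
    have h3 := ((h1.add h2).rpow_const (p := -a) (Or.inl (hbpos ξ hξ τ hτ).ne')).const_mul (w τ)
    convert! h3 using 1
    ext y
    simp only [F', b, _root_.add_apply, _root_.smul_apply, smul_eq_mul,
      Pi.add_apply, show -a - 1 = -(a + 1) by ring]
    ring

/-- The constant in the formula for the gradient of the fundamental solution. -/
noncomputable def kernelConst (m : ℕ) (α : ℝ) : ℝ :=
  2 * Real.Gamma (α + (m : ℝ) / 2) /
    ((4 : ℝ) ^ (1 - α) * Real.pi ^ ((m : ℝ) / 2) * Real.Gamma α)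

/-- The two terms come from differentiating `r²` and `4 s₁ x₁ τ`. Pfaff's transformation with first
beta exponent `α + j`, `j = 0, 1`, extracts `(r²) ^ (j - m / 2)`, so the second term gains two
orders. The factor `a` from the derivative joins `Γ(a)` to give `Γ(α + m / 2)`. -/
theorem fderiv_q₁_apply {m : ℕ} [NeZero m] (hm : 2 < m) {α : ℝ} (hα : 0 < α)
    {s x : Space m} (hs : 0 < s 0) (hx : 0 < x 0) (hne : s ≠ x) (e : Space m) :
    fderiv ℝ (fun ξ => q₁ α ξ x) s e = -kernelConst m α *
      (inner ℝ (s - x) e * ‖s - x‖ ^ (-(m : ℝ)) *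
          kernelFactor m α 0 (‖s - x‖ ^ 2) (4 * s 0 * x 0) +
        2 * x 0 * e 0 * ‖s - x‖ ^ (2 - (m : ℝ)) *
          kernelFactor m α 1 (‖s - x‖ ^ 2) (4 * s 0 * x 0)) := by
  have hm' : (2 : ℝ) < m := by exact_mod_cast hm
  set a := α + ((m : ℝ) - 2) / 2 with ha
  have ha0 : 0 < a := by rw [ha]; linarith
  have hr : 0 < ‖s - x‖ := norm_pos_iff.2 (sub_ne_zero.2 hne)
  have hev : (fun ξ => q₁ α ξ x) =ᶠ[𝓝 s] fun ξ =>
      k₁ m α * (Real.Gamma (2 * α) / (Real.Gamma α * Real.Gamma α)) *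
      ∫ τ in Ioo (0 : ℝ) 1, τ ^ (α - 1) * (1 - τ) ^ (α - 1) *
        (‖ξ - x‖ ^ 2 + 4 * ξ 0 * x 0 * τ) ^ (-a) := by
    filter_upwards [(isOpen_lt continuous_const (by fun_prop : Continuous fun ξ : Space m => ξ 0)
      ).mem_nhds hs, isOpen_ne.mem_nhds hne] with ξ h1 h2
    exact q₁_eq_integral (le_of_lt h1) hx.le h2
  have hd := ((hasFDerivAt_integral_euler hα ha0 hs hx hne).const_mul
    (k₁ m α * (Real.Gamma (2 * α) / (Real.Gamma α * Real.Gamma α)))).congr_of_eventuallyEq hev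
  have hA : 0 < ‖s - x‖ ^ 2 := by positivity
  have hB : 0 ≤ 4 * s 0 * x 0 := by positivity
  have i0 := integral_euler_eq_kernelFactor (m := m) (α := α) (j := 0) hA hB
  have i1 := integral_euler_eq_kernelFactor (m := m) (α := α) (j := 1) hA hB
  have ha1 : a + 1 = α + (m : ℝ) / 2 := by rw [ha]; ring
  have hpow : ∀ j : ℝ, (‖s - x‖ ^ 2) ^ (j - (m : ℝ) / 2) = ‖s - x‖ ^ (2 * j - m) := by
    intro j
    rw [← Real.rpow_natCast, ← Real.rpow_mul hr.le]
    congr 1; push_cast; ring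
  rw [hpow, add_zero] at i0
  rw [hpow] at i1
  rw [hd.fderiv, ha1, i0, i1]
  have hΓ : Real.Gamma (α + (m : ℝ) / 2) = a * Real.Gamma a := by
    rw [← ha1, Real.Gamma_add_one ha0.ne']
  have h1 := (Real.Gamma_pos_of_pos hα).ne'
  have h2 := (Real.Gamma_pos_of_pos (by linarith : 0 < 2 * α)).ne'
  have h3 : (4 : ℝ) ^ (1 - α) ≠ 0 := by positivity
  have h4 : Real.pi ^ ((m : ℝ) / 2) ≠ 0 := by positivity
  simp only [_root_.add_apply, _root_.smul_apply, smul_eq_mul,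
    innerSL_apply_apply, PiLp.proj_apply, k₁, kernelConst, hΓ, ← ha,
    show 2 * (0 : ℝ) - m = -m by ring, show 2 * (1 : ℝ) - m = 2 - m by ring]
  field_simp
  ring

/-! ### The mass of the Poisson kernel -/

/-- Write `Γ(M) (1 + |z|²) ^ (-M)` as a Gamma integral in `u` and exchange the integrals. The
Gaussian integral in `z` is `(π / u) ^ ((m - 1) / 2)`, and what remains is `Γ(1/2) = √π`. -/
theorem integral_one_add_norm_sq_rpow {m : ℕ} (hm : 2 < m) :
    ∫ z : EuclideanSpace ℝ (Fin (m - 1)), (1 + ‖z‖ ^ 2) ^ (-((m : ℝ) / 2)) =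
      Real.pi ^ ((m : ℝ) / 2) / Real.Gamma ((m : ℝ) / 2) := by
  have hm' : (2 : ℝ) < m := by exact_mod_cast hm
  have hk : ((m - 1 : ℕ) : ℝ) = m - 1 := by
    rw [Nat.cast_sub (by omega)]; simp
  set M := (m : ℝ) / 2 with hM
  have hM0 : 0 < M := by rw [hM]; linarith
  let f : EuclideanSpace ℝ (Fin (m - 1)) → ℝ → ℝ := fun z u =>
    u ^ (M - 1) * Real.exp (-((1 + ‖z‖ ^ 2) * u))
  have hf : Measurable (Function.uncurry f) := by
    simp only [f, Function.uncurry_def]; fun_prop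
  have hz : ∀ z, ∫ u in Ioi (0 : ℝ), f z u = Real.Gamma M * (1 + ‖z‖ ^ 2) ^ (-M) := by
    intro z
    rw [Real.integral_rpow_mul_exp_neg_mul_Ioi hM0 (by positivity), one_div,
      Real.inv_rpow (by positivity), Real.rpow_neg (by positivity), mul_comm]
  have hfu : ∀ (z : EuclideanSpace ℝ (Fin (m - 1))) (u : ℝ),
      f z u = u ^ (M - 1) * Real.exp (-u) * Real.exp (-u * ‖z‖ ^ 2) := by
    intro z u
    rw [mul_assoc, ← Real.exp_add]; simp only [f]; ring_nf
  have hgauss : ∀ u : ℝ, 0 < u → Integrable fun z : EuclideanSpace ℝ (Fin (m - 1)) =>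
      Real.exp (-u * ‖z‖ ^ 2) := by
    intro u hu
    have := (GaussianFourier.integrable_cexp_neg_mul_sq_norm_add
      (V := EuclideanSpace ℝ (Fin (m - 1))) (b := (u : ℂ)) (by simpa using hu) 0 0).re
    refine this.congr (Eventually.of_forall fun z => ?_)
    simp only [zero_mul, add_zero, RCLike.re_to_complex]
    norm_cast
  have hu : ∀ u ∈ Ioi (0 : ℝ), ∫ z, f z u = Real.pi ^ (M - 1 / 2) * (Real.exp (-u) * u ^ ((1 / 2 : ℝ) - 1)) := by
    intro u hu
    have hu : 0 < u := hu
    simp_rw [hfu]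
    rw [integral_const_mul, GaussianFourier.integral_rexp_neg_mul_sq_norm hu,
      finrank_euclideanSpace_fin, hk, Real.div_rpow Real.pi_pos.le hu.le]
    have : u ^ ((1 / 2 : ℝ) - 1) = u ^ (M - 1) / u ^ (((m : ℝ) - 1) / 2) := by
      rw [← Real.rpow_sub hu]; congr 1; rw [hM]; ring
    rw [this, show M - 1 / 2 = ((m : ℝ) - 1) / 2 by rw [hM]; ring]
    ring
  have hint : Integrable (Function.uncurry f) (volume.prod (volume.restrict (Ioi 0))) := by
    rw [integrable_prod_iff' hf.aestronglyMeasurable]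
    constructor
    · refine ae_restrict_of_forall_mem measurableSet_Ioi fun u hu => ?_
      simp only [Function.uncurry_apply_pair, hfu]
      exact (hgauss u hu).const_mul _
    · have h1 : IntegrableOn (fun u : ℝ => Real.pi ^ (M - 1 / 2) *
          (Real.exp (-u) * u ^ ((1 / 2 : ℝ) - 1))) (Ioi 0) :=
        (Real.GammaIntegral_convergent (by norm_num)).const_mul _
      refine h1.congr (ae_restrict_of_forall_mem measurableSet_Ioi fun u hu' => ?_)
      simp only [← hu u hu', Function.uncurry_apply_pair]
      refine integral_congr_ae (Eventually.of_forall fun z => ?_)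
      have : 0 < u := hu'
      exact (Real.norm_of_nonneg (by simp only [f]; positivity)).symm
  have hswap := integral_integral_swap hint
  simp_rw [hz] at hswap
  rw [integral_const_mul, setIntegral_congr_fun measurableSet_Ioi hu, integral_const_mul,
    ← Real.Gamma_eq_integral (by norm_num), Real.Gamma_one_half_eq, Real.sqrt_eq_rpow,
    ← Real.rpow_add Real.pi_pos, sub_add_cancel] at hswap
  rw [← hswap]
  field_simp [(Real.Gamma_pos_of_pos hM0).ne']

/-! ### Hausdorff measure and the area formula -/

/-- The distance inequality makes `f` factor through `h` by a `K`-Lipschitz map on `h '' A`. It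
serves to compare an immersion with its differential, and a surface with its projection to a
hyperplane. -/
theorem euclideanHausdorffMeasure_image_le {X Y Z : Type*} [MetricSpace Y] [MeasurableSpace Y]
    [BorelSpace Y] [MetricSpace Z] [MeasurableSpace Z] [BorelSpace Z] {f : X → Y} {h : X → Z}
    {A : Set X} {K : ℝ≥0} (hfh : ∀ a ∈ A, ∀ b ∈ A, dist (f a) (f b) ≤ K * dist (h a) (h b))
    (d : ℕ) : μHE[d] (f '' A) ≤ (K : ℝ≥0∞) ^ d * μHE[d] (h '' A) := by
  rcases A.eq_empty_or_nonempty with rfl | ⟨a₀, ha₀⟩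
  · simp
  have : Nonempty X := ⟨a₀⟩
  let p : Z → X := Function.invFunOn h A
  have hp : ∀ a ∈ A, p (h a) ∈ A ∧ h (p (h a)) = h a := fun a ha =>
    ⟨Function.invFunOn_mem ⟨a, ha, rfl⟩, Function.invFunOn_eq ⟨a, ha, rfl⟩⟩
  have himg : f '' A = (f ∘ p) '' (h '' A) := by
    rw [image_image]
    refine image_congr fun a ha => ?_
    have := hfh a ha _ (hp a ha).1
    rw [(hp a ha).2, dist_self, mul_zero] at this
    exact dist_le_zero.1 this
  have hlip : LipschitzOnWith K (f ∘ p) (h '' A) := by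
    refine LipschitzOnWith.of_dist_le_mul ?_
    rintro _ ⟨a, ha, rfl⟩ _ ⟨b, hb, rfl⟩
    have := hfh _ (hp a ha).1 _ (hp b hb).1
    rwa [(hp a ha).2, (hp b hb).2] at this
  have := hlip.hausdorffMeasure_image_le (d := d) (by positivity)
  rw [himg, Measure.euclideanHausdorffMeasure_def, Measure.euclideanHausdorffMeasure_def,
    Measure.smul_apply, Measure.smul_apply]
  rw [ENNReal.rpow_natCast] at this
  rw [ENNReal.smul_def, ENNReal.smul_def, smul_eq_mul, smul_eq_mul, mul_left_comm]
  gcongr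

/-- The images of an orthonormal basis have Gram matrix `1 + u uᵀ`, whose determinant is `1 + |u|²`
by the matrix determinant lemma. -/
theorem normDet_graph {E F : Type*} [NormedAddCommGroup E] [InnerProductSpace ℝ E]
    [FiniteDimensional ℝ E] [NormedAddCommGroup F] [InnerProductSpace ℝ F] (ι : E →ₗᵢ[ℝ] F)
    {v : F} (hv : ‖v‖ = 1) (hιv : ∀ y, inner ℝ v (ι y) = 0)
    (u : E) :
    (ι.toContinuousLinearMap + (innerSL ℝ u).smulRight v : E →ₗ[ℝ] F).normDet =
      √(1 + ‖u‖ ^ 2) := by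
  set T : E →ₗ[ℝ] F := (ι.toContinuousLinearMap + (innerSL ℝ u).smulRight v : E →ₗ[ℝ] F)
  have hTy : ∀ y, T y = ι y + inner ℝ u y • v := fun y => rfl
  have hT : ∀ y z, inner ℝ (T y) (T z) = inner ℝ y z + inner ℝ u y * inner ℝ u z := by
    intro y z
    have hvv : inner ℝ v v = (1 : ℝ) := by rw [real_inner_self_eq_norm_sq, hv, one_pow]
    rw [hTy, hTy, inner_add_left, inner_add_right, inner_add_right, real_inner_smul_left,
      real_inner_smul_left, real_inner_smul_right, real_inner_smul_right, hιv, hvv,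
      real_inner_comm v (ι y), hιv, ι.inner_map_map]
    ring
  have h := T.normDet_sq_eq_det_gram (stdOrthonormalBasis ℝ E)
  set b := stdOrthonormalBasis ℝ E
  have hgram : Matrix.gram ℝ (fun i => T (b i)) =
      1 + Matrix.replicateCol Unit (fun i => inner ℝ u (b i)) *
        Matrix.replicateRow Unit (fun i => inner ℝ u (b i)) := by
    ext i j
    rw [Matrix.gram_apply, hT, Matrix.add_apply, Matrix.mul_apply]
    simp [Matrix.one_apply, orthonormal_iff_ite.1 b.orthonormal i j]
  rw [hgram, Matrix.det_one_add_replicateCol_mul_replicateRow] at h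
  have hs : (fun i => inner ℝ u (b i)) ⬝ᵥ (fun i => inner ℝ u (b i)) = ‖u‖ ^ 2 := by
    rw [← b.sum_sq_norm_inner_left u]
    simp [dotProduct, sq]
  rw [hs] at h
  rw [eq_comm, Real.sqrt_eq_iff_mul_self_eq (by positivity) T.normDet_nonneg, ← sq]
  simpa using h.symm

section Area

variable {E F : Type*} [NormedAddCommGroup E] [InnerProductSpace ℝ E] [FiniteDimensional ℝ E]
  [MeasurableSpace E] [BorelSpace E] [NormedAddCommGroup F] [InnerProductSpace ℝ F]
  [MeasurableSpace F] [BorelSpace F]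

/-- Strict differentiability makes distances under `g` and under its differential `T` agree up to
the factor `d`, hence the `k`-dimensional measures of images agree up to `d ^ k`. One more factor
`d` pays for the variation of `J`. -/
theorem exists_nhds_area_bounds {g : E → F} {T : E →L[ℝ] F} {J : E → ℝ} {y₀ : E}
    (hg : HasStrictFDerivAt g T y₀) (hT : Function.Injective T)
    (hJT : J y₀ = (T : E →ₗ[ℝ] F).normDet) (hJ : ContinuousAt J y₀) {d : ℝ≥0} (hd : 1 < d) :
    ∃ V ∈ 𝓝 y₀, ∀ A ⊆ V, MeasurableSet A →
      μHE[Module.finrank ℝ E] (g '' A) ≤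
        (d : ℝ≥0∞) ^ (Module.finrank ℝ E + 1) * ∫⁻ y in A, ENNReal.ofReal (J y) ∧
      ∫⁻ y in A, ENNReal.ofReal (J y) ≤
        (d : ℝ≥0∞) ^ (Module.finrank ℝ E + 1) * μHE[Module.finrank ℝ E] (g '' A) := by
  set k := Module.finrank ℝ E
  have hd' : (1 : ℝ) < d := hd
  have hd0 : (0 : ℝ) < d := by linarith
  obtain ⟨K, hK, hanti⟩ := (T : E →ₗ[ℝ] F).injective_iff_antilipschitz.1 hT
  have hJpos : 0 < J y₀ := by
    rw [hJT]
    refine lt_of_le_of_ne (LinearMap.normDet_nonneg _) (Ne.symm ?_)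
    exact ((T : E →ₗ[ℝ] F).normDet_ne_zero_tfae.out 0 4).2 hT
  -- Chosen so that `1 - η = 1 / d` exactly and `1 + η ≤ d`.
  set η : ℝ := 1 - (d : ℝ)⁻¹ with hη
  have hη0 : 0 < η := by
    have := inv_lt_one_of_one_lt₀ hd'
    linarith
  have hη1 : 1 + η ≤ d := by
    have : (d : ℝ) - 2 + (d : ℝ)⁻¹ = (d - 1) ^ 2 / d := by field_simp; ring
    have h2 : 0 ≤ ((d : ℝ) - 1) ^ 2 / d := by positivity
    linarith
  have hK' : (0 : ℝ) < K := hK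
  -- The constant `K` with `‖a - b‖ ≤ K ‖T (a - b)‖` turns the error `(η / K) ‖a - b‖` into one
  -- relative to `T`.
  have hstrict := hg.isLittleO.bound (show 0 < η / K by positivity)
  rw [nhds_prod_eq, Filter.eventually_prod_self_iff'] at hstrict
  obtain ⟨V₁, hV₁, hV₁'⟩ := hstrict
  have hV₂ : ∀ᶠ y in 𝓝 y₀, J y < d * J y₀ ∧ J y₀ < d * J y := by
    refine (hJ.eventually_lt_const (by nlinarith)).and ?_
    exact (hJ.const_mul (d : ℝ)).eventually_const_lt (by nlinarith)
  refine ⟨V₁ ∩ _, inter_mem hV₁ hV₂, fun A hA hAm => ?_⟩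
  have hdiff : ∀ a ∈ A, ∀ b ∈ A, ‖g a - g b - T (a - b)‖ ≤ η * ‖T (a - b)‖ := by
    intro a ha b hb
    refine (hV₁' a (hA ha).1 b (hA hb).1).trans ?_
    have := hanti.le_mul_dist a b
    rw [dist_eq_norm, dist_eq_norm] at this
    calc η / K * ‖a - b‖ ≤ η / K * (K * ‖T a - T b‖) := by gcongr; exact this
      _ = η * ‖T (a - b)‖ := by rw [map_sub]; field_simp
  have hTA : μHE[k] (T '' A) = ENNReal.ofReal (J y₀) * volume A := by
    rw [hJT]
    exact (T : E →ₗ[ℝ] F).euclideanHausdorffMeasure_image_eq_normDet_mul_volume A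
  have h1 : μHE[k] (g '' A) ≤ (d : ℝ≥0∞) ^ k * μHE[k] (T '' A) := by
    refine euclideanHausdorffMeasure_image_le (fun a ha b hb => ?_) k
    rw [dist_eq_norm, dist_eq_norm, ← map_sub]
    have := hdiff a ha b hb
    have h3 := norm_le_norm_add_norm_sub' (g a - g b) (T (a - b))
    nlinarith [norm_nonneg (T (a - b))]
  have h2 : μHE[k] (T '' A) ≤ (d : ℝ≥0∞) ^ k * μHE[k] (g '' A) := by
    refine euclideanHausdorffMeasure_image_le (fun a ha b hb => ?_) k
    rw [dist_eq_norm, dist_eq_norm, ← map_sub]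
    have := hdiff a ha b hb
    have h3 := norm_le_norm_add_norm_sub (g a - g b) (T (a - b))
    have h4 : (d : ℝ)⁻¹ * ‖T (a - b)‖ ≤ ‖g a - g b‖ := by
      have : (d : ℝ)⁻¹ = 1 - η := by rw [hη]; ring
      rw [this]; linarith
    rwa [inv_mul_le_iff₀ hd0] at h4
  have h3 : ENNReal.ofReal (J y₀) * volume A ≤ d * ∫⁻ y in A, ENNReal.ofReal (J y) := by
    rw [← lintegral_const_mul' _ _ ENNReal.coe_ne_top, ← setLIntegral_const]
    refine setLIntegral_mono' hAm fun y hy => ?_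
    rw [← ENNReal.ofReal_coe_nnreal, ← ENNReal.ofReal_mul hd0.le]
    exact ENNReal.ofReal_le_ofReal (hA hy).2.2.le
  have h4 : ∫⁻ y in A, ENNReal.ofReal (J y) ≤ d * (ENNReal.ofReal (J y₀) * volume A) := by
    rw [← mul_assoc, ← setLIntegral_const]
    refine setLIntegral_mono' hAm fun y hy => ?_
    rw [← ENNReal.ofReal_coe_nnreal, ← ENNReal.ofReal_mul hd0.le]
    exact ENNReal.ofReal_le_ofReal (hA hy).2.1.le
  constructor
  · calc μHE[k] (g '' A) ≤ (d : ℝ≥0∞) ^ k * (d * ∫⁻ y in A, ENNReal.ofReal (J y)) := by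
          refine h1.trans ?_
          rw [hTA]
          gcongr
      _ = _ := by rw [pow_succ, mul_assoc]
  · calc ∫⁻ y in A, ENNReal.ofReal (J y) ≤ d * ((d : ℝ≥0∞) ^ k * μHE[k] (g '' A)) := by
          refine h4.trans ?_
          rw [← hTA]
          gcongr
      _ = _ := by rw [pow_succ', mul_assoc]

/-- The area formula for injective immersions of class `C¹`. -/
theorem euclideanHausdorffMeasure_image_eq_lintegral {g : E → F} {g' : E → E →L[ℝ] F} {J : E → ℝ}
    {S : Set E} (hS : IsOpen S) (hg : ∀ y ∈ S, HasStrictFDerivAt g (g' y) y)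
    (hg' : ∀ y ∈ S, Function.Injective (g' y))
    (hJg : ∀ y ∈ S, J y = (g' y : E →ₗ[ℝ] F).normDet) (hJ : ContinuousOn J S)
    (hinj : InjOn g S) {A : Set E} (hA : MeasurableSet A) (hAS : A ⊆ S) :
    μHE[Module.finrank ℝ E] (g '' A) = ∫⁻ y in A, ENNReal.ofReal (J y) := by
  set k := Module.finrank ℝ E
  have hgc : ContinuousOn g S := fun y hy => (hg y hy).continuousAt.continuousWithinAt
  -- The local bounds hold with a fixed factor, so they add up over a countable measurable partition
  -- of `A`; afterwards `d` decreases to `1`.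
  have key : ∀ d : ℝ≥0, 1 < d →
      μHE[k] (g '' A) ≤ (d : ℝ≥0∞) ^ (k + 1) * ∫⁻ y in A, ENNReal.ofReal (J y) ∧
      ∫⁻ y in A, ENNReal.ofReal (J y) ≤ (d : ℝ≥0∞) ^ (k + 1) * μHE[k] (g '' A) := by
    intro d hd
    have hloc : ∀ y : E, ∃ V ∈ 𝓝[A] y, y ∈ A → IsOpen V ∧ ∀ B ⊆ V, MeasurableSet B →
        μHE[k] (g '' B) ≤ (d : ℝ≥0∞) ^ (k + 1) * ∫⁻ y in B, ENNReal.ofReal (J y) ∧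
        ∫⁻ y in B, ENNReal.ofReal (J y) ≤ (d : ℝ≥0∞) ^ (k + 1) * μHE[k] (g '' B) := by
      intro y
      by_cases hy : y ∈ A
      · have hyS := hAS hy
        obtain ⟨V, hV, h⟩ := exists_nhds_area_bounds (hg y hyS) (hg' y hyS) (hJg y hyS)
          (hJ.continuousAt (hS.mem_nhds hyS)) hd
        obtain ⟨W, hWV, hW, hyW⟩ := mem_nhds_iff.1 hV
        exact ⟨W, mem_nhdsWithin_of_mem_nhds (hW.mem_nhds hyW),
          fun _ => ⟨hW, fun B hB => h B (hB.trans hWV)⟩⟩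
      · exact ⟨univ, univ_mem, fun h => absurd h hy⟩
    choose V hV hVB using hloc
    obtain ⟨t, htA, htc, hcov⟩ := TopologicalSpace.countable_cover_nhdsWithin fun y _ => hV y
    rcases t.eq_empty_or_nonempty with rfl | htne
    · have : A = ∅ := by simpa using hcov
      simp [this]
    obtain ⟨u, hu⟩ := htc.exists_eq_range htne
    have hut : ∀ i, u i ∈ A := fun i => htA (hu ▸ mem_range_self i)
    let B : ℕ → Set E := fun i => A ∩ disjointed (fun i => V (u i)) i
    have hBm : ∀ i, MeasurableSet (B i) := fun i =>
      hA.inter (MeasurableSet.disjointed (fun i => ((hVB _ (hut i)).1).measurableSet) i)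
    have hBd : Pairwise (Function.onFun Disjoint B) := fun i j hij =>
      ((disjoint_disjointed _ hij).mono inter_subset_right inter_subset_right)
    have hBU : A = ⋃ i, B i := by
      rw [← inter_iUnion, iUnion_disjointed, eq_comm, inter_eq_left]
      rwa [hu, biUnion_range] at hcov
    have hBV : ∀ i, B i ⊆ V (u i) := fun i =>
      inter_subset_right.trans (disjointed_subset _ i)
    have hBS : ∀ i, B i ⊆ S := fun i => inter_subset_left.trans hAS
    have e1 : μHE[k] (g '' A) = ∑' i, μHE[k] (g '' B i) := by
      conv_lhs => rw [hBU, image_iUnion]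
      refine measure_iUnion (fun i j hij => ?_) fun i => ?_
      · exact (hBd hij).image hinj (hBS i) (hBS j)
      · exact (hBm i).image_of_continuousOn_injOn (hgc.mono (hBS i)) (hinj.mono (hBS i))
    have e2 : ∫⁻ y in A, ENNReal.ofReal (J y) = ∑' i, ∫⁻ y in B i, ENNReal.ofReal (J y) := by
      conv_lhs => rw [hBU]
      exact lintegral_iUnion hBm hBd _
    rw [e1, e2, ← ENNReal.tsum_mul_left, ← ENNReal.tsum_mul_left]
    exact ⟨ENNReal.tsum_le_tsum fun i => ((hVB _ (hut i)).2 _ (hBV i) (hBm i)).1,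
      ENNReal.tsum_le_tsum fun i => ((hVB _ (hut i)).2 _ (hBV i) (hBm i)).2⟩
  have lim : ∀ a b : ℝ≥0∞, (∀ d : ℝ≥0, 1 < d → a ≤ (d : ℝ≥0∞) ^ (k + 1) * b) → a ≤ b := by
    intro a b h
    have ht : Tendsto (fun d : ℝ≥0 => ((d ^ (k + 1) : ℝ≥0) : ℝ≥0∞) * b) (𝓝[>] 1)
        (𝓝 (((1 ^ (k + 1) : ℝ≥0) : ℝ≥0∞) * b)) := by
      refine ENNReal.Tendsto.mul_const (ENNReal.tendsto_coe.2 ?_) (Or.inl (by simp))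
      exact ((continuous_pow (k + 1)).tendsto 1).mono_left nhdsWithin_le_nhds
    rw [one_pow, ENNReal.coe_one, one_mul] at ht
    refine ge_of_tendsto ht ?_
    filter_upwards [self_mem_nhdsWithin] with d hd
    simpa using h d hd
  exact le_antisymm (lim _ _ fun d hd => (key d hd).1) (lim _ _ fun d hd => (key d hd).2)

theorem restrict_image_eq_map_withDensity {g : E → F} {g' : E → E →L[ℝ] F} {J : E → ℝ}
    {S : Set E} (hS : IsOpen S) (hg : ∀ y ∈ S, HasStrictFDerivAt g (g' y) y)
    (hg' : ∀ y ∈ S, Function.Injective (g' y))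
    (hJg : ∀ y ∈ S, J y = (g' y : E →ₗ[ℝ] F).normDet) (hJ : ContinuousOn J S)
    (hinj : InjOn g S) (hgm : Measurable g) :
    (μHE[Module.finrank ℝ E] : Measure F).restrict (g '' S) =
      ((volume.restrict S).withDensity fun y => ENNReal.ofReal (J y)).map g := by
  ext B hB
  rw [Measure.map_apply hgm hB, withDensity_apply _ (hgm hB),
    Measure.restrict_restrict (hgm hB), ← euclideanHausdorffMeasure_image_eq_lintegral hS hg hg'
      hJg hJ hinj ((hgm hB).inter hS.measurableSet) inter_subset_right, Measure.restrict_apply hB]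
  congr 1
  rw [inter_comm (g ⁻¹' B), image_inter_preimage, inter_comm]

/-- Integration over the image of an injective immersion of class `C¹`. -/
theorem integral_image_area {g : E → F} {g' : E → E →L[ℝ] F} {J : E → ℝ}
    {S : Set E} (hS : IsOpen S) (hg : ∀ y ∈ S, HasStrictFDerivAt g (g' y) y)
    (hg' : ∀ y ∈ S, Function.Injective (g' y))
    (hJg : ∀ y ∈ S, J y = (g' y : E →ₗ[ℝ] F).normDet) (hJ : ContinuousOn J S)
    (hinj : InjOn g S) {f : F → ℝ}
    (hf : AEStronglyMeasurable f (μHE[Module.finrank ℝ E].restrict (g '' S))) :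
    (IntegrableOn f (g '' S) μHE[Module.finrank ℝ E] ↔
        IntegrableOn (fun y => J y * f (g y)) S) ∧
      ∫ x in g '' S, f x ∂μHE[Module.finrank ℝ E] = ∫ y in S, J y * f (g y) := by
  classical
  have hJ0 : ∀ y ∈ S, 0 ≤ J y := fun y hy => hJg y hy ▸ LinearMap.normDet_nonneg _
  -- Nothing is known about `g` off `S`; the extension by a constant is measurable everywhere, as a
  -- push-forward requires. `D` does the same for the density.
  let G : E → F := S.piecewise g fun _ => 0
  have hG : ∀ y ∈ S, G y = g y := fun y hy => piecewise_eq_of_mem _ _ _ hy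
  have hGev : ∀ y ∈ S, G =ᶠ[𝓝 y] g := fun y hy => by
    filter_upwards [hS.mem_nhds hy] with z hz using hG z hz
  have hGm : Measurable G := by
    refine ContinuousOn.measurable_piecewise
      (fun y hy => (hg y hy).continuousAt.continuousWithinAt) continuousOn_const hS.measurableSet
  have himg : G '' S = g '' S := image_congr hG
  have hGS : ∀ y ∈ S, HasStrictFDerivAt G (g' y) y := fun y hy =>
    (hg y hy).congr_of_eventuallyEq (hGev y hy).symm
  have hmap := restrict_image_eq_map_withDensity hS hGS hg' hJg hJ
    (hinj.congr fun y hy => (hG y hy).symm) hGm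
  rw [himg] at hmap
  let D : E → ℝ≥0∞ := S.indicator fun y => ENNReal.ofReal (J y)
  have hDm : Measurable D := by
    refine ContinuousOn.measurable_piecewise (g := fun _ => (0 : ℝ≥0∞)) ?_ continuousOn_const
      hS.measurableSet
    exact ENNReal.continuous_ofReal.comp_continuousOn hJ
  have hwd : ((volume.restrict S).withDensity fun y => ENNReal.ofReal (J y)) =
      (volume.restrict S).withDensity D := by
    refine withDensity_congr_ae (ae_restrict_of_forall_mem hS.measurableSet fun y hy => ?_)
    simp [D, hy]
  rw [hwd] at hmap
  have hDtop : ∀ᵐ y ∂volume.restrict S, D y < ∞ :=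
    ae_restrict_of_forall_mem hS.measurableSet fun y hy => by simp [D, hy]
  have hcongr : (fun y => (D y).toReal • f (G y)) =ᵐ[volume.restrict S]
      fun y => J y * f (g y) := by
    refine ae_restrict_of_forall_mem hS.measurableSet fun y hy => ?_
    simp [D, hy, hG y hy, hJ0 y hy]
  rw [hmap] at hf
  constructor
  · rw [IntegrableOn, hmap, integrable_map_measure hf hGm.aemeasurable,
      integrable_withDensity_iff_integrable_smul' hDm hDtop]
    exact integrable_congr hcongr
  · rw [hmap, integral_map hGm.aemeasurable hf,
      integral_withDensity_eq_integral_toReal_smul hDm hDtop]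
    exact integral_congr_ae hcongr

/-- Integration over the graph of a function of class `C¹`. -/
theorem integral_graph (ι : E →ₗᵢ[ℝ] F) {v : F} (hv : ‖v‖ = 1) (hιv : ∀ y, inner ℝ v (ι y) = 0)
    (t : F) {φ : E → ℝ} {u : E → E} {S : Set E} (hS : IsOpen S)
    (hφ : ∀ y ∈ S, HasStrictFDerivAt φ (innerSL ℝ (u y)) y) (hu : ContinuousOn u S) {f : F → ℝ}
    (hf : AEStronglyMeasurable f
      (μHE[Module.finrank ℝ E].restrict ((fun y => t + ι y + φ y • v) '' S))) :
    (IntegrableOn f ((fun y => t + ι y + φ y • v) '' S) μHE[Module.finrank ℝ E] ↔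
        IntegrableOn (fun y => √(1 + ‖u y‖ ^ 2) * f (t + ι y + φ y • v)) S) ∧
      ∫ x in (fun y => t + ι y + φ y • v) '' S, f x ∂μHE[Module.finrank ℝ E] =
        ∫ y in S, √(1 + ‖u y‖ ^ 2) * f (t + ι y + φ y • v) := by
  -- The component along `v` does not affect the horizontal one. This gives injectivity both of the
  -- graph map and of its differential.
  have hvι : ∀ a b : E, ∀ c d : ℝ, ι a + c • v = ι b + d • v → a = b := by
    intro a b c d h
    have h1 : ι (a - b) = (d - c) • v := by
      rw [map_sub, sub_smul, sub_eq_sub_iff_add_eq_add, h, add_comm]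
    have h2 := ι.norm_map (a - b)
    have h3 := hιv (a - b)
    rw [h1, real_inner_smul_right, real_inner_self_eq_norm_sq, hv, one_pow, mul_one] at h3
    rw [h1, h3, zero_smul, norm_zero, eq_comm, norm_eq_zero, sub_eq_zero] at h2
    exact h2
  refine integral_image_area (J := fun y => √(1 + ‖u y‖ ^ 2))
    (g' := fun y => ι.toContinuousLinearMap + (innerSL ℝ (u y)).smulRight v) hS ?_ ?_ ?_ ?_ ?_ hf
  · intro y hy
    exact (ι.toContinuousLinearMap.hasStrictFDerivAt.const_add t).add
      ((hφ y hy).smul_const v)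
  · intro y _ a b hab
    exact hvι a b _ _ hab
  · intro y _
    exact (normDet_graph ι hv hιv (u y)).symm
  · exact (continuousOn_const.add (hu.norm.pow 2)).sqrt
  · intro a _ b _ hab
    simp only [add_assoc, add_right_inj] at hab
    exact hvι a b _ _ hab

end Area

/-! ### Uniqueness of the outer normal -/

/-- Applied to a defining function or to its negative, this says that a short move along `e` enters
the set or leaves it. -/
theorem eventually_mem_of_hasFDerivAt_neg {F : Type*} [NormedAddCommGroup F] [NormedSpace ℝ F]
    {f : F → ℝ} {L : F →L[ℝ] ℝ} {p e : F} (hf : HasFDerivAt f L p) (hfp : f p = 0)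
    (he : L e < 0) : ∀ᶠ ε in 𝓝[>] (0 : ℝ), f (p + ε • e) < 0 := by
  have h1 : HasDerivAt (fun ε : ℝ => f (p + ε • e)) (L e) 0 := by
    have h2 : HasDerivAt (fun ε : ℝ => p + ε • e) e 0 := by
      simpa using ((hasDerivAt_id (0 : ℝ)).smul_const e).const_add p
    have hf' : HasFDerivAt f L (p + (0 : ℝ) • e) := by simpa using hf
    exact hf'.comp_hasDerivAt (0 : ℝ) h2
  have h3 := (hasDerivAt_iff_tendsto_slope.1 h1).eventually_lt_const he
  have h4 : ∀ᶠ ε in 𝓝[>] (0 : ℝ), slope (fun ε : ℝ => f (p + ε • e)) 0 ε < 0 :=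
    h3.filter_mono (nhdsWithin_mono _ fun x hx => ne_of_gt hx)
  filter_upwards [h4, self_mem_nhdsWithin] with ε h hε
  have hε : 0 < ε := hε
  rw [slope_def_field] at h
  simp only [zero_smul, add_zero, hfp, sub_zero] at h
  exact (div_neg_iff.1 h).elim (fun h => absurd hε (not_lt.2 h.2.le)) fun h => h.1

/-- Two local defining functions of the same set have positively proportional gradients. -/
theorem eq_norm_smul_of_local_defining {F : Type*} [NormedAddCommGroup F] [InnerProductSpace ℝ F]
    {Ω : Set F} {f₁ f₂ : F → ℝ} {p w N : F} (hw : ‖w‖ = 1)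
    (h₁ : HasFDerivAt f₁ (innerSL ℝ w) p) (h₂ : HasFDerivAt f₂ (innerSL ℝ N) p)
    (h₁p : f₁ p = 0) (h₂p : f₂ p = 0) (hΩ₁ : ∀ᶠ x in 𝓝 p, x ∈ Ω ↔ f₁ x < 0)
    (hΩ₂ : ∀ᶠ x in 𝓝 p, x ∈ Ω ↔ f₂ x < 0) : N = ‖N‖ • w := by
  have hline : ∀ e : F, Tendsto (fun ε : ℝ => p + ε • e) (𝓝[>] 0) (𝓝 p) := fun e => by
    have : Tendsto (fun ε : ℝ => p + ε • e) (𝓝 0) (𝓝 (p + (0 : ℝ) • e)) :=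
      Continuous.tendsto (by fun_prop) 0
    rw [zero_smul, add_zero] at this
    exact this.mono_left nhdsWithin_le_nhds
  -- A direction that decreases `f₁` and increases `f₂` would lead both into `Ω` and out of it.
  have key : ∀ e, inner ℝ w e < 0 → inner ℝ N e ≤ 0 := by
    intro e he
    by_contra! hN
    have a1 := eventually_mem_of_hasFDerivAt_neg h₁ h₁p (e := e) (by simpa using he)
    have a2 := eventually_mem_of_hasFDerivAt_neg h₂.neg (by simp [h₂p]) (e := e)
      (by simpa using hN)
    obtain ⟨ε, b1, b2, b3, b4⟩ := (a1.and (a2.and (((hline e).eventually hΩ₁).and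
      ((hline e).eventually hΩ₂)))).exists
    have := b4.1 (b3.2 b1)
    simp only [Pi.neg_apply] at b2
    linarith
  have hww : inner ℝ w w = (1 : ℝ) := by rw [real_inner_self_eq_norm_sq, hw, one_pow]
  have hNw : 0 ≤ inner ℝ N w := by
    have := key (-w) (by rw [inner_neg_right, hww]; norm_num)
    rw [inner_neg_right] at this
    linarith
  have hle : ∀ e, inner ℝ w e = 0 → inner ℝ N e ≤ 0 := by
    intro e he
    by_contra! hN
    -- A small tilt against `w` makes `key` applicable. The coefficient costs at most half of `⟨N,
    -- e⟩`, and the `+ 1` keeps its denominator positive.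
    have := key (e - (inner ℝ N e / (2 * (inner ℝ N w + 1))) • w) (by
      rw [inner_sub_right, he, real_inner_smul_right, hww, mul_one, zero_sub]
      have : 0 < inner ℝ N e / (2 * (inner ℝ N w + 1)) := by positivity
      linarith)
    rw [inner_sub_right, real_inner_smul_right] at this
    have h3 : inner ℝ N e / (2 * (inner ℝ N w + 1)) * inner ℝ N w ≤ inner ℝ N e / 2 := by
      rw [div_mul_eq_mul_div, div_le_div_iff₀ (by positivity) (by norm_num)]
      nlinarith
    linarith
  have hzero : ∀ e, inner ℝ w e = 0 → inner ℝ N e = 0 := by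
    intro e he
    have h1 := hle e he
    have h2 := hle (-e) (by rw [inner_neg_right, he, neg_zero])
    rw [inner_neg_right] at h2
    linarith
  have hN : N = inner ℝ N w • w := by
    have h0 : inner ℝ w (N - inner ℝ N w • w) = 0 := by
      rw [inner_sub_right, real_inner_smul_right, hww, mul_one, real_inner_comm, sub_self]
    have h1 := hzero _ h0
    rw [← sub_eq_zero, ← inner_self_eq_zero (𝕜 := ℝ)]
    conv_lhs => rw [inner_sub_left, real_inner_smul_left, h0, h1]
    simp
  have hnorm : ‖N‖ = inner ℝ N w := by
    conv_lhs => rw [hN]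
    rw [norm_smul, hw, mul_one, Real.norm_of_nonneg hNw]
  rw [hnorm]
  exact hN

theorem hasFDerivAt_apply_sub {F G : Type*} [NormedAddCommGroup F] [NormedSpace ℝ F]
    [NormedAddCommGroup G] [NormedSpace ℝ G] (L : F →L[ℝ] G) (p q : F) :
    HasFDerivAt (fun x => L (x - p)) L q := by
  simpa only [map_sub] using L.hasFDerivAt.sub_const (L p)

/-- The function is height minus `φ`. As the derivative of `φ` vanishes at `0`, its gradient at `p`
is exactly `v`. -/
theorem IsOuterUnitNormal.exists_defining {m : ℕ} {Ω : Set (Space m)} {p v : Space m}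
    (h : IsOuterUnitNormal Ω p v) :
    ∃ f : Space m → ℝ, HasFDerivAt f (innerSL ℝ v) p ∧ f p = 0 ∧
      ∀ᶠ x in 𝓝 p, x ∈ Ω ↔ f x < 0 := by
  obtain ⟨-, φ, hφ, hφ0, hφ', hΩ⟩ := h
  refine ⟨fun x => inner ℝ v (x - p) - φ ((ℝ ∙ v)ᗮ.orthogonalProjectionOnto (x - p)), ?_, ?_, ?_⟩
  · have h1 : HasFDerivAt (fun x : Space m => inner ℝ v (x - p)) (innerSL ℝ v) p :=
      hasFDerivAt_apply_sub (innerSL ℝ v) p p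
    have h2 := hasFDerivAt_apply_sub ((ℝ ∙ v)ᗮ.orthogonalProjectionOnto) p p
    have h3 : HasFDerivAt φ (0 : (ℝ ∙ v)ᗮ →L[ℝ] ℝ)
        ((ℝ ∙ v)ᗮ.orthogonalProjectionOnto (p - p)) := by
      rw [sub_self, map_zero, ← hφ']
      exact (hφ.differentiableAt one_ne_zero).hasFDerivAt
    have := h1.sub (h3.comp p h2)
    simpa using! this
  · simp [hφ0]
  · filter_upwards [hΩ] with x hx
    rw [hx, sub_neg]

/-- A chord of the unit sphere is at most its arc: `‖v - w‖² = 2 - 2 cos θ ≤ θ²`. -/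
theorem norm_sub_le_angle {F : Type*} [NormedAddCommGroup F] [InnerProductSpace ℝ F] {v w : F}
    (hv : ‖v‖ = 1) (hw : ‖w‖ = 1) : ‖v - w‖ ≤ InnerProductGeometry.angle v w := by
  have h1 := InnerProductGeometry.cos_angle v w
  rw [hv, hw, one_mul, div_one] at h1
  have h2 := Real.one_sub_sq_div_two_le_cos (x := InnerProductGeometry.angle v w)
  refine abs_le_of_sq_le_sq' ?_ (InnerProductGeometry.angle_nonneg v w) |>.2
  rw [@norm_sub_sq_real, hv, hw, ← h1]
  linarith

/-! ### Global geometry of the Lyapunov surface -/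

section Domain

variable {m : ℕ} [NeZero m] {Ω Γ₁ Γ : Set (Space m)} {n : Space m → Space m}

theorem isOpen_halfSpace (m : ℕ) [NeZero m] : IsOpen (halfSpace m) :=
  isOpen_lt continuous_const (by fun_prop)

theorem convex_halfSpace (m : ℕ) [NeZero m] : Convex ℝ (halfSpace m) :=
  convex_halfSpace_gt (f := fun x : Space m => x 0) ⟨by simp, by simp⟩ 0

/-- The flat part and its closure lie in `x₁ = 0`, so nothing but `Γ` remains of the frontier in the
open half-space. Hence `Γ` is a Borel set, relatively closed in the half-space, and determined by
`Ω`. -/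
theorem IsLyapunovDomain.surface_eq (h : IsLyapunovDomain Ω Γ₁ Γ n) :
    Γ = frontier Ω ∩ halfSpace m := by
  have h1 : closure Γ₁ ⊆ hyperplane m := by
    obtain ⟨U, -, rfl⟩ := h.isOpen_flatPart
    exact closure_minimal inter_subset_right (isClosed_eq (by fun_prop) continuous_const)
  ext x
  constructor
  · exact fun hx => ⟨h.frontier_eq ▸ Or.inr hx, h.surface_subset hx⟩
  · rintro ⟨hx, hx0⟩
    rw [h.frontier_eq] at hx
    refine hx.resolve_left fun h2 => ?_
    have h3 : x 0 = 0 := h1 h2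
    have h4 : 0 < x 0 := hx0
    linarith

theorem IsLyapunovDomain.measurableSet_surface (h : IsLyapunovDomain Ω Γ₁ Γ n) :
    MeasurableSet Γ := by
  rw [h.surface_eq]
  exact isClosed_frontier.measurableSet.inter (isOpen_halfSpace m).measurableSet

theorem IsLyapunovDomain.closure_inter_halfSpace (h : IsLyapunovDomain Ω Γ₁ Γ n) :
    closure Γ ∩ halfSpace m ⊆ Γ := by
  rintro x ⟨hx, hx0⟩
  have h1 : closure Γ ⊆ frontier Ω :=
    closure_minimal (fun y hy => h.frontier_eq ▸ Or.inr hy) isClosed_frontier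
  rw [h.surface_eq]
  exact ⟨h1 hx, hx0⟩

theorem IsLyapunovDomain.isCompact_closure (h : IsLyapunovDomain Ω Γ₁ Γ n) :
    IsCompact (closure Γ) := by
  refine (h.isBounded.closure.subset ?_).isCompact_closure
  intro x hx
  exact frontier_subset_closure (h.frontier_eq ▸ Or.inr hx)

theorem IsLyapunovDomain.norm_normal (h : IsLyapunovDomain Ω Γ₁ Γ n) {x : Space m} (hx : x ∈ Γ) :
    ‖n x‖ = 1 := (h.normal x hx).1

theorem IsLyapunovDomain.holder_normal (h : IsLyapunovDomain Ω Γ₁ Γ n) :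
    ∃ a > (0 : ℝ), ∃ l > (0 : ℝ), ∀ x ∈ Γ, ∀ y ∈ Γ, ‖n x - n y‖ ≤ a * dist x y ^ l := by
  obtain ⟨a, ha, l, hl, hal⟩ := h.lyapunov
  exact ⟨a, ha, l, hl, fun x hx y hy =>
    (norm_sub_le_angle (h.norm_normal hx) (h.norm_normal hy)).trans (hal x hx y hy)⟩

theorem IsLyapunovDomain.continuousOn_normal (h : IsLyapunovDomain Ω Γ₁ Γ n) :
    ContinuousOn n Γ := by
  obtain ⟨a, ha, l, hl, hal⟩ := h.holder_normal
  intro x hx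
  rw [ContinuousWithinAt, tendsto_iff_norm_sub_tendsto_zero]
  have h1 : Tendsto (fun y => a * dist y x ^ l) (𝓝[Γ] x) (𝓝 0) := by
    have : Continuous fun y : Space m => a * dist y x ^ l := by
      exact continuous_const.mul ((continuous_id.dist continuous_const).rpow_const fun _ =>
        Or.inr hl.le)
    have := this.tendsto x
    simp only [dist_self, Real.zero_rpow hl.ne', mul_zero] at this
    exact this.mono_left nhdsWithin_le_nhds
  refine squeeze_zero' (Eventually.of_forall fun y => norm_nonneg _) ?_ h1
  filter_upwards [self_mem_nhdsWithin] with y hy using hal y hy x hx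

/-- A chord between two points of the surface cannot make an acute angle with all the normals
along it. -/
theorem IsLyapunovDomain.exists_inner_normal_le (h : IsLyapunovDomain Ω Γ₁ Γ n) {x y : Space m}
    (hx : x ∈ Γ) (hy : y ∈ Γ) :
    ∃ z ∈ Γ ∩ segment ℝ x y, inner ℝ (n z) (y - x) ≤ 0 := by
  by_contra! hcon
  set e := y - x with he
  have hout : ∀ z ∈ Γ, 0 < inner ℝ (n z) e → ∀ᶠ ε in 𝓝[>] (0 : ℝ), z + ε • e ∉ Ω := by
    intro z hz hze
    obtain ⟨f, hf, hfz, hΩ⟩ := (h.normal z hz).exists_defining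
    have h1 := eventually_mem_of_hasFDerivAt_neg hf.neg (by simp [hfz]) (e := e)
      (by simpa using hze)
    have h2 : Tendsto (fun ε : ℝ => z + ε • e) (𝓝[>] 0) (𝓝 z) := by
      have : Tendsto (fun ε : ℝ => z + ε • e) (𝓝 0) (𝓝 (z + (0 : ℝ) • e)) :=
        Continuous.tendsto (by fun_prop) 0
      rw [zero_smul, add_zero] at this
      exact this.mono_left nhdsWithin_le_nhds
    filter_upwards [h1, h2.eventually hΩ] with ε h3 h4
    rw [h4]
    simp only [Pi.neg_apply] at h3
    linarith
  -- Retreating from `y` along the chord leads into `Ω`, since the normal at `y` makes an acute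
  -- angle with the chord.
  have hin : ∀ᶠ ε in 𝓝[>] (0 : ℝ), y + ε • (-e) ∈ Ω := by
    obtain ⟨f, hf, hfz, hΩ⟩ := (h.normal y hy).exists_defining
    have h1 := eventually_mem_of_hasFDerivAt_neg hf hfz (e := -e)
      (by simpa using hcon y ⟨hy, right_mem_segment ℝ x y⟩)
    have h2 : Tendsto (fun ε : ℝ => y + ε • (-e)) (𝓝[>] 0) (𝓝 y) := by
      have : Tendsto (fun ε : ℝ => y + ε • (-e)) (𝓝 0) (𝓝 (y + (0 : ℝ) • (-e))) :=
        Continuous.tendsto (by fun_prop) 0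
      rw [zero_smul, add_zero] at this
      exact this.mono_left nhdsWithin_le_nhds
    filter_upwards [h1, h2.eventually hΩ] with ε h3 h4
    exact h4.2 h3
  have hseg : ∀ τ ∈ Icc (0 : ℝ) 1, x + τ • e ∈ segment ℝ x y := fun τ hτ => by
    rw [segment_eq_image']
    exact ⟨τ, hτ, rfl⟩
  -- Convexity keeps the chord off the flat part of the boundary, so any frontier point on it
  -- belongs to `Γ`.
  have hhalf : segment ℝ x y ⊆ halfSpace m :=
    (convex_halfSpace m).segment_subset (h.surface_subset hx) (h.surface_subset hy)
  have hIoo : ∀ᶠ ε in 𝓝[>] (0 : ℝ), ε < 1 / 2 :=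
    nhdsWithin_le_nhds (eventually_lt_nhds (by norm_num))
  obtain ⟨ε₂, hε₂, hε₂', hε₂0⟩ := (hin.and (hIoo.and self_mem_nhdsWithin)).exists
  have hε₂0 : 0 < ε₂ := hε₂0
  set τ₂ := 1 - ε₂ with hτ₂
  have hτ₂Ω : x + τ₂ • e ∈ Ω := by
    convert! hε₂ using 1
    rw [hτ₂, he]; module
  -- the last parameter before `τ₂` at which the chord is outside
  let S : Set ℝ := Icc 0 τ₂ ∩ {τ | x + τ • e ∉ Ω}
  have hSc : IsClosed S :=
    isClosed_Icc.inter (h.isOpen.isClosed_compl.preimage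
      (by fun_prop : Continuous fun τ : ℝ => x + τ • e))
  have hxΩ : x ∉ Ω := by
    have : x ∈ frontier Ω := h.frontier_eq ▸ Or.inr hx
    rw [h.isOpen.frontier_eq] at this
    exact this.2
  have hSne : S.Nonempty := ⟨0, ⟨le_rfl, by linarith⟩, by simpa using hxΩ⟩
  have hSb : BddAbove S := ⟨τ₂, fun τ hτ => hτ.1.2⟩
  set σ := sSup S with hσ
  have hσS : σ ∈ S := hSc.csSup_mem hSne hSb
  have hστ : σ < τ₂ := lt_of_le_of_ne hσS.1.2 fun h1 => hσS.2 (h1 ▸ hτ₂Ω)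
  have hafter : ∀ τ, σ < τ → τ ≤ τ₂ → x + τ • e ∈ Ω := by
    intro τ h1 h2
    by_contra h3
    exact absurd (le_csSup hSb ⟨⟨hσS.1.1.trans h1.le, h2⟩, h3⟩) (not_le.2 h1)
  have hafter' : ∀ᶠ ε in 𝓝[>] (0 : ℝ), x + σ • e + ε • e ∈ Ω := by
    have : ∀ᶠ ε in 𝓝[>] (0 : ℝ), ε < τ₂ - σ :=
      nhdsWithin_le_nhds (eventually_lt_nhds (by linarith))
    filter_upwards [this, self_mem_nhdsWithin] with ε h1 h2
    have h2 : 0 < ε := h2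
    rw [add_assoc, ← add_smul]
    exact hafter _ (by linarith) (by linarith)
  have hσseg : x + σ • e ∈ segment ℝ x y := hseg σ ⟨hσS.1.1, by linarith⟩
  -- At `σ` the chord is outside `Ω` and right afterwards inside, so it crosses `Γ` inwards. The
  -- normal there points along the chord and would force it outwards.
  have hσΓ : x + σ • e ∈ Γ := by
    rw [h.surface_eq]
    refine ⟨?_, hhalf hσseg⟩
    rw [h.isOpen.frontier_eq]
    refine ⟨?_, hσS.2⟩
    have h2 : Tendsto (fun ε : ℝ => x + σ • e + ε • e) (𝓝[>] 0) (𝓝 (x + σ • e)) := by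
      have : Tendsto (fun ε : ℝ => x + σ • e + ε • e) (𝓝 0) (𝓝 (x + σ • e + (0 : ℝ) • e)) :=
        Continuous.tendsto (by fun_prop) 0
      rw [zero_smul, add_zero] at this
      exact this.mono_left nhdsWithin_le_nhds
    exact mem_closure_of_tendsto h2 hafter'
  obtain ⟨ε, h1, h2⟩ := (hafter'.and (hout _ hσΓ (hcon _ ⟨hσΓ, hσseg⟩))).exists
  exact h2 h1

end Domain

theorem exists_orthogonal_isometry {m : ℕ} {v : Space m} (hv : ‖v‖ = 1) :
    Nonempty (EuclideanSpace ℝ (Fin (m - 1)) ≃ₗᵢ[ℝ] (ℝ ∙ v)ᗮ) := by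
  have hv0 : v ≠ 0 := fun h => by simp [h] at hv
  have hfr : Module.finrank ℝ (ℝ ∙ v)ᗮ = m - 1 := by
    have := (ℝ ∙ v).finrank_add_finrank_orthogonal
    rw [finrank_span_singleton hv0, finrank_euclideanSpace_fin] at this
    omega
  exact ⟨((stdOrthonormalBasis ℝ (ℝ ∙ v)ᗮ).reindex (finCongr hfr)).repr.symm⟩

theorem orthogonalProjection_add_inner {m : ℕ} {v : Space m} (hv : ‖v‖ = 1) (x : Space m) :
    ((ℝ ∙ v)ᗮ.orthogonalProjectionOnto x : Space m) + inner ℝ v x • v = x := by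
  have h1 := (ℝ ∙ v).starProjection_add_starProjection_orthogonal x
  rw [Submodule.starProjection_unit_singleton ℝ hv] at h1
  rw [add_comm]
  exact h1

section Domain

variable {m : ℕ} [NeZero m] {Ω Γ₁ Γ : Set (Space m)} {n : Space m → Space m}

/-- In a small ball the normals differ by at most `1/4`, so by `exists_inner_normal_le` every chord
of `Γ` is almost orthogonal to one fixed normal `v`. Projection along `v` then has a `2`-Lipschitz
inverse on that piece. The radius is uniform, so finitely many balls cover `closure Γ`, including
its edge on the hyperplane, where no graph is available. -/
theorem IsLyapunovDomain.surfaceMeasure_lt_top (h : IsLyapunovDomain Ω Γ₁ Γ n) :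
    surfaceMeasure m Γ < ∞ := by
  obtain ⟨a, ha, l, hl, hal⟩ := h.holder_normal
  obtain ⟨δ, hδ, hδa⟩ : ∃ δ > 0, ∀ r, 0 ≤ r → r < 2 * δ → a * r ^ l ≤ 1 / 4 := by
    -- `2 * δ` bounds the distance of two points in a ball of radius `δ`, and `(2 * δ) ^ l = 1 / (4
    -- a)`.
    refine ⟨(1 / (4 * a)) ^ (1 / l) / 2, by positivity, fun r hr hr' => ?_⟩
    have h1 : r ^ l ≤ ((1 / (4 * a)) ^ (1 / l)) ^ l :=
      Real.rpow_le_rpow hr (by linarith) hl.le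
    rw [← Real.rpow_mul (by positivity), one_div_mul_cancel hl.ne', Real.rpow_one] at h1
    calc a * r ^ l ≤ a * (1 / (4 * a)) := by gcongr
      _ = 1 / 4 := by field_simp
  have hloc : ∀ p : Space m, surfaceMeasure m (Γ ∩ Metric.ball p δ) < ∞ := by
    intro p
    rcases (Γ ∩ Metric.ball p δ).eq_empty_or_nonempty with h0 | ⟨x₀, hx₀, hx₀p⟩
    · simp [h0]
    set v := n x₀
    have hv : ‖v‖ = 1 := h.norm_normal hx₀
    obtain ⟨L⟩ := exists_orthogonal_isometry hv
    let P : Space m → EuclideanSpace ℝ (Fin (m - 1)) := fun x =>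
      L.symm ((ℝ ∙ v)ᗮ.orthogonalProjectionOnto x)
    have hnv : ∀ z ∈ Γ, z ∈ Metric.ball p δ → ‖n z - v‖ ≤ 1 / 4 := by
      intro z hz hzp
      refine (hal z hz x₀ hx₀).trans (hδa _ dist_nonneg ?_)
      have := dist_triangle_right z x₀ p
      rw [Metric.mem_ball] at hzp hx₀p
      linarith
    have hinner : ∀ x ∈ Γ ∩ Metric.ball p δ, ∀ y ∈ Γ ∩ Metric.ball p δ,
        inner ℝ v (y - x) ≤ ‖y - x‖ / 4 := by
      rintro x ⟨hx, hxp⟩ y ⟨hy, hyp⟩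
      obtain ⟨z, ⟨hz, hzs⟩, hze⟩ := h.exists_inner_normal_le hx hy
      have h1 := hnv z hz ((convex_ball p δ).segment_subset hxp hyp hzs)
      have h2 : inner ℝ (v - n z) (y - x) ≤ 1 / 4 * ‖y - x‖ := by
        refine (real_inner_le_norm _ _).trans ?_
        rw [norm_sub_rev] at h1
        gcongr
      rw [inner_sub_left] at h2
      linarith
    have hdist : ∀ x ∈ Γ ∩ Metric.ball p δ, ∀ y ∈ Γ ∩ Metric.ball p δ,
        dist (id x) (id y) ≤ (2 : ℝ≥0) * dist (P x) (P y) := by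
      intro x hx y hy
      have h1 := hinner x hx y hy
      have h2 := hinner y hy x hx
      have h3 : P x - P y = L.symm ((ℝ ∙ v)ᗮ.orthogonalProjectionOnto (x - y)) := by
        simp only [P, map_sub]
      rw [id, id, dist_eq_norm, dist_eq_norm, h3, L.symm.norm_map]
      rw [norm_sub_rev, ← neg_sub x y, inner_neg_right] at h1
      -- The vertical component is at most a quarter of the chord, so the projection keeps at least
      -- three quarters of its length.
      have h4 : ‖x - y‖ ≤ ‖(ℝ ∙ v)ᗮ.orthogonalProjectionOnto (x - y)‖ + ‖x - y‖ / 4 := by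
        conv_lhs => rw [← orthogonalProjection_add_inner hv (x - y)]
        refine (norm_add_le _ _).trans (add_le_add le_rfl ?_)
        rw [norm_smul, hv, mul_one, Real.norm_eq_abs, abs_le]
        constructor <;> linarith
      have h5 := norm_nonneg (x - y)
      push_cast
      linarith
    have hle := euclideanHausdorffMeasure_image_le hdist (m - 1)
    rw [image_id] at hle
    refine lt_of_le_of_lt hle (ENNReal.mul_lt_top (by finiteness) ?_)
    rw [EuclideanSpace.euclideanHausdorffMeasure_eq_volume]
    have hb : Bornology.IsBounded (P '' (Γ ∩ Metric.ball p δ)) := by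
      have hP : LipschitzWith 1 P := by
        refine LipschitzWith.of_dist_le_mul fun x y => ?_
        rw [dist_eq_norm, dist_eq_norm, NNReal.coe_one, one_mul]
        simp only [P, ← map_sub, LinearIsometryEquiv.norm_map]
        exact Submodule.norm_orthogonalProjectionOnto_apply_le _ _
      exact hP.isBounded_image (Metric.isBounded_ball.subset inter_subset_right)
    exact hb.measure_lt_top
  obtain ⟨T, -, hT⟩ := h.isCompact_closure.elim_nhds_subcover (fun p => Metric.ball p δ)
    fun p _ => Metric.ball_mem_nhds p hδ
  have : Γ ⊆ ⋃ p ∈ T, Γ ∩ Metric.ball p δ := by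
    intro x hx
    have := hT (subset_closure hx)
    simp only [mem_iUnion] at this ⊢
    obtain ⟨p, hp, hxp⟩ := this
    exact ⟨p, hp, hx, hxp⟩
  refine (measure_mono this).trans_lt ?_
  exact measure_biUnion_lt_top T.finite_toSet fun p _ => hloc p

end Domain

/-! ### Graph charts at a point of the surface -/

/-- A description of the surface `Γ` near `t` as the graph of a function `φ` of class `C^{1,l}`
with gradient `u` over a ball in the hyperplane orthogonal to the normal at `t`, parametrized by
the linear isometry `ι`; `P` is the orthogonal projection to the hyperplane. -/
structure GraphChart {m : ℕ} (Ω Γ : Set (Space m)) (n : Space m → Space m) (t : Space m) where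
  ι : EuclideanSpace ℝ (Fin (m - 1)) →ₗᵢ[ℝ] Space m
  P : Space m →L[ℝ] EuclideanSpace ℝ (Fin (m - 1))
  φ : EuclideanSpace ℝ (Fin (m - 1)) → ℝ
  u : EuclideanSpace ℝ (Fin (m - 1)) → EuclideanSpace ℝ (Fin (m - 1))
  ρ : ℝ
  C : ℝ
  l : ℝ
  ρ_pos : 0 < ρ
  C_nonneg : 0 ≤ C
  l_pos : 0 < l
  norm_normal : ‖n t‖ = 1
  inner_ι : ∀ y, inner ℝ (n t) (ι y) = 0
  decomp : ∀ x, ι (P x) + inner ℝ (n t) x • n t = x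
  hasStrictFDerivAt : ∀ y ∈ Metric.ball 0 ρ, HasStrictFDerivAt φ (innerSL ℝ (u y)) y
  continuousOn_u : ContinuousOn u (Metric.ball 0 ρ)
  φ_zero : φ 0 = 0
  u_zero : u 0 = 0
  norm_u_le : ∀ y ∈ Metric.ball 0 ρ, ‖u y‖ ≤ 1 / 2
  mem_surface : ∀ y ∈ Metric.ball 0 ρ, t + ι y + φ y • n t ∈ Γ
  -- The area density of the graph is also the factor that gives the normal vertical component `1`,
  -- so the square root disappears from surface integrals of the kernel.
  normal_eq : ∀ y ∈ Metric.ball 0 ρ, √(1 + ‖u y‖ ^ 2) • n (t + ι y + φ y • n t) = n t - ι (u y)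
  taylor : ∀ y ∈ Metric.ball 0 ρ, ∀ z ∈ Metric.ball 0 ρ,
    |φ z - φ y - inner ℝ (u y) (z - y)| ≤ C * ‖z - y‖ ^ (1 + l)
  covers : ∀ᶠ s in 𝓝 t, s ∈ Γ → P (s - t) ∈ Metric.ball 0 ρ ∧
    s = t + ι (P (s - t)) + φ (P (s - t)) • n t
  inside : ∀ᶠ x in 𝓝 t, x ∈ Ω → inner ℝ (n t) (x - t) < φ (P (x - t))
  outside : ∀ᶠ x in 𝓝 t, x ∉ closure Ω → φ (P (x - t)) < inner ℝ (n t) (x - t)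

/-- For a function whose gradient is Hölder continuous, the first order Taylor remainder. -/
theorem abs_taylor_le_of_holder {E : Type*} [NormedAddCommGroup E] [InnerProductSpace ℝ E]
    {φ : E → ℝ} {u : E → E} {S : Set E} (hS : Convex ℝ S)
    (hφ : ∀ y ∈ S, HasFDerivAt φ (innerSL ℝ (u y)) y) {C l : ℝ} (hC : 0 ≤ C) (hl : 0 < l)
    (hu : ∀ y ∈ S, ∀ z ∈ S, ‖u z - u y‖ ≤ C * ‖z - y‖ ^ l) {y z : E} (hy : y ∈ S) (hz : z ∈ S) :
    |φ z - φ y - inner ℝ (u y) (z - y)| ≤ C * ‖z - y‖ ^ (1 + l) := by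
  have hseg : segment ℝ y z ⊆ S := hS.segment_subset hy hz
  have := (convex_segment y z).norm_image_sub_le_of_norm_hasFDerivWithin_le'
    (f := φ) (f' := fun w => innerSL ℝ (u w)) (φ := innerSL ℝ (u y)) (C := C * ‖z - y‖ ^ l)
    (fun w hw => (hφ w (hseg hw)).hasFDerivWithinAt) (fun w hw => ?_)
    (left_mem_segment ℝ y z) (right_mem_segment ℝ y z)
  · rw [Real.rpow_add' (norm_nonneg _) (by linarith), Real.rpow_one, mul_comm ‖z - y‖, ← mul_assoc]
    simpa using this
  · rw [← map_sub, innerSL_apply_norm]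
    refine (hu y hy w (hseg hw)).trans ?_
    gcongr
    rw [segment_eq_image'] at hw
    obtain ⟨θ, hθ, rfl⟩ := hw
    rw [add_sub_cancel_left, norm_smul, Real.norm_of_nonneg hθ.1]
    exact mul_le_of_le_one_left (norm_nonneg _) hθ.2

/-- If `J • w` has inner product `1` with a unit vector `v`, then `J • w` depends on the unit
vector `w` in a Lipschitz way as long as `J` is bounded. -/
theorem norm_smul_sub_smul_le {F : Type*} [NormedAddCommGroup F] [InnerProductSpace ℝ F]
    {v w w' : F} {J J' : ℝ} (hv : ‖v‖ = 1) (hw' : ‖w'‖ = 1) (hJ : 0 ≤ J) (hJ' : 0 ≤ J')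
    (hJ2 : J ≤ 2) (hJ2' : J' ≤ 2) (h : inner ℝ v (J • w) = 1) (h' : inner ℝ v (J' • w') = 1) :
    ‖J • w - J' • w'‖ ≤ 6 * ‖w - w'‖ := by
  rw [real_inner_smul_right] at h h'
  have e : J - J' = J * J' * inner ℝ v (w' - w) := by
    rw [inner_sub_right]
    linear_combination J * (-h') + J' * h
  have h1 : |inner ℝ v (w' - w)| ≤ ‖w - w'‖ := by
    have := abs_real_inner_le_norm v (w' - w)
    rwa [hv, one_mul, norm_sub_rev] at this
  have h2 : |J - J'| ≤ 4 * ‖w - w'‖ := by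
    rw [e, abs_mul, abs_of_nonneg (mul_nonneg hJ hJ')]
    have : J * J' ≤ 4 := by nlinarith
    gcongr
  calc ‖J • w - J' • w'‖ = ‖J • (w - w') + (J - J') • w'‖ := by congr 1; module
    _ ≤ J * ‖w - w'‖ + |J - J'| * 1 := by
        refine (norm_add_le _ _).trans (add_le_add ?_ ?_)
        · rw [norm_smul, Real.norm_of_nonneg hJ]
        · rw [norm_smul, hw', Real.norm_eq_abs]
    _ ≤ 6 * ‖w - w'‖ := by nlinarith [norm_nonneg (w - w')]

section Domain

variable {m : ℕ} [NeZero m] {Ω Γ₁ Γ : Set (Space m)} {n : Space m → Space m}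

/-- Where `f > 0` a whole neighbourhood misses `Ω`. Conversely a zero of `f` is a frontier point
only if `f < 0` arbitrarily close to it; moving along `-v` provides such points. -/
theorem IsLyapunovDomain.mem_surface_iff (h : IsLyapunovDomain Ω Γ₁ Γ n) {f : Space m → ℝ}
    {x v : Space m} (hx : x ∈ halfSpace m) (hf : ContinuousAt f x)
    (hΩ : ∀ᶠ z in 𝓝 x, z ∈ Ω ↔ f z < 0) (hfv : ∀ᶠ ε in 𝓝[>] (0 : ℝ), f x = 0 → f (x - ε • v) < 0) :
    x ∈ Γ ↔ f x = 0 := by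
  rw [h.surface_eq, h.isOpen.frontier_eq]
  constructor
  · rintro ⟨⟨hcl, hxΩ⟩, -⟩
    rw [hΩ.self_of_nhds, not_lt] at hxΩ
    refine le_antisymm ?_ hxΩ
    by_contra! hpos
    have : ∀ᶠ z in 𝓝 x, z ∉ Ω := by
      filter_upwards [hΩ, hf.eventually_const_lt hpos] with z h1 h2
      rw [h1]; linarith
    rw [mem_closure_iff_frequently] at hcl
    exact hcl this
  · intro hfx
    refine ⟨⟨?_, ?_⟩, hx⟩
    · have h2 : Tendsto (fun ε : ℝ => x - ε • v) (𝓝[>] 0) (𝓝 x) := by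
        have : Tendsto (fun ε : ℝ => x - ε • v) (𝓝 0) (𝓝 (x - (0 : ℝ) • v)) :=
          Continuous.tendsto (by fun_prop) 0
        rw [zero_smul, sub_zero] at this
        exact this.mono_left nhdsWithin_le_nhds
      refine mem_closure_of_tendsto h2 ?_
      filter_upwards [h2.eventually hΩ, hfv] with ε h3 h4
      exact h3.2 (h4 hfx)
    · rw [hΩ.self_of_nhds, hfx]
      exact lt_irrefl _

/-- The defining function at `t` also defines `Ω` near neighbouring points of the graph. Uniqueness
of the normal therefore identifies `n` there with the normalized graph normal, and the Hölder
condition on `n` passes to the gradient `u`. -/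
theorem IsLyapunovDomain.exists_graphChart (h : IsLyapunovDomain Ω Γ₁ Γ n) {t : Space m}
    (ht : t ∈ Γ) : Nonempty (GraphChart Ω Γ n t) := by
  obtain ⟨a, ha, l, hl, hal⟩ := h.holder_normal
  have hnt := h.normal t ht
  obtain ⟨v, hvdef⟩ : ∃ v, v = n t := ⟨_, rfl⟩
  rw [← hvdef] at hnt
  obtain ⟨hv, ψ, hψ, hψ0, hψ', hΩψ⟩ := hnt
  obtain ⟨L⟩ := exists_orthogonal_isometry hv
  let E := EuclideanSpace ℝ (Fin (m - 1))
  let ι : E →ₗᵢ[ℝ] Space m := (ℝ ∙ v)ᗮ.subtypeₗᵢ.comp L.toLinearIsometry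
  let P : Space m →L[ℝ] E :=
    (L.symm.toContinuousLinearEquiv : _ →L[ℝ] _).comp (ℝ ∙ v)ᗮ.orthogonalProjectionOnto
  have hιP : ∀ x, ι (P x) + inner ℝ v x • v = x := by
    intro x
    have : ι (P x) = ((ℝ ∙ v)ᗮ.orthogonalProjectionOnto x : Space m) := by simp [ι, P]
    rw [this]
    exact orthogonalProjection_add_inner hv x
  have hιv : ∀ y, inner ℝ v (ι y) = 0 := fun y =>
    Submodule.mem_orthogonal_singleton_iff_inner_right.1 (L y).2
  have hvv : inner ℝ v v = (1 : ℝ) := by rw [real_inner_self_eq_norm_sq, hv, one_pow]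
  have hPι : ∀ y (c : ℝ), P (ι y + c • v) = y := by
    intro y c
    have h1 := hιP (ι y + c • v)
    rw [inner_add_right, real_inner_smul_right, hιv, hvv, mul_one, zero_add] at h1
    exact ι.injective (add_right_cancel h1)
  let φ : E → ℝ := fun y => ψ (L y)
  have hφ1 : ContDiffAt ℝ 1 φ 0 := by
    have h1 : ContDiffAt ℝ 1 ψ (L 0) := by rwa [map_zero]
    exact h1.comp (0 : E) L.contDiff.contDiffAt
  have hφ0 : φ 0 = 0 := by simp [φ, hψ0]
  have hφ' : fderiv ℝ φ 0 = 0 := by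
    have h1 : HasFDerivAt ψ (0 : (ℝ ∙ v)ᗮ →L[ℝ] ℝ) (L 0) := by
      rw [map_zero, ← hψ']
      exact (hψ.differentiableAt one_ne_zero).hasFDerivAt
    have := (h1.comp (0 : E) L.toContinuousLinearEquiv.hasFDerivAt).fderiv
    simpa using! this
  let u : E → E := fun y => (InnerProductSpace.toDual ℝ E).symm (fderiv ℝ φ y)
  have hu' : ∀ y, innerSL ℝ (u y) = fderiv ℝ φ y := by
    intro y
    ext z
    simp only [innerSL_apply_apply, u]
    exact InnerProductSpace.toDual_symm_apply
  have hu0 : u 0 = 0 := by simp [u, hφ']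
  obtain ⟨W, hW, hWφ⟩ := (hφ1.eventually (by simp)).exists_mem
  obtain ⟨ρ₀, hρ₀, hρ₀W⟩ := Metric.mem_nhds_iff.1 hW
  have hstrict : ∀ y ∈ Metric.ball 0 ρ₀, HasStrictFDerivAt φ (innerSL ℝ (u y)) y := by
    intro y hy
    rw [hu']
    exact (hWφ y (hρ₀W hy)).hasStrictFDerivAt one_ne_zero
  have hucont : ContinuousOn u (Metric.ball 0 ρ₀) := by
    have h1 : ContDiffOn ℝ 1 φ (Metric.ball 0 ρ₀) := fun y hy =>
      (hWφ y (hρ₀W hy)).contDiffWithinAt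
    have h2 := h1.continuousOn_fderiv_of_isOpen Metric.isOpen_ball le_rfl
    exact (InnerProductSpace.toDual ℝ E).symm.continuous.comp_continuousOn h2
  let f : Space m → ℝ := fun x => inner ℝ v (x - t) - φ (P (x - t))
  have hΩf : ∀ᶠ x in 𝓝 t, x ∈ Ω ↔ f x < 0 := by
    filter_upwards [hΩψ] with x hx
    rw [hx, ← sub_neg]
    simp [f, φ, P]
  have hPt : Tendsto (fun x => P (x - t)) (𝓝 t) (𝓝 0) := by
    have : Tendsto (fun x => P (x - t)) (𝓝 t) (𝓝 (P (t - t))) :=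
      Continuous.tendsto (by fun_prop) t
    rwa [sub_self, map_zero] at this
  have hgood : ∀ᶠ x in 𝓝 t, x ∈ halfSpace m ∧ (∀ᶠ z in 𝓝 x, z ∈ Ω ↔ f z < 0) ∧
      P (x - t) ∈ Metric.ball 0 ρ₀ :=
    ((isOpen_halfSpace m).eventually_mem (h.surface_subset ht)).and
      ((eventually_eventually_nhds.2 hΩf).and (hPt (Metric.ball_mem_nhds 0 hρ₀)))
  have hfcont : ∀ x, P (x - t) ∈ Metric.ball 0 ρ₀ → ContinuousAt f x := by
    intro x hx
    have h1 : ContinuousAt (fun x => P (x - t)) x := by fun_prop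
    exact ContinuousAt.sub (by fun_prop)
      (ContinuousAt.comp (g := φ) (hstrict _ hx).continuousAt h1)
  have hfv : ∀ x (ε : ℝ), f (x - ε • v) = f x - ε := by
    intro x ε
    have h1 : P (x - ε • v - t) = P (x - t) := by
      have h2 := hPι 0 1
      rw [map_zero, zero_add, one_smul] at h2
      rw [sub_right_comm, map_sub, map_smul, h2, smul_zero, sub_zero]
    simp only [f]
    rw [h1, sub_right_comm, inner_sub_right, real_inner_smul_right, hvv]
    ring
  have hmem : ∀ᶠ x in 𝓝 t, (x ∈ Γ ↔ f x = 0) := by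
    filter_upwards [hgood] with x ⟨h1, h2, h3⟩
    refine h.mem_surface_iff (v := v) h1 (hfcont x h3) h2 ?_
    filter_upwards [self_mem_nhdsWithin] with ε hε h4
    rw [hfv, h4]
    simpa using hε
  let g : E → Space m := fun y => t + ι y + φ y • v
  have hg0 : g 0 = t := by simp [g, hφ0]
  have hPg : ∀ y, P (g y - t) = y := by
    intro y
    have : g y - t = ι y + φ y • v := by simp only [g]; abel
    rw [this, hPι]
  have hfg : ∀ y, f (g y) = 0 := by
    intro y
    simp only [f]
    rw [hPg]
    have : g y - t = ι y + φ y • v := by simp only [g]; abel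
    rw [this, inner_add_right, real_inner_smul_right, hιv, hvv]
    ring
  have hgc : ContinuousAt g 0 :=
    (continuousAt_const.add ι.continuous.continuousAt).add
      (hφ1.continuousAt.smul continuousAt_const)
  have hgt : Tendsto g (𝓝 0) (𝓝 t) := by
    have := hgc.tendsto; rwa [hg0] at this
  have huc0 : ContinuousAt u 0 := hucont.continuousAt (Metric.ball_mem_nhds 0 hρ₀)
  have hsmall : ∀ᶠ y in 𝓝 (0 : E), g y ∈ Γ ∧ (∀ᶠ z in 𝓝 (g y), z ∈ Ω ↔ f z < 0) ∧
      ‖u y‖ < 1 / 2 ∧ y ∈ Metric.ball 0 ρ₀ := by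
    have h1 : ∀ᶠ y in 𝓝 (0 : E), ‖u y‖ < 1 / 2 := by
      refine huc0.norm.eventually_lt_const ?_
      simp [hu0]
    filter_upwards [hgt.eventually hmem, hgt.eventually hgood, h1, Metric.ball_mem_nhds 0 hρ₀]
      with y h2 h3 h4 h5
    exact ⟨h2.2 (hfg y), h3.2.1, h4, h5⟩
  -- On this ball the graph lies in `Γ`, the defining function still describes `Ω` locally, and the
  -- slope is below `1/2`.
  obtain ⟨ρ, hρ, hρball⟩ := Metric.eventually_nhds_iff_ball.1 hsmall
  have hN : ∀ w : E, ‖v - ι w‖ = √(1 + ‖w‖ ^ 2) := by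
    intro w
    rw [eq_comm, Real.sqrt_eq_iff_mul_self_eq (by positivity) (norm_nonneg _), ← sq,
      @norm_sub_sq_real, hιv, hv, ι.norm_map]
    ring
  have hnormal : ∀ y ∈ Metric.ball 0 ρ, √(1 + ‖u y‖ ^ 2) • n (g y) = v - ι (u y) := by
    intro y hy
    obtain ⟨h1, h2, h3, h4⟩ := hρball y hy
    obtain ⟨f₁, hf₁, hf₁p, hΩ₁⟩ := (h.normal _ h1).exists_defining
    have hfd : HasFDerivAt f (innerSL ℝ (v - ι (u y))) (g y) := by
      have a1 : HasFDerivAt (fun x : Space m => inner ℝ v (x - t)) (innerSL ℝ v) (g y) :=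
        hasFDerivAt_apply_sub (innerSL ℝ v) t (g y)
      have a2 := hasFDerivAt_apply_sub P t (g y)
      have a3 : HasFDerivAt φ (innerSL ℝ (u y)) (P (g y - t)) := by
        rw [hPg]; exact (hstrict y h4).hasFDerivAt
      have a4 := a1.sub (a3.comp (g y) a2)
      convert! a4 using 1
      ext e
      have a5 : inner ℝ (ι (u y)) e = inner ℝ (u y) (P e) := by
        conv_lhs => rw [← hιP e]
        rw [inner_add_right, real_inner_smul_right, real_inner_comm v, hιv, ι.inner_map_map]
        ring
      simp [a5]
    have := eq_norm_smul_of_local_defining (h.norm_normal h1) hf₁ hfd hf₁p (hfg y) hΩ₁ h2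
    rw [hN] at this
    exact this.symm
  have hJ2 : ∀ y ∈ Metric.ball 0 ρ, √(1 + ‖u y‖ ^ 2) ≤ 2 := by
    intro y hy
    rw [Real.sqrt_le_left (by norm_num)]
    have := (hρball y hy).2.2.1
    nlinarith [norm_nonneg (u y)]
  have hφlip : ∀ y ∈ Metric.ball 0 ρ, ∀ z ∈ Metric.ball 0 ρ, |φ z - φ y| ≤ 1 / 2 * ‖z - y‖ := by
    intro y hy z hz
    have := (convex_ball (0 : E) ρ).norm_image_sub_le_of_norm_hasFDerivWithin_le (f := φ)
      (f' := fun y => innerSL ℝ (u y)) (C := 1 / 2)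
      (fun w hw => (hstrict w (hρball w hw).2.2.2).hasFDerivAt.hasFDerivWithinAt)
      (fun w hw => by rw [innerSL_apply_norm]; exact (hρball w hw).2.2.1.le) hy hz
    simpa using this
  have hglip : ∀ y ∈ Metric.ball 0 ρ, ∀ z ∈ Metric.ball 0 ρ, dist (g z) (g y) ≤ 2 * ‖z - y‖ := by
    intro y hy z hz
    have e : g z - g y = ι (z - y) + (φ z - φ y) • v := by
      simp only [g, map_sub]; module
    rw [dist_eq_norm, e]
    refine (norm_add_le _ _).trans ?_
    rw [ι.norm_map, norm_smul, hv, Real.norm_eq_abs]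
    have := hφlip y hy z hz
    have := norm_nonneg (z - y)
    linarith
  -- The scaled normals have vertical component `1`, so they are controlled by the unit normals with
  -- the constant `6` of `norm_smul_sub_smul_le`; `2 ^ l` comes from the `2`-Lipschitz graph map.
  have hholder : ∀ y ∈ Metric.ball 0 ρ, ∀ z ∈ Metric.ball 0 ρ,
      ‖u z - u y‖ ≤ (6 * a * 2 ^ l) * ‖z - y‖ ^ l := by
    intro y hy z hz
    have e : ‖u z - u y‖ = ‖√(1 + ‖u z‖ ^ 2) • n (g z) - √(1 + ‖u y‖ ^ 2) • n (g y)‖ := by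
      rw [hnormal y hy, hnormal z hz, sub_sub_sub_cancel_left, ← ι.map_sub, ι.norm_map, norm_sub_rev]
    have hone : ∀ y ∈ Metric.ball 0 ρ, inner ℝ v (√(1 + ‖u y‖ ^ 2) • n (g y)) = 1 := by
      intro y hy
      rw [hnormal y hy, inner_sub_right, hvv, hιv, sub_zero]
    rw [e]
    refine (norm_smul_sub_smul_le hv (h.norm_normal (hρball y hy).1) (Real.sqrt_nonneg _)
      (Real.sqrt_nonneg _) (hJ2 z hz) (hJ2 y hy) (hone z hz) (hone y hy)).trans ?_
    have h1 := hal _ (hρball z hz).1 _ (hρball y hy).1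
    have h2 : dist (g z) (g y) ^ l ≤ 2 ^ l * ‖z - y‖ ^ l := by
      rw [← Real.mul_rpow (by norm_num) (norm_nonneg _)]
      exact Real.rpow_le_rpow dist_nonneg (hglip y hy z hz) hl.le
    calc 6 * ‖n (g z) - n (g y)‖ ≤ 6 * (a * (2 ^ l * ‖z - y‖ ^ l)) := by
          gcongr
          exact h1.trans (by gcongr)
      _ = _ := by ring
  subst hvdef
  refine ⟨{ ι := ι, P := P, φ := φ, u := u, ρ := ρ, C := 6 * a * 2 ^ l, l := l, ρ_pos := hρ
            C_nonneg := by positivity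
            l_pos := hl
            norm_normal := hv
            inner_ι := hιv
            decomp := hιP
            hasStrictFDerivAt := fun y hy => hstrict y (hρball y hy).2.2.2
            continuousOn_u := hucont.mono fun y hy => (hρball y hy).2.2.2
            φ_zero := hφ0
            u_zero := hu0
            norm_u_le := fun y hy => (hρball y hy).2.2.1.le
            mem_surface := fun y hy => (hρball y hy).1
            normal_eq := hnormal
            taylor := fun y hy z hz => abs_taylor_le_of_holder (convex_ball 0 ρ)
              (fun w hw => (hstrict w (hρball w hw).2.2.2).hasFDerivAt) (by positivity) hl
              hholder hy hz
            covers := ?_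
            inside := ?_
            outside := ?_ }⟩
  · filter_upwards [hmem, hPt (Metric.ball_mem_nhds 0 hρ)] with s h1 h2 h3
    refine ⟨h2, ?_⟩
    have h4 := h1.1 h3
    simp only [f, sub_eq_zero] at h4
    rw [← h4, add_assoc, hιP, add_sub_cancel]
  · filter_upwards [hΩf] with x h1 h2
    simpa [f, sub_neg] using h1.1 h2
  · filter_upwards [hΩf, hmem] with x h1 h2 h3
    have h4 : ¬ f x < 0 := fun h5 => h3 (subset_closure (h1.2 h5))
    have h5 : f x ≠ 0 := fun h6 => by
      have h7 := h2.2 h6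
      rw [h.surface_eq] at h7
      exact h3 (frontier_subset_closure h7.1)
    have h6 : 0 < f x := lt_of_le_of_ne (not_lt.1 h4) h5.symm
    simpa [f, sub_pos] using h6

end Domain

/-! ### Limits of weakly singular and Poisson-type integrals -/

section Limits

variable {E X : Type*} [NormedAddCommGroup E] [InnerProductSpace ℝ E] [FiniteDimensional ℝ E]
  [MeasurableSpace E] [BorelSpace E] {l : Filter X}

theorem integrableOn_norm_sub_rpow [Nontrivial E] {s : ℝ} (hs : s < Module.finrank ℝ E) (c : E)
    (r : ℝ) : IntegrableOn (fun y => ‖y - c‖ ^ (-s)) (Metric.ball c r) := by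
  have h1 : IntegrableOn (fun y : E => ‖y‖ ^ (-s)) (Metric.ball 0 r) := by
    refine integrableOn_ball_of_norm_le_rpow (C := 1) Module.finrank_pos hs ?_
      (Measurable.aestronglyMeasurable (by fun_prop))
    refine Eventually.of_forall fun y => ?_
    rw [one_mul, Real.norm_of_nonneg (by positivity)]
  have h2 := (integrable_indicator_iff measurableSet_ball).2 h1
  have h3 := h2.comp_sub_right c
  rw [← integrable_indicator_iff measurableSet_ball]
  refine h3.congr (Eventually.of_forall fun y => ?_)
  simp only [indicator, mem_ball_iff_norm, sub_zero]

theorem integrableOn_of_norm_le_rpow [Nontrivial E] {s C ρ : ℝ} (hs : s < Module.finrank ℝ E)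
    {c : E} (hc : c ∈ Metric.ball (0 : E) ρ) {f : E → ℝ}
    (hf : AEStronglyMeasurable f (volume.restrict (Metric.ball 0 ρ)))
    (hfC : ∀ y ∈ Metric.ball (0 : E) ρ, y ≠ c → |f y| ≤ C * ‖y - c‖ ^ (-s)) :
    IntegrableOn f (Metric.ball 0 ρ) := by
  have h1 : Metric.ball (0 : E) ρ ⊆ Metric.ball c (2 * ρ) := by
    intro y hy
    rw [Metric.mem_ball] at *
    have := dist_triangle_right y c 0
    linarith
  refine Integrable.mono' (((integrableOn_norm_sub_rpow hs c (2 * ρ)).mono_set h1).const_mul C) hf ?_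
  filter_upwards [ae_restrict_mem measurableSet_ball,
    ae_restrict_of_ae (compl_mem_ae_iff.2 (measure_singleton c))] with y hy hyc
  exact hfC y hy hyc

/-- Continuity of a weakly singular integral whose singularity moves with the parameter. -/
theorem tendsto_integral_weaklySingular [Nontrivial E] [l.IsCountablyGenerated] {s C ρ : ℝ}
    (hρ : 0 < ρ) (hC : 0 ≤ C) (hs : s < Module.finrank ℝ E) {c : X → E} (hc : Tendsto c l (𝓝 0))
    {W : X → E → ℝ} {W₀ : E → ℝ}
    (hm : ∀ᶠ i in l, AEStronglyMeasurable (W i) (volume.restrict (Metric.ball 0 ρ)))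
    (hb : ∀ᶠ i in l, ∀ y ∈ Metric.ball (0 : E) ρ, y ≠ c i → |W i y| ≤ C * ‖y - c i‖ ^ (-s))
    (hlim : ∀ y ∈ Metric.ball (0 : E) ρ, y ≠ 0 →
      Tendsto (fun p : X × E => W p.1 p.2) (l ×ˢ 𝓝 y) (𝓝 (W₀ y))) :
    Tendsto (fun i => ∫ y in Metric.ball 0 ρ, W i y) l (𝓝 (∫ y in Metric.ball 0 ρ, W₀ y)) := by
  have hcρ : ∀ᶠ i in l, c i ∈ Metric.ball (0 : E) ρ := hc (Metric.ball_mem_nhds 0 hρ)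
  -- Translation by `c i` puts the singularity at `0`, so a single majorant on the ball of radius `2
  -- * ρ` serves all parameters near the limit. The evaluation point `c i + z` then moves, which is
  -- why `hlim` is a joint limit.
  have e : ∀ i, ∫ y in Metric.ball 0 ρ, W i y =
      ∫ z, (Metric.ball 0 ρ).indicator (W i) (c i + z) := fun i => by
    rw [integral_add_left_eq_self, integral_indicator measurableSet_ball]
  simp_rw [e]
  rw [← integral_indicator measurableSet_ball]
  refine tendsto_integral_filter_of_dominated_convergence
    ((Metric.ball 0 (2 * ρ)).indicator fun z => C * ‖z‖ ^ (-s)) ?_ ?_ ?_ ?_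
  · filter_upwards [hm, hb, hcρ] with i h1 h2 h3
    exact ((integrable_indicator_iff measurableSet_ball).2
      (integrableOn_of_norm_le_rpow hs h3 h1 h2)).comp_add_left (c i) |>.1
  · filter_upwards [hb, hcρ] with i h1 h2
    filter_upwards [compl_mem_ae_iff.2 (measure_singleton (0 : E))] with z hz
    have hpos : 0 ≤ C * ‖z‖ ^ (-s) := by positivity
    by_cases hz' : c i + z ∈ Metric.ball (0 : E) ρ
    · rw [indicator_of_mem hz', indicator_of_mem]
      · have := h1 _ hz' (by simpa using hz)
        rwa [add_sub_cancel_left] at this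
      · rw [mem_ball_zero_iff] at *
        have := norm_sub_le (c i + z) (c i)
        rw [add_sub_cancel_left] at this
        linarith
    · rw [indicator_of_notMem hz', norm_zero]
      exact indicator_nonneg (fun z _ => by positivity) z
  · rw [integrable_indicator_iff measurableSet_ball]
    simpa using! (integrableOn_norm_sub_rpow hs 0 (2 * ρ)).const_mul C
  -- On the sphere of radius `ρ` the translated indicators need not converge, but it is a null set.
  · filter_upwards [compl_mem_ae_iff.2 (measure_singleton (0 : E)),
      compl_mem_ae_iff.2 (Measure.addHaar_sphere volume (0 : E) ρ)] with z hz hzs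
    have ht : Tendsto (fun i => c i + z) l (𝓝 z) := by
      simpa using hc.add_const z
    rcases lt_trichotomy ‖z‖ ρ with h1 | h1 | h1
    · have hzb : z ∈ Metric.ball (0 : E) ρ := mem_ball_zero_iff.2 h1
      rw [indicator_of_mem hzb]
      have h2 := (hlim z hzb hz).comp (tendsto_id.prodMk ht)
      refine h2.congr' ?_
      filter_upwards [ht.eventually (Metric.isOpen_ball.eventually_mem hzb)] with i hi
      rw [indicator_of_mem hi]
      rfl
    · exact absurd (mem_sphere_zero_iff_norm.2 h1) hzs
    · rw [indicator_of_notMem (by rw [mem_ball_zero_iff]; linarith)]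
      refine tendsto_const_nhds.congr' ?_
      filter_upwards [ht.norm.eventually_const_lt h1] with i hi
      rw [indicator_of_notMem (by rw [mem_ball_zero_iff]; linarith)]

/-- Over a graph of slope at most `1/2` the distance to a point at height `h` controls both `h` and
the horizontal distance `w`. This yields the majorant of the Poisson-type integral. -/
theorem quarter_le_sq_add_sq {w d h : ℝ} (hd : |d| ≤ 1 / 2 * w) :
    (h ^ 2 + w ^ 2) / 4 ≤ w ^ 2 + (d - h) ^ 2 := by
  have h1 : d ^ 2 ≤ w ^ 2 / 4 := by
    have := sq_le_sq' (abs_le.1 hd).1 (abs_le.1 hd).2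
    linarith
  nlinarith [sq_nonneg (2 * d - h)]

/-- The Poisson-type integral over a graph, whose pole tends to the surface, concentrates at the
limit point. -/
theorem tendsto_integral_poisson [l.IsCountablyGenerated] {p C ρ : ℝ}
    (hp : p = Module.finrank ℝ E + 1) (hρ : 0 < ρ) {φ : E → ℝ}
    (hφ : ∀ y ∈ Metric.ball (0 : E) ρ, ∀ z ∈ Metric.ball (0 : E) ρ, |φ z - φ y| ≤ 1 / 2 * ‖z - y‖)
    (hφ' : HasStrictFDerivAt φ (0 : E →L[ℝ] ℝ) 0) {c : X → E} (hc : Tendsto c l (𝓝 0)) {h : X → ℝ}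
    (hh : Tendsto h l (𝓝 0)) (hh0 : ∀ᶠ i in l, h i ≠ 0) {G : X → E → ℝ} {G₀ : ℝ}
    (hm : ∀ᶠ i in l, AEStronglyMeasurable (G i) (volume.restrict (Metric.ball 0 ρ)))
    (hb : ∀ᶠ i in l, ∀ y ∈ Metric.ball (0 : E) ρ, |G i y| ≤ C)
    (hlim : Tendsto (fun q : X × E => G q.1 q.2) (l ×ˢ 𝓝 0) (𝓝 G₀)) :
    (∀ᶠ i in l, IntegrableOn
      (fun y => (‖y - c i‖ ^ 2 + (φ y - φ (c i) - h i) ^ 2) ^ (-(p / 2)) * G i y)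
      (Metric.ball 0 ρ)) ∧
    Tendsto (fun i => |h i| * ∫ y in Metric.ball 0 ρ,
        (‖y - c i‖ ^ 2 + (φ y - φ (c i) - h i) ^ 2) ^ (-(p / 2)) * G i y) l
      (𝓝 (G₀ * ∫ z : E, (1 + ‖z‖ ^ 2) ^ (-(p / 2)))) := by
  have hp0 : 0 < p := by rw [hp]; positivity
  have hcρ : ∀ᶠ i in l, c i ∈ Metric.ball (0 : E) ρ := hc (Metric.ball_mem_nhds 0 hρ)
  let D : X → E → ℝ := fun i y => ‖y - c i‖ ^ 2 + (φ y - φ (c i) - h i) ^ 2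
  have hD : ∀ i, c i ∈ Metric.ball (0 : E) ρ → ∀ y ∈ Metric.ball (0 : E) ρ,
      (h i ^ 2 + ‖y - c i‖ ^ 2) / 4 ≤ D i y := fun i hi y hy =>
    quarter_le_sq_add_sq (hφ _ hi _ hy)
  have hφc : ContinuousOn φ (Metric.ball 0 ρ) := by
    refine (LipschitzOnWith.of_dist_le_mul (K := 1 / 2) fun y hy z hz => ?_).continuousOn
    rw [Real.dist_eq, dist_eq_norm]
    simpa using hφ z hz y hy
  have hint : ∀ᶠ i in l, IntegrableOn (fun y => D i y ^ (-(p / 2)) * G i y)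
      (Metric.ball 0 ρ) := by
    filter_upwards [hcρ, hh0, hm, hb] with i h1 h2 h3 h4
    have hpos : ∀ y ∈ Metric.ball (0 : E) ρ, h i ^ 2 / 4 ≤ D i y := fun y hy =>
      le_trans (by nlinarith [sq_nonneg ‖y - c i‖]) (hD i h1 y hy)
    have h20 : 0 < h i ^ 2 / 4 := by positivity
    have hDc : ContinuousOn (fun y => D i y ^ (-(p / 2))) (Metric.ball 0 ρ) := by
      refine ContinuousOn.rpow_const ?_ fun y hy => Or.inl (h20.trans_le (hpos y hy)).ne'
      exact ContinuousOn.add (by fun_prop)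
        (((hφc.sub continuousOn_const).sub continuousOn_const).pow 2)
    refine IntegrableOn.of_bound (C := (h i ^ 2 / 4) ^ (-(p / 2)) * C) measure_ball_lt_top
      ((hDc.aestronglyMeasurable measurableSet_ball).mul h3) ?_
    refine ae_restrict_of_forall_mem measurableSet_ball fun y hy => ?_
    rw [norm_mul]
    refine mul_le_mul ?_ (h4 y hy) (norm_nonneg _) (by positivity)
    rw [Real.norm_of_nonneg (Real.rpow_nonneg (h20.trans_le (hpos y hy)).le _)]
    exact Real.rpow_le_rpow_of_nonpos h20 (hpos y hy) (by linarith)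
  refine ⟨hint, ?_⟩
  let f : X → E → ℝ := fun i => (Metric.ball 0 ρ).indicator fun y => D i y ^ (-(p / 2)) * G i y
  have hpk : ∀ r : ℝ, 0 < r → r ^ p = r * r ^ Module.finrank ℝ E := fun r hr => by
    rw [hp, Real.rpow_add_one hr.ne', Real.rpow_natCast, mul_comm]
  -- Substitution `y = c i + |h i| z`: the Jacobian is `|h i| ^ (p - 1)`, and the factor in front
  -- completes it to the power that the kernel's homogeneity absorbs.
  have e : ∀ᶠ i in l, ∫ z, |h i| ^ p * f i (c i + |h i| • z) =
      |h i| * ∫ y in Metric.ball 0 ρ, D i y ^ (-(p / 2)) * G i y := by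
    filter_upwards [hh0] with i hi
    have hi' : 0 < |h i| := abs_pos.2 hi
    rw [integral_const_mul, Measure.integral_comp_smul volume (fun z => f i (c i + z)) |h i|,
      integral_add_left_eq_self, ← integral_indicator measurableSet_ball, hpk _ hi',
      abs_of_pos (inv_pos.2 (pow_pos hi' _)), smul_eq_mul, mul_assoc,
      mul_inv_cancel_left₀ (pow_pos hi' _).ne']
  refine Tendsto.congr' e ?_
  rw [← integral_const_mul]
  refine tendsto_integral_filter_of_dominated_convergence
    (fun z => (1 / 4 : ℝ) ^ (-(p / 2)) * (1 + ‖z‖ ^ 2) ^ (-p / 2) * C) ?_ ?_ ?_ ?_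
  · filter_upwards [hint, hh0] with i h1 h2
    have h3 := ((integrable_indicator_iff measurableSet_ball).2 h1).comp_add_left (c i)
    exact ((h3.comp_smul (abs_pos.2 h2).ne').const_mul (|h i| ^ p)).1
  · filter_upwards [hb, hcρ, hh0] with i h1 h2 h3
    refine Eventually.of_forall fun z => ?_
    have hC : 0 ≤ C := (abs_nonneg _).trans (h1 0 (Metric.mem_ball_self hρ))
    have h3' : 0 < |h i| := abs_pos.2 h3
    by_cases hz : c i + |h i| • z ∈ Metric.ball (0 : E) ρ
    · simp only [f]
      rw [indicator_of_mem hz, norm_mul, norm_mul, ← mul_assoc]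
      refine mul_le_mul ?_ (h1 _ hz) (norm_nonneg _) (by positivity)
      have hq := hD i h2 _ hz
      rw [add_sub_cancel_left, norm_smul, Real.norm_eq_abs, abs_abs, mul_pow, sq_abs] at hq
      have hq0 : 0 < h i ^ 2 * (1 / 4 * (1 + ‖z‖ ^ 2)) := by positivity
      have hq1 : h i ^ 2 * (1 / 4 * (1 + ‖z‖ ^ 2)) ≤ D i (c i + |h i| • z) := by linarith
      rw [Real.norm_of_nonneg (by positivity),
        Real.norm_of_nonneg (Real.rpow_nonneg (hq0.le.trans hq1) _)]
      calc |h i| ^ p * D i (c i + |h i| • z) ^ (-(p / 2))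
          ≤ |h i| ^ p * (h i ^ 2 * (1 / 4 * (1 + ‖z‖ ^ 2))) ^ (-(p / 2)) := by
            exact mul_le_mul_of_nonneg_left
              (Real.rpow_le_rpow_of_nonpos hq0 hq1 (by linarith)) (by positivity)
        _ = _ := by
            rw [Real.mul_rpow (by positivity) (by positivity),
              Real.mul_rpow (by norm_num) (by positivity), ← sq_abs, ← Real.rpow_natCast,
              ← Real.rpow_mul h3'.le, ← mul_assoc, ← Real.rpow_add h3', neg_div,
              show p + ((2 : ℕ) : ℝ) * -(p / 2) = 0 by push_cast; ring, Real.rpow_zero, one_mul]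
    · simp only [f]
      rw [indicator_of_notMem hz, mul_zero, norm_zero]
      positivity
  · refine ((integrable_rpow_neg_one_add_norm_sq ?_).const_mul _).mul_const _
    rw [hp]; linarith
  · refine Eventually.of_forall fun z => ?_
    have ht : Tendsto (fun i => c i + |h i| • z) l (𝓝 0) := by
      have h1 : Tendsto (fun i => |h i|) l (𝓝 0) := by simpa using hh.abs
      simpa using hc.add (h1.smul_const z)
    -- the difference quotients tend to `0`
    have hq : Tendsto (fun i => (φ (c i + |h i| • z) - φ (c i)) / |h i|) l (𝓝 0) := by
      have h1 := hφ'.isLittleO.comp_tendsto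
        (f := fun q : E × E => φ q.1 - φ q.2 - (0 : E →L[ℝ] ℝ) (q.1 - q.2)) (ht.prodMk_nhds hc)
      have h2 : (fun i => φ (c i + |h i| • z) - φ (c i)) =o[l] fun i => |h i| • z := by
        simpa [Function.comp_def] using! h1
      have h3 : (fun i => |h i| • z) =O[l] fun i => |h i| := by
        refine Asymptotics.IsBigO.of_bound ‖z‖ (Eventually.of_forall fun i => ?_)
        rw [norm_smul, mul_comm]
      exact (h2.trans_isBigO h3).tendsto_div_nhds_zero
    have hsq : Tendsto (fun i => ‖z‖ ^ 2 +
        ((φ (c i + |h i| • z) - φ (c i)) / |h i| - h i / |h i|) ^ 2) l (𝓝 (1 + ‖z‖ ^ 2)) := by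
      -- In the expanded square the cross term is a difference quotient tending to `0` times the
      -- bounded sign `h / |h|`. The sign squares to `1`, so both sides of the graph give the same
      -- limit.
      have h1 : Tendsto (fun i => ((φ (c i + |h i| • z) - φ (c i)) / |h i|) ^ 2 -
          2 * ((φ (c i + |h i| • z) - φ (c i)) / |h i| * (h i / |h i|)) + 1) l
          (𝓝 (0 ^ 2 - 2 * 0 + 1)) := by
        refine (((hq.pow 2).sub (Tendsto.const_mul 2 ?_)).add_const 1)
        refine hq.zero_mul_isBoundedUnder_le ?_
        refine isBoundedUnder_of_eventually_le (a := 1) (Eventually.of_forall fun i => ?_)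
        simp only [Function.comp, Real.norm_eq_abs, abs_div, abs_abs]
        exact div_self_le_one _
      have h2 := h1.const_add (‖z‖ ^ 2)
      have e2 : ‖z‖ ^ 2 + ((0 : ℝ) ^ 2 - 2 * 0 + 1) = 1 + ‖z‖ ^ 2 := by ring
      rw [e2] at h2
      refine h2.congr' ?_
      filter_upwards [hh0] with i hi
      have : (h i / |h i|) ^ 2 = 1 := by
        rw [div_pow, sq_abs, div_self (pow_ne_zero 2 hi)]
      rw [sub_sq, this]
      ring
    have hfin : Tendsto (fun i => (‖z‖ ^ 2 +
        ((φ (c i + |h i| • z) - φ (c i)) / |h i| - h i / |h i|) ^ 2) ^ (-(p / 2)) *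
          G i (c i + |h i| • z)) l (𝓝 (G₀ * (1 + ‖z‖ ^ 2) ^ (-(p / 2)))) := by
      rw [mul_comm G₀]
      refine Tendsto.mul (hsq.rpow_const (Or.inl (by positivity))) ?_
      exact hlim.comp (tendsto_id.prodMk ht)
    refine hfin.congr' ?_
    filter_upwards [hh0, ht.eventually (Metric.isOpen_ball.eventually_mem (Metric.mem_ball_self hρ))] with i hi hz
    have hi' : 0 < |h i| := abs_pos.2 hi
    simp only [f]
    rw [indicator_of_mem hz, ← mul_assoc]
    congr 1
    have hDe : D i (c i + |h i| • z) = |h i| ^ 2 * (‖z‖ ^ 2 +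
        ((φ (c i + |h i| • z) - φ (c i)) / |h i| - h i / |h i|) ^ 2) := by
      simp only [D]
      rw [add_sub_cancel_left, norm_smul, Real.norm_eq_abs, abs_abs]
      field_simp
    rw [hDe, Real.mul_rpow (by positivity) (by positivity), ← Real.rpow_natCast |h i|,
      ← Real.rpow_mul hi'.le, ← mul_assoc, ← Real.rpow_add hi',
      show p + ((2 : ℕ) : ℝ) * -(p / 2) = 0 by push_cast; ring, Real.rpow_zero, one_mul]

end Limits

/-! ### The layer density and its contribution away from the pole -/

theorem surfaceMeasure_singleton {m : ℕ} (hm : 2 < m) (x : Space m) : surfaceMeasure m {x} = 0 := by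
  have : NullSingletonClass (μH[((m - 1 : ℕ) : ℝ)] : Measure (Space m)) :=
    Measure.nullSingletonClass_hausdorff _ (by
      have : 0 < m - 1 := by omega
      exact_mod_cast this)
  rw [surfaceMeasure, Measure.euclideanHausdorffMeasure_def, Measure.smul_apply,
    measure_singleton, smul_zero]

section Layer

variable {m : ℕ} [NeZero m]

/-- The integrand of the double-layer potential. -/
noncomputable def layerDensity (α : ℝ) (n : Space m → Space m) (μ : Space m → ℝ)
    (x s : Space m) : ℝ :=
  s 0 ^ (2 * α) * μ s * fderiv ℝ (fun η => q₁ α η x) s (n s)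

/-- The density of the layer times a regular factor of the kernel. -/
noncomputable def weightedFactor (α : ℝ) (μ : Space m → ℝ) (j : ℝ) (s x : Space m) : ℝ :=
  s 0 ^ (2 * α) * μ s * kernelFactor m α j (‖s - x‖ ^ 2) (4 * s 0 * x 0)

theorem layerDensity_eq (hm : 2 < m) {α : ℝ} (hα : 0 < α) {n : Space m → Space m}
    {μ : Space m → ℝ} {x s : Space m} (hs : 0 < s 0) (hx : 0 < x 0) (hne : s ≠ x) :
    layerDensity α n μ x s = -kernelConst m α *
      (inner ℝ (s - x) (n s) * ‖s - x‖ ^ (-(m : ℝ)) * weightedFactor α μ 0 s x +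
        2 * x 0 * n s 0 * ‖s - x‖ ^ (2 - (m : ℝ)) * weightedFactor α μ 1 s x) := by
  rw [layerDensity, fderiv_q₁_apply hm hα hs hx hne, weightedFactor, weightedFactor]
  ring

/-- For `x₁ > 0` the arguments of the regular factor never vanish together, even at `s = x`. Since
`2α > 0`, the weight is also continuous at points `s` on the hyperplane, so `S` may be all of
`closure Γ`. -/
theorem tendsto_weightedFactor {α j : ℝ} (hα : 0 < α) (hj : 0 ≤ j) (hjm : j + α ≤ (m : ℝ) / 2)
    {μ : Space m → ℝ} {S : Set (Space m)} (hμ : ContinuousOn μ S) {s x : Space m} (hs : s ∈ S)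
    (hx : 0 < x 0) :
    Tendsto (fun q : Space m × Space m => weightedFactor α μ j q.1 q.2) (𝓝[S] s ×ˢ 𝓝 x)
      (𝓝 (weightedFactor α μ j s x)) := by
  have h1 : Tendsto (fun q : Space m × Space m => q.1 0 ^ (2 * α) * μ q.1) (𝓝[S] s ×ˢ 𝓝 x)
      (𝓝 (s 0 ^ (2 * α) * μ s)) := by
    have h2 : Tendsto (fun s : Space m => s 0 ^ (2 * α) * μ s) (𝓝[S] s)
        (𝓝 (s 0 ^ (2 * α) * μ s)) := by
      refine Tendsto.mul (Tendsto.mono_left ?_ nhdsWithin_le_nhds) (hμ s hs)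
      exact Continuous.tendsto (Continuous.rpow_const (by fun_prop)
        fun _ => Or.inr (by linarith)) s
    exact h2.comp tendsto_fst
  refine h1.mul ?_
  have h3 : ContinuousAt (fun q : Space m × Space m => (‖q.1 - q.2‖ ^ 2, 4 * q.1 0 * q.2 0))
      (s, x) := by fun_prop
  have h4 : (‖s - x‖ ^ 2, 4 * s 0 * x 0) ≠ 0 := by
    intro h
    have h5 := congrArg Prod.fst h
    have h6 := congrArg Prod.snd h
    simp only [Prod.fst_zero, Prod.snd_zero] at h5 h6
    have h7 : s = x := by
      rw [← sub_eq_zero, ← norm_eq_zero]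
      exact pow_eq_zero_iff two_ne_zero |>.1 h5
    rw [h7] at h6
    have : 0 < 4 * x 0 * x 0 := by positivity
    linarith
  have h5 := (ContinuousAt.comp (f := fun q : Space m × Space m =>
    (‖q.1 - q.2‖ ^ 2, 4 * q.1 0 * q.2 0)) (x := (s, x))
    (continuousAt_kernelFactor (m := m) hα hj hjm h4) h3).tendsto
  rw [nhds_prod_eq] at h5
  exact h5.mono_left (Filter.prod_mono nhdsWithin_le_nhds le_rfl)

/-- Compactness of `S` times a closed ball around `t` inside the half-space. With `S = closure Γ`
the bound is uniform up to the edge of the surface. -/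
theorem exists_bound_weightedFactor {α j : ℝ} (hα : 0 < α) (hj : 0 ≤ j)
    (hjm : j + α ≤ (m : ℝ) / 2) {μ : Space m → ℝ} {S : Set (Space m)} (hS : IsCompact S)
    (hμ : ContinuousOn μ S) {t : Space m} (ht : t ∈ halfSpace m) :
    ∃ M, 0 ≤ M ∧ ∀ᶠ x in 𝓝 t, ∀ s ∈ S, |weightedFactor α μ j s x| ≤ M := by
  obtain ⟨η, hη, hball⟩ := Metric.nhds_basis_closedBall.mem_iff.1
    ((isOpen_halfSpace m).mem_nhds ht)
  obtain ⟨M, hM⟩ := (hS.prod (isCompact_closedBall t η)).exists_bound_of_continuousOn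
    (f := fun q : Space m × Space m => weightedFactor α μ j q.1 q.2) (by
      rintro ⟨s, x⟩ ⟨hs, hx⟩
      have := tendsto_weightedFactor hα hj hjm hμ hs (hball hx)
      rw [ContinuousWithinAt, nhdsWithin_prod_eq]
      exact this.mono_left (Filter.prod_mono le_rfl nhdsWithin_le_nhds))
  refine ⟨max M 0, le_max_right _ _, ?_⟩
  filter_upwards [Metric.closedBall_mem_nhds t hη] with x hx s hs
  exact (hM (s, x) ⟨hs, hx⟩).trans (le_max_left _ _)

variable {Ω Γ₁ Γ : Set (Space m)} {n : Space m → Space m} {μ : Space m → ℝ} {α : ℝ}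

theorem IsLyapunovDomain.tendsto_layerDensity (h : IsLyapunovDomain Ω Γ₁ Γ n) (hm : 2 < m)
    (hα : 0 < α) (hα₁ : 2 * α < 1) (hμ : ContinuousOn μ (closure Γ)) {s x : Space m} (hs : s ∈ Γ)
    (hx : x ∈ halfSpace m) (hne : s ≠ x) :
    Tendsto (fun q : Space m × Space m => layerDensity α n μ q.2 q.1) (𝓝[Γ] s ×ˢ 𝓝 x)
      (𝓝 (layerDensity α n μ x s)) := by
  have hm' : (3 : ℝ) ≤ m := by exact_mod_cast hm
  have hle : 𝓝[Γ] s ×ˢ 𝓝 x ≤ 𝓝[closure Γ] s ×ˢ 𝓝 x :=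
    Filter.prod_mono (nhdsWithin_mono _ subset_closure) le_rfl
  have hle' : 𝓝[Γ] s ×ˢ 𝓝 x ≤ 𝓝 (s, x) := by
    rw [nhds_prod_eq]
    exact Filter.prod_mono nhdsWithin_le_nhds le_rfl
  have hn : Tendsto (fun q : Space m × Space m => n q.1) (𝓝[Γ] s ×ˢ 𝓝 x) (𝓝 (n s)) :=
    (h.continuousOn_normal s hs).tendsto.comp tendsto_fst
  have hn0 : Tendsto (fun q : Space m × Space m => n q.1 0) (𝓝[Γ] s ×ˢ 𝓝 x) (𝓝 (n s 0)) :=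
    (Continuous.tendsto (by fun_prop : Continuous fun y : Space m => y 0) (n s)).comp hn
  have hsub : Tendsto (fun q : Space m × Space m => q.1 - q.2) (𝓝[Γ] s ×ˢ 𝓝 x) (𝓝 (s - x)) :=
    (Continuous.tendsto (by fun_prop : Continuous fun q : Space m × Space m => q.1 - q.2)
      (s, x)).mono_left hle'
  have hpow : ∀ e : ℝ, Tendsto (fun q : Space m × Space m => ‖q.1 - q.2‖ ^ e) (𝓝[Γ] s ×ˢ 𝓝 x)
      (𝓝 (‖s - x‖ ^ e)) := fun e =>
    hsub.norm.rpow_const (Or.inl (norm_ne_zero_iff.2 (sub_ne_zero.2 hne)))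
  have hx0 : Tendsto (fun q : Space m × Space m => 2 * q.2 0) (𝓝[Γ] s ×ˢ 𝓝 x) (𝓝 (2 * x 0)) :=
    (Continuous.tendsto (by fun_prop : Continuous fun q : Space m × Space m => 2 * q.2 0)
      (s, x)).mono_left hle'
  have w0 := (tendsto_weightedFactor (m := m) hα le_rfl (by linarith) hμ
    (subset_closure hs) hx).mono_left hle
  have w1 := (tendsto_weightedFactor (m := m) hα zero_le_one (by linarith) hμ
    (subset_closure hs) hx).mono_left hle
  rw [layerDensity_eq hm hα (h.surface_subset hs) hx hne]
  have key := ((((hsub.inner hn).mul (hpow (-(m : ℝ)))).mul w0).add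
    (((hx0.mul hn0).mul (hpow (2 - (m : ℝ)))).mul w1)).const_mul (-kernelConst m α)
  refine key.congr' ?_
  have hev : ∀ᶠ q : Space m × Space m in 𝓝[Γ] s ×ˢ 𝓝 x, q.1 ∈ Γ :=
    tendsto_fst.eventually self_mem_nhdsWithin
  filter_upwards [hev, hle' (isOpen_ne_fun continuous_fst continuous_snd |>.mem_nhds hne),
    tendsto_snd.eventually ((isOpen_halfSpace m).mem_nhds hx)] with q h1 h2 h3
  rw [layerDensity_eq hm hα (h.surface_subset h1) h3 h2]

theorem IsLyapunovDomain.aestronglyMeasurable_layerDensity (h : IsLyapunovDomain Ω Γ₁ Γ n)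
    (hm : 2 < m) (hα : 0 < α) (hα₁ : 2 * α < 1) (hμ : ContinuousOn μ (closure Γ)) {x : Space m}
    (hx : x ∈ halfSpace m) :
    AEStronglyMeasurable (layerDensity α n μ x) ((surfaceMeasure m).restrict Γ) := by
  have h1 : ContinuousOn (layerDensity α n μ x) (Γ \ {x}) := by
    rintro s ⟨hs, hsx⟩
    have h2 := (h.tendsto_layerDensity hm hα hα₁ hμ hs hx hsx).comp
      (tendsto_id.prodMk (tendsto_const_nhds (x := x)))
    exact h2.mono_left (nhdsWithin_mono _ sdiff_subset)
  have h2 := h1.aestronglyMeasurable (μ := surfaceMeasure m)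
    (h.measurableSet_surface.diff (measurableSet_singleton x))
  rwa [Measure.restrict_congr_set
    (sdiff_null_ae_eq_self (surfaceMeasure_singleton hm x))] at h2

set_option maxHeartbeats 400000 in
/-- Away from the pole, the potential is given by a continuous integral. -/
theorem IsLyapunovDomain.tendsto_integral_far (h : IsLyapunovDomain Ω Γ₁ Γ n)
    (hm : 2 < m) (hα : 0 < α) (hα₁ : 2 * α < 1) (hμ : ContinuousOn μ (closure Γ)) {t : Space m}
    (ht : t ∈ halfSpace m) {S : Set (Space m)} (hS : MeasurableSet S) (hSΓ : S ⊆ Γ) {δ : ℝ}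
    (hδ : 0 < δ) (hSδ : ∀ s ∈ S, δ ≤ dist s t) :
    (∀ᶠ x in 𝓝 t, IntegrableOn (layerDensity α n μ x) S (surfaceMeasure m)) ∧
      Tendsto (fun x => ∫ s in S, layerDensity α n μ x s ∂surfaceMeasure m) (𝓝 t)
        (𝓝 (∫ s in S, layerDensity α n μ t s ∂surfaceMeasure m)) := by
  have hm' : (3 : ℝ) ≤ m := by exact_mod_cast hm
  obtain ⟨M₀, hM₀, hb₀⟩ := exists_bound_weightedFactor (m := m) hα le_rfl (by linarith)
    h.isCompact_closure hμ ht
  obtain ⟨M₁, hM₁, hb₁⟩ := exists_bound_weightedFactor (m := m) hα zero_le_one (by linarith)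
    h.isCompact_closure hμ ht
  have hfin : surfaceMeasure m S < ∞ := (measure_mono hSΓ).trans_lt h.surfaceMeasure_lt_top
  -- Poles within `δ / 2` of `t` stay at distance at least `δ / 2` from `S`. Cauchy–Schwarz reduces
  -- the first term to the power `1 - m`.
  set B := |kernelConst m α| * ((δ / 2) ^ (1 - (m : ℝ)) * M₀ +
    2 * (t 0 + 1) * (δ / 2) ^ (2 - (m : ℝ)) * M₁) with hB
  have hx0 : ∀ᶠ x : Space m in 𝓝 t, x 0 < t 0 + 1 :=
    (Continuous.tendsto (by fun_prop : Continuous fun y : Space m => y 0) t).eventually_lt_const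
      (by linarith)
  have hbound : ∀ᶠ x in 𝓝 t, x ∈ halfSpace m ∧ ∀ s ∈ S, |layerDensity α n μ x s| ≤ B := by
    filter_upwards [hb₀, hb₁, (isOpen_halfSpace m).mem_nhds ht, hx0,
      Metric.ball_mem_nhds t (half_pos hδ)] with x h0 h1 h2 h3 h4
    refine ⟨h2, fun s hs => ?_⟩
    have h20 : 0 < x 0 := h2
    have hdist : δ / 2 ≤ ‖s - x‖ := by
      rw [← dist_eq_norm]
      have := hSδ s hs
      have := dist_triangle s x t
      rw [Metric.mem_ball] at h4
      linarith
    have hpos : 0 < ‖s - x‖ := by linarith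
    have hne : s ≠ x := fun e => by simp [e] at hpos
    have hns := h.norm_normal (hSΓ hs)
    have hn0 : |n s 0| ≤ 1 := by
      rw [← hns]; exact PiLp.norm_apply_le (n s) 0
    have hp1 : ‖s - x‖ ^ (1 - (m : ℝ)) ≤ (δ / 2) ^ (1 - (m : ℝ)) :=
      Real.rpow_le_rpow_of_nonpos (by positivity) hdist (by linarith)
    have hp2 : ‖s - x‖ ^ (2 - (m : ℝ)) ≤ (δ / 2) ^ (2 - (m : ℝ)) :=
      Real.rpow_le_rpow_of_nonpos (by positivity) hdist (by linarith)
    have hin : |inner ℝ (s - x) (n s)| ≤ ‖s - x‖ := by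
      have := abs_real_inner_le_norm (s - x) (n s)
      rwa [hns, mul_one] at this
    rw [layerDensity_eq hm hα (h.surface_subset (hSΓ hs)) h2 hne, abs_mul, abs_neg, hB]
    refine mul_le_mul_of_nonneg_left ?_ (abs_nonneg _)
    refine (abs_add_le _ _).trans (add_le_add ?_ ?_)
    · rw [abs_mul, abs_mul, abs_of_nonneg (Real.rpow_nonneg hpos.le _)]
      refine mul_le_mul ?_ (h0 s (subset_closure (hSΓ hs))) (abs_nonneg _) (by positivity)
      calc |inner ℝ (s - x) (n s)| * ‖s - x‖ ^ (-(m : ℝ))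
          ≤ ‖s - x‖ * ‖s - x‖ ^ (-(m : ℝ)) := by gcongr
        _ = ‖s - x‖ ^ (1 - (m : ℝ)) := by
            rw [sub_eq_add_neg (1 : ℝ), Real.rpow_add hpos, Real.rpow_one]
        _ ≤ _ := hp1
    · rw [abs_mul, abs_mul, abs_mul, abs_of_nonneg (Real.rpow_nonneg hpos.le _),
        abs_of_pos (by positivity : 0 < 2 * x 0)]
      refine mul_le_mul ?_ (h1 s (subset_closure (hSΓ hs))) (abs_nonneg _) ?_
      · have ht0 : 0 < t 0 := ht
        calc 2 * x 0 * |n s 0| * ‖s - x‖ ^ (2 - (m : ℝ))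
            ≤ 2 * (t 0 + 1) * 1 * (δ / 2) ^ (2 - (m : ℝ)) := by gcongr
          _ = _ := by ring
      · have ht0 : 0 < t 0 := ht
        positivity
  have hmeas : ∀ x ∈ halfSpace m,
      AEStronglyMeasurable (layerDensity α n μ x) ((surfaceMeasure m).restrict S) := fun x hx =>
    (h.aestronglyMeasurable_layerDensity hm hα hα₁ hμ hx).mono_measure
      (Measure.restrict_mono_set _ hSΓ)
  have hbound' : ∀ᶠ x in 𝓝 t, ∀ᵐ s ∂(surfaceMeasure m).restrict S,
      ‖layerDensity α n μ x s‖ ≤ B := by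
    filter_upwards [hbound] with x hx using ae_restrict_of_forall_mem hS hx.2
  constructor
  · filter_upwards [hbound, hbound'] with x h1 h2
    exact IntegrableOn.of_bound hfin (hmeas x h1.1) B h2
  · refine tendsto_integral_filter_of_dominated_convergence (fun _ => B) ?_ hbound' ?_ ?_
    · filter_upwards [hbound] with x hx using hmeas x hx.1
    · exact integrableOn_const hfin.ne
    · refine ae_restrict_of_forall_mem hS fun s hs => ?_
      have hne : s ≠ t := fun e => by
        have := hSδ s hs
        rw [e, dist_self] at this
        linarith
      have hpair : Tendsto (fun x : Space m => (s, x)) (𝓝 t) (𝓝[Γ] s ×ˢ 𝓝 t) :=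
        Tendsto.prodMk (tendsto_const_pure.mono_right (pure_le_nhdsWithin (hSΓ hs))) tendsto_id
      have hlim := h.tendsto_layerDensity hm hα hα₁ hμ (hSΓ hs) ht hne
      exact hlim.comp hpair

/-- `Γ` is relatively closed in the half-space, so `x` has positive distance from it and the far
estimate applies to the whole surface. -/
theorem IsLyapunovDomain.integrableOn_layerDensity (h : IsLyapunovDomain Ω Γ₁ Γ n)
    (hm : 2 < m) (hα : 0 < α) (hα₁ : 2 * α < 1) (hμ : ContinuousOn μ (closure Γ)) {x : Space m}
    (hx : x ∈ halfSpace m \ Γ) :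
    IntegrableOn (layerDensity α n μ x) Γ (surfaceMeasure m) := by
  have hxc : x ∈ (closure Γ)ᶜ := fun h1 => hx.2 (h.closure_inter_halfSpace ⟨h1, hx.1⟩)
  obtain ⟨δ, hδ, hball⟩ := Metric.mem_nhds_iff.1 (isClosed_closure.isOpen_compl.mem_nhds hxc)
  refine (h.tendsto_integral_far hm hα hα₁ hμ hx.1 h.measurableSet_surface Subset.rfl hδ
    fun s hs => ?_).1.self_of_nhds
  by_contra! h1
  exact hball h1 (subset_closure hs)

end Layer

/-! ### The size of the jump -/

/-- At the pole `A = 0` and `B = 4 r²`, so `r ^ (2α) B ^ (-α) = 4 ^ (-α)` does not depend on `r`.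
The Gamma factors and the power of `π` cancel against the mass of the Poisson kernel, which leaves
`2 · 4 ^ (-α) / 4 ^ (1 - α) = 1/2`. -/
theorem kernelConst_mul_kernelFactor {m : ℕ} (hm : 2 < m) {α r : ℝ} (hα : 0 < α) (hr : 0 < r) :
    kernelConst m α * (r ^ (2 * α) * kernelFactor m α 0 0 (4 * r * r)) *
      (Real.pi ^ ((m : ℝ) / 2) / Real.Gamma ((m : ℝ) / 2)) = 1 / 2 := by
  have hm' : (2 : ℝ) < m := by exact_mod_cast hm
  have hB : 0 < 4 * r * r := by positivity
  rw [kernelFactor, add_zero, sub_zero, eulerFactor_zero_left hα (by linarith) hB, abs_zero,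
    zero_add, abs_of_pos hB, show α + ((m : ℝ) / 2 - α) = m / 2 by ring,
    ← mul_assoc ((4 * r * r) ^ (-((m : ℝ) / 2))), ← Real.rpow_add hB, show -((m : ℝ) / 2) + (m / 2 - α) = -α by ring]
  have e : r ^ (2 * α) * (4 * r * r) ^ (-α) = 4 ^ (-α) := by
    rw [mul_assoc, Real.mul_rpow (by norm_num) (by positivity), ← sq, ← Real.rpow_natCast,
      ← Real.rpow_mul hr.le, mul_left_comm, ← Real.rpow_add hr,
      show 2 * α + ((2 : ℕ) : ℝ) * -α = 0 by push_cast; ring, Real.rpow_zero, mul_one]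
  rw [← mul_assoc (r ^ (2 * α)), e, kernelConst, Real.rpow_sub (by norm_num), Real.rpow_one,
    Real.rpow_neg (by norm_num)]
  have h1 := (Real.Gamma_pos_of_pos hα).ne'
  have h2 := (Real.Gamma_pos_of_pos (show 0 < α + (m : ℝ) / 2 by linarith)).ne'
  have h3 := (Real.Gamma_pos_of_pos (show 0 < (m : ℝ) / 2 by linarith)).ne'
  have h4 : Real.pi ^ ((m : ℝ) / 2) ≠ 0 := by positivity
  have h5 : (4 : ℝ) ^ α ≠ 0 := by positivity
  field_simp
  norm_num

/-! ### Coordinates of a chart -/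

namespace GraphChart

variable {m : ℕ} {Ω Γ : Set (Space m)} {n : Space m → Space m} {t : Space m}
  (ch : GraphChart Ω Γ n t)

/-- The point of the graph over `y`. -/
noncomputable def point (y : EuclideanSpace ℝ (Fin (m - 1))) : Space m :=
  t + ch.ι y + ch.φ y • n t

/-- The base point of `x`. -/
noncomputable def base (x : Space m) : EuclideanSpace ℝ (Fin (m - 1)) := ch.P (x - t)

/-- The height of `x` above the graph. -/
noncomputable def height (x : Space m) : ℝ := inner ℝ (n t) (x - t) - ch.φ (ch.base x)

/-- The normal to the graph over `y` with vertical component `1`. -/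
noncomputable def normalAt (y : EuclideanSpace ℝ (Fin (m - 1))) : Space m := n t - ch.ι (ch.u y)

theorem inner_normal_self (ch : GraphChart Ω Γ n t) : inner ℝ (n t) (n t) = (1 : ℝ) := by
  rw [real_inner_self_eq_norm_sq, ch.norm_normal, one_pow]

theorem base_point (y : EuclideanSpace ℝ (Fin (m - 1))) : ch.base (ch.point y) = y := by
  have h1 := ch.decomp (ch.ι y + ch.φ y • n t)
  rw [inner_add_right, real_inner_smul_right, ch.inner_ι, ch.inner_normal_self, mul_one,
    zero_add] at h1
  rw [base, point, add_assoc, add_sub_cancel_left]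
  exact ch.ι.injective (add_right_cancel h1)

theorem base_self : ch.base t = 0 := by rw [base, sub_self, map_zero]

theorem height_self : ch.height t = 0 := by
  rw [height, base_self, ch.φ_zero, sub_self, inner_zero_right, sub_zero]

theorem point_zero : ch.point 0 = t := by simp [point, ch.φ_zero]

/-- `x` lies over `base x`, at `height x` above the graph along `n t`; subtraction separates
horizontal and vertical parts. -/
theorem point_sub (x : Space m) (y : EuclideanSpace ℝ (Fin (m - 1))) :
    ch.point y - x = ch.ι (y - ch.base x) +
      (ch.φ y - ch.φ (ch.base x) - ch.height x) • n t := by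
  have h1 := ch.decomp (x - t)
  have h2 : x = t + (ch.ι (ch.base x) + inner ℝ (n t) (x - t) • n t) := by
    rw [base, h1, add_sub_cancel]
  conv_lhs => rw [h2]
  rw [point, height, map_sub]
  module

theorem norm_point_sub_sq (x : Space m) (y : EuclideanSpace ℝ (Fin (m - 1))) :
    ‖ch.point y - x‖ ^ 2 = ‖y - ch.base x‖ ^ 2 +
      (ch.φ y - ch.φ (ch.base x) - ch.height x) ^ 2 := by
  rw [point_sub, @norm_add_sq_real, real_inner_smul_right, real_inner_comm, ch.inner_ι,
    ch.ι.norm_map, norm_smul, ch.norm_normal, Real.norm_eq_abs, mul_one, sq_abs]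
  ring

theorem norm_sub_base_le (x : Space m) (y : EuclideanSpace ℝ (Fin (m - 1))) :
    ‖y - ch.base x‖ ≤ ‖ch.point y - x‖ := by
  refine abs_le_of_sq_le_sq' ?_ (norm_nonneg _) |>.2
  rw [norm_point_sub_sq]
  nlinarith [sq_nonneg (ch.φ y - ch.φ (ch.base x) - ch.height x)]

/-- The decisive splitting: the height produces the Poisson-type term and hence the jump, and the
rest is a first order Taylor remainder. -/
theorem inner_point_sub (x : Space m) (y : EuclideanSpace ℝ (Fin (m - 1))) :
    inner ℝ (ch.point y - x) (ch.normalAt y) =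
      -ch.height x + (ch.φ y - ch.φ (ch.base x) - inner ℝ (y - ch.base x) (ch.u y)) := by
  rw [point_sub, normalAt, inner_add_left, inner_sub_right, inner_sub_right, real_inner_smul_left,
    real_inner_smul_left, ch.inner_normal_self, ch.inner_ι, ch.ι.inner_map_map,
    real_inner_comm (n t), ch.inner_ι]
  ring

theorem point_ne {x : Space m} (hx : ch.height x ≠ 0) (y : EuclideanSpace ℝ (Fin (m - 1))) :
    ch.point y ≠ x := by
  intro h
  apply hx
  have h1 := ch.norm_point_sub_sq x y
  have h2 : ch.base x = y := by rw [← h, base_point]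
  rw [h, h2] at h1
  simpa using h1.symm

theorem injective_point : Function.Injective ch.point := fun y z h => by
  rw [← ch.base_point y, h, ch.base_point]

theorem continuousAt_φ {y : EuclideanSpace ℝ (Fin (m - 1))} (hy : y ∈ Metric.ball 0 ch.ρ) :
    ContinuousAt ch.φ y := (ch.hasStrictFDerivAt y hy).continuousAt

theorem tendsto_point {y : EuclideanSpace ℝ (Fin (m - 1))} (hy : y ∈ Metric.ball 0 ch.ρ) :
    Tendsto ch.point (𝓝 y) (𝓝[Γ] (ch.point y)) := by
  refine tendsto_nhdsWithin_iff.2 ⟨?_, ?_⟩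
  · exact (tendsto_const_nhds.add ch.ι.continuous.continuousAt.tendsto).add
      ((ch.continuousAt_φ hy).tendsto.smul_const _)
  · filter_upwards [Metric.isOpen_ball.mem_nhds hy] with z hz using ch.mem_surface z hz

theorem continuous_base : Continuous ch.base := by unfold base; fun_prop

theorem tendsto_base : Tendsto ch.base (𝓝 t) (𝓝 0) := by
  have := ch.continuous_base.tendsto t
  rwa [ch.base_self] at this

theorem tendsto_height : Tendsto ch.height (𝓝 t) (𝓝 0) := by
  have h1 : Tendsto (fun x => ch.φ (ch.base x)) (𝓝 t) (𝓝 0) := by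
    have := (ch.continuousAt_φ (Metric.mem_ball_self ch.ρ_pos)).tendsto
    rw [ch.φ_zero] at this
    exact this.comp ch.tendsto_base
  have h2 : Tendsto (fun x => inner ℝ (n t) (x - t)) (𝓝 t) (𝓝 0) := by
    have : Continuous fun x : Space m => inner ℝ (n t) (x - t) := by fun_prop
    simpa using this.tendsto t
  have := h2.sub h1
  rwa [sub_zero] at this

theorem norm_normalAt_le {y : EuclideanSpace ℝ (Fin (m - 1))} (hy : y ∈ Metric.ball 0 ch.ρ) :
    ‖ch.normalAt y‖ ≤ 2 := by
  refine (norm_sub_le _ _).trans ?_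
  rw [ch.norm_normal, ch.ι.norm_map]
  linarith [ch.norm_u_le y hy]

theorem lipschitz_φ {y z : EuclideanSpace ℝ (Fin (m - 1))} (hy : y ∈ Metric.ball 0 ch.ρ)
    (hz : z ∈ Metric.ball 0 ch.ρ) : |ch.φ z - ch.φ y| ≤ 1 / 2 * ‖z - y‖ := by
  have := (convex_ball (0 : EuclideanSpace ℝ (Fin (m - 1)))
    ch.ρ).norm_image_sub_le_of_norm_hasFDerivWithin_le (f := ch.φ)
    (f' := fun y => innerSL ℝ (ch.u y)) (C := 1 / 2)
    (fun w hw => (ch.hasStrictFDerivAt w hw).hasFDerivAt.hasFDerivWithinAt)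
    (fun w hw => by rw [innerSL_apply_norm]; exact ch.norm_u_le w hw) hy hz
  simpa using this

theorem tendsto_norm_point_sub_rpow {x : Space m}
    {y : EuclideanSpace ℝ (Fin (m - 1))} (hy : y ∈ Metric.ball 0 ch.ρ) (hne : ch.point y ≠ x)
    (e : ℝ) :
    Tendsto (fun q : Space m × EuclideanSpace ℝ (Fin (m - 1)) => ‖ch.point q.2 - q.1‖ ^ e)
      (𝓝 x ×ˢ 𝓝 y) (𝓝 (‖ch.point y - x‖ ^ e)) := by
  have h1 : Tendsto (fun q : Space m × EuclideanSpace ℝ (Fin (m - 1)) => ch.point q.2)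
      (𝓝 x ×ˢ 𝓝 y) (𝓝 (ch.point y)) :=
    ((ch.tendsto_point hy).mono_right nhdsWithin_le_nhds).comp tendsto_snd
  exact (h1.sub tendsto_fst).norm.rpow_const (Or.inl (norm_ne_zero_iff.2 (sub_ne_zero.2 hne)))

theorem tendsto_u {x : Space m} {y : EuclideanSpace ℝ (Fin (m - 1))}
    (hy : y ∈ Metric.ball 0 ch.ρ) :
    Tendsto (fun q : Space m × EuclideanSpace ℝ (Fin (m - 1)) => ch.u q.2) (𝓝 x ×ˢ 𝓝 y)
      (𝓝 (ch.u y)) :=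
  (ch.continuousOn_u.continuousAt (Metric.isOpen_ball.mem_nhds hy)).tendsto.comp tendsto_snd

theorem point_ne_of_ne_base {x : Space m} {y : EuclideanSpace ℝ (Fin (m - 1))}
    (h : y ≠ ch.base x) : ch.point y ≠ x := fun h1 => h (by rw [← h1, base_point])

theorem image_point_subset : ch.point '' Metric.ball 0 ch.ρ ⊆ Γ := by
  rintro _ ⟨y, hy, rfl⟩
  exact ch.mem_surface y hy

theorem measurableSet_image_point : MeasurableSet (ch.point '' Metric.ball 0 ch.ρ) :=
  measurableSet_ball.image_of_continuousOn_injOn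
    (fun _ hy => ((ch.tendsto_point hy).mono_right nhdsWithin_le_nhds).mono_left nhdsWithin_le_nhds)
    ch.injective_point.injOn

end GraphChart

theorem aestronglyMeasurable_of_continuousAt_off_point {E : Type*} [NormedAddCommGroup E]
    [InnerProductSpace ℝ E] [FiniteDimensional ℝ E] [MeasurableSpace E] [BorelSpace E]
    [Nontrivial E] {F : E → ℝ} {c : E} {S : Set E} (hS : MeasurableSet S)
    (hF : ∀ y ∈ S, y ≠ c → ContinuousAt F y) : AEStronglyMeasurable F (volume.restrict S) := by
  have h1 : ContinuousOn F (S \ {c}) := fun y hy => (hF y hy.1 hy.2).continuousWithinAt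
  have h2 := h1.aestronglyMeasurable (μ := volume) (hS.diff (measurableSet_singleton c))
  rwa [Measure.restrict_congr_set (sdiff_null_ae_eq_self (measure_singleton c))] at h2

/-! ### The kernel in a chart -/

namespace GraphChart

variable {m : ℕ} [NeZero m] {Ω Γ₁ Γ : Set (Space m)} {n : Space m → Space m} {t : Space m}
  {μ : Space m → ℝ} {α : ℝ} (ch : GraphChart Ω Γ n t)

/-- The coefficient of the Poisson-type part of the kernel in the chart. -/
noncomputable def leading (α : ℝ) (μ : Space m → ℝ) (x : Space m)
    (y : EuclideanSpace ℝ (Fin (m - 1))) : ℝ :=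
  -kernelConst m α * weightedFactor α μ 0 (ch.point y) x

/-- The weakly singular part of the kernel that comes from the curvature of the graph. -/
noncomputable def curvaturePart (α : ℝ) (μ : Space m → ℝ) (x : Space m)
    (y : EuclideanSpace ℝ (Fin (m - 1))) : ℝ :=
  (ch.φ y - ch.φ (ch.base x) - inner ℝ (y - ch.base x) (ch.u y)) *
    ‖ch.point y - x‖ ^ (-(m : ℝ)) * ch.leading α μ x y

/-- The weakly singular part of the kernel that comes from the lower order term of the equation. -/
noncomputable def lowerOrderPart (α : ℝ) (μ : Space m → ℝ) (x : Space m)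
    (y : EuclideanSpace ℝ (Fin (m - 1))) : ℝ :=
  2 * x 0 * ch.normalAt y 0 * ‖ch.point y - x‖ ^ (2 - (m : ℝ)) *
    (-kernelConst m α * weightedFactor α μ 1 (ch.point y) x)

/-- The area density turns the unit normal into `normalAt`, and `inner_point_sub` splits the
Laplacian part of the kernel in two. -/
theorem sqrt_mul_layerDensity (h : IsLyapunovDomain Ω Γ₁ Γ n) (hm : 2 < m) (hα : 0 < α)
    {x : Space m} (hx : x ∈ halfSpace m) {y : EuclideanSpace ℝ (Fin (m - 1))}
    (hy : y ∈ Metric.ball 0 ch.ρ) (hne : ch.point y ≠ x) :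
    √(1 + ‖ch.u y‖ ^ 2) * layerDensity α n μ x (ch.point y) =
      -ch.height x * ((‖y - ch.base x‖ ^ 2 + (ch.φ y - ch.φ (ch.base x) - ch.height x) ^ 2) ^
        (-((m : ℝ) / 2)) * ch.leading α μ x y) + ch.curvaturePart α μ x y +
          ch.lowerOrderPart α μ x y := by
  have hn : √(1 + ‖ch.u y‖ ^ 2) • n (ch.point y) = ch.normalAt y := ch.normal_eq y hy
  have h1 : √(1 + ‖ch.u y‖ ^ 2) * inner ℝ (ch.point y - x) (n (ch.point y)) =
      -ch.height x + (ch.φ y - ch.φ (ch.base x) - inner ℝ (y - ch.base x) (ch.u y)) := by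
    rw [← inner_point_sub, ← hn, real_inner_smul_right]
  have h2 : √(1 + ‖ch.u y‖ ^ 2) * n (ch.point y) 0 = ch.normalAt y 0 := by
    rw [← hn]; rfl
  have h3 : (‖y - ch.base x‖ ^ 2 + (ch.φ y - ch.φ (ch.base x) - ch.height x) ^ 2) ^
      (-((m : ℝ) / 2)) = ‖ch.point y - x‖ ^ (-(m : ℝ)) := by
    rw [← norm_point_sub_sq, ← Real.rpow_natCast, ← Real.rpow_mul (norm_nonneg _)]
    congr 1; push_cast; ring
  have hs : ch.point y ∈ Γ := ch.mem_surface y hy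
  rw [layerDensity_eq hm hα (h.surface_subset hs) hx hne, h3, curvaturePart,
    lowerOrderPart, leading, ← h2]
  linear_combination (-kernelConst m α * ‖ch.point y - x‖ ^ (-(m : ℝ)) *
    weightedFactor α μ 0 (ch.point y) x) * h1

theorem tendsto_weightedFactor_point {j : ℝ} (hα : 0 < α) (hj : 0 ≤ j)
    (hjm : j + α ≤ (m : ℝ) / 2) (hμ : ContinuousOn μ (closure Γ)) {x : Space m}
    (hx : x ∈ halfSpace m) {y : EuclideanSpace ℝ (Fin (m - 1))} (hy : y ∈ Metric.ball 0 ch.ρ) :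
    Tendsto (fun q : Space m × EuclideanSpace ℝ (Fin (m - 1)) =>
        weightedFactor α μ j (ch.point q.2) q.1) (𝓝 x ×ˢ 𝓝 y)
      (𝓝 (weightedFactor α μ j (ch.point y) x)) := by
  have h1 : Tendsto (fun q : Space m × EuclideanSpace ℝ (Fin (m - 1)) => (ch.point q.2, q.1))
      (𝓝 x ×ˢ 𝓝 y) (𝓝[closure Γ] (ch.point y) ×ˢ 𝓝 x) :=
    (((ch.tendsto_point hy).mono_right (nhdsWithin_mono _ subset_closure)).comp
      tendsto_snd).prodMk tendsto_fst
  have hs : ch.point y ∈ closure Γ := subset_closure (ch.mem_surface y hy)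
  have hlim := tendsto_weightedFactor (m := m) hα hj hjm hμ hs hx
  simpa only [Function.comp_def] using hlim.comp h1

theorem tendsto_leading (hm : 2 < m) (hα : 0 < α) (hα₁ : 2 * α < 1)
    (hμ : ContinuousOn μ (closure Γ)) {x : Space m} (hx : x ∈ halfSpace m)
    {y : EuclideanSpace ℝ (Fin (m - 1))} (hy : y ∈ Metric.ball 0 ch.ρ) :
    Tendsto (fun q : Space m × EuclideanSpace ℝ (Fin (m - 1)) => ch.leading α μ q.1 q.2)
      (𝓝 x ×ˢ 𝓝 y) (𝓝 (ch.leading α μ x y)) := by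
  have hm' : (3 : ℝ) ≤ m := by exact_mod_cast hm
  exact (ch.tendsto_weightedFactor_point hα le_rfl (by linarith) hμ hx hy).const_mul _

theorem tendsto_curvaturePart (hm : 2 < m) (hα : 0 < α) (hα₁ : 2 * α < 1)
    (hμ : ContinuousOn μ (closure Γ)) {x : Space m} (hx : x ∈ halfSpace m)
    (hxb : ch.base x ∈ Metric.ball 0 ch.ρ) {y : EuclideanSpace ℝ (Fin (m - 1))}
    (hy : y ∈ Metric.ball 0 ch.ρ) (hne : ch.point y ≠ x) :
    Tendsto (fun q : Space m × EuclideanSpace ℝ (Fin (m - 1)) => ch.curvaturePart α μ q.1 q.2)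
      (𝓝 x ×ˢ 𝓝 y) (𝓝 (ch.curvaturePart α μ x y)) := by
  have hb : Tendsto (fun q : Space m × EuclideanSpace ℝ (Fin (m - 1)) => ch.base q.1)
      (𝓝 x ×ˢ 𝓝 y) (𝓝 (ch.base x)) := (ch.continuous_base.tendsto x).comp tendsto_fst
  have hφy : Tendsto (fun q : Space m × EuclideanSpace ℝ (Fin (m - 1)) => ch.φ q.2)
      (𝓝 x ×ˢ 𝓝 y) (𝓝 (ch.φ y)) := (ch.continuousAt_φ hy).tendsto.comp tendsto_snd
  have hφx : Tendsto (fun q : Space m × EuclideanSpace ℝ (Fin (m - 1)) => ch.φ (ch.base q.1))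
      (𝓝 x ×ˢ 𝓝 y) (𝓝 (ch.φ (ch.base x))) := (ch.continuousAt_φ hxb).tendsto.comp hb
  have hin : Tendsto (fun q : Space m × EuclideanSpace ℝ (Fin (m - 1)) =>
      inner ℝ (q.2 - ch.base q.1) (ch.u q.2)) (𝓝 x ×ˢ 𝓝 y)
      (𝓝 (inner ℝ (y - ch.base x) (ch.u y))) :=
    Tendsto.inner (𝕜 := ℝ) (tendsto_snd.sub hb) (ch.tendsto_u hy)
  exact (((hφy.sub hφx).sub hin).mul (ch.tendsto_norm_point_sub_rpow hy hne _)).mul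
    (ch.tendsto_leading hm hα hα₁ hμ hx hy)

theorem tendsto_lowerOrderPart (hm : 2 < m) (hα : 0 < α) (hα₁ : 2 * α < 1)
    (hμ : ContinuousOn μ (closure Γ)) {x : Space m} (hx : x ∈ halfSpace m)
    {y : EuclideanSpace ℝ (Fin (m - 1))} (hy : y ∈ Metric.ball 0 ch.ρ) (hne : ch.point y ≠ x) :
    Tendsto (fun q : Space m × EuclideanSpace ℝ (Fin (m - 1)) => ch.lowerOrderPart α μ q.1 q.2)
      (𝓝 x ×ˢ 𝓝 y) (𝓝 (ch.lowerOrderPart α μ x y)) := by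
  have hm' : (3 : ℝ) ≤ m := by exact_mod_cast hm
  have hN : Tendsto (fun q : Space m × EuclideanSpace ℝ (Fin (m - 1)) => ch.normalAt q.2)
      (𝓝 x ×ˢ 𝓝 y) (𝓝 (ch.normalAt y)) :=
    tendsto_const_nhds.sub (ch.ι.continuous.continuousAt.tendsto.comp (ch.tendsto_u hy))
  have hN0 : Tendsto (fun q : Space m × EuclideanSpace ℝ (Fin (m - 1)) => ch.normalAt q.2 0)
      (𝓝 x ×ˢ 𝓝 y) (𝓝 (ch.normalAt y 0)) :=
    (Continuous.tendsto (by fun_prop : Continuous fun z : Space m => z 0) _).comp hN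
  have hx0 : Tendsto (fun q : Space m × EuclideanSpace ℝ (Fin (m - 1)) => 2 * q.1 0)
      (𝓝 x ×ˢ 𝓝 y) (𝓝 (2 * x 0)) :=
    (Continuous.tendsto (by fun_prop : Continuous fun z : Space m => 2 * z 0) _).comp tendsto_fst
  exact ((hx0.mul hN0).mul (ch.tendsto_norm_point_sub_rpow hy hne _)).mul
    ((ch.tendsto_weightedFactor_point hα zero_le_one (by linarith) hμ hx hy).const_mul _)

/-- The remainder of order `1 + l` against the power `-m` leaves a singularity weaker than the
dimension `m - 1`, thanks to `l > 0`. -/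
theorem abs_curvaturePart_le {x : Space m} {M : ℝ}
    (hxM : ∀ s ∈ closure Γ, |weightedFactor α μ 0 s x| ≤ M) (hxb : ch.base x ∈ Metric.ball 0 ch.ρ)
    {y : EuclideanSpace ℝ (Fin (m - 1))} (hy : y ∈ Metric.ball 0 ch.ρ) (hne : y ≠ ch.base x) :
    |ch.curvaturePart α μ x y| ≤
      ch.C * (|kernelConst m α| * M) * ‖y - ch.base x‖ ^ (-((m : ℝ) - 1 - ch.l)) := by
  have hpos : 0 < ‖y - ch.base x‖ := norm_pos_iff.2 (sub_ne_zero.2 hne)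
  have h1 := ch.taylor y hy _ hxb
  -- The gradient is taken at `y`, so this is the Taylor remainder at `base x` of the expansion
  -- about `y`, with the opposite sign.
  have e : ch.φ y - ch.φ (ch.base x) - inner ℝ (y - ch.base x) (ch.u y) =
      -(ch.φ (ch.base x) - ch.φ y - inner ℝ (ch.u y) (ch.base x - y)) := by
    rw [real_inner_comm, ← neg_sub y, inner_neg_right]; ring
  have h2 : ‖ch.point y - x‖ ^ (-(m : ℝ)) ≤ ‖y - ch.base x‖ ^ (-(m : ℝ)) :=
    Real.rpow_le_rpow_of_nonpos hpos (ch.norm_sub_base_le x y) (by simp)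
  have h3 : |ch.leading α μ x y| ≤ |kernelConst m α| * M := by
    rw [leading, abs_mul, abs_neg]
    exact mul_le_mul_of_nonneg_left (hxM _ (subset_closure (ch.mem_surface y hy))) (abs_nonneg _)
  rw [curvaturePart, e, abs_mul, abs_mul, abs_neg, abs_of_nonneg (Real.rpow_nonneg (norm_nonneg _) _)]
  rw [norm_sub_rev] at h1
  have hC := ch.C_nonneg
  calc _ ≤ ch.C * ‖y - ch.base x‖ ^ (1 + ch.l) * ‖y - ch.base x‖ ^ (-(m : ℝ)) *
        (|kernelConst m α| * M) := by gcongr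
    _ = ch.C * (|kernelConst m α| * M) *
        (‖y - ch.base x‖ ^ (1 + ch.l) * ‖y - ch.base x‖ ^ (-(m : ℝ))) := by ring
    _ = _ := by
      rw [← Real.rpow_add hpos]
      congr 2; ring

theorem abs_lowerOrderPart_le (hm : 2 < m) {x : Space m} {M R : ℝ}
    (hx : x ∈ halfSpace m) (hxR : x 0 ≤ R)
    (hxM : ∀ s ∈ closure Γ, |weightedFactor α μ 1 s x| ≤ M)
    {y : EuclideanSpace ℝ (Fin (m - 1))} (hy : y ∈ Metric.ball 0 ch.ρ) (hne : y ≠ ch.base x) :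
    |ch.lowerOrderPart α μ x y| ≤
      2 * R * 2 * (|kernelConst m α| * M) * ‖y - ch.base x‖ ^ (-((m : ℝ) - 2)) := by
  have hm' : (3 : ℝ) ≤ m := by exact_mod_cast hm
  have hx0 : 0 < x 0 := hx
  have hR : 0 ≤ R := hx0.le.trans hxR
  have hpos : 0 < ‖y - ch.base x‖ := norm_pos_iff.2 (sub_ne_zero.2 hne)
  have h2 : ‖ch.point y - x‖ ^ (2 - (m : ℝ)) ≤ ‖y - ch.base x‖ ^ (2 - (m : ℝ)) :=
    Real.rpow_le_rpow_of_nonpos hpos (ch.norm_sub_base_le x y) (by linarith)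
  have h3 : |-kernelConst m α * weightedFactor α μ 1 (ch.point y) x| ≤ |kernelConst m α| * M := by
    rw [abs_mul, abs_neg]
    exact mul_le_mul_of_nonneg_left (hxM _ (subset_closure (ch.mem_surface y hy))) (abs_nonneg _)
  have h4 : |ch.normalAt y 0| ≤ 2 :=
    (PiLp.norm_apply_le (ch.normalAt y) 0).trans (ch.norm_normalAt_le hy)
  rw [lowerOrderPart, abs_mul, abs_mul, abs_mul, abs_of_nonneg (Real.rpow_nonneg (norm_nonneg _) _),
    abs_of_pos (by positivity : 0 < 2 * x 0)]
  calc _ ≤ 2 * R * 2 * ‖y - ch.base x‖ ^ (2 - (m : ℝ)) * (|kernelConst m α| * M) := by gcongr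
    _ = _ := by rw [neg_sub]; ring

end GraphChart

theorem continuousAt_of_tendsto_prod {X E : Type*} [TopologicalSpace X] [TopologicalSpace E]
    {F : X → E → ℝ} {x : X} {y : E}
    (h : Tendsto (fun q : X × E => F q.1 q.2) (𝓝 x ×ˢ 𝓝 y) (𝓝 (F x y))) :
    ContinuousAt (F x) y :=
  h.comp (tendsto_const_nhds.prodMk tendsto_id)

/-! ### The jump of a chart's contribution -/

namespace GraphChart

variable {m : ℕ} [NeZero m] {Ω Γ₁ Γ : Set (Space m)} {n : Space m → Space m} {t : Space m}
  {μ : Space m → ℝ} {α : ℝ} (ch : GraphChart Ω Γ n t)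

theorem integral_image_point (h : IsLyapunovDomain Ω Γ₁ Γ n) (hm : 2 < m) (hα : 0 < α)
    (hα₁ : 2 * α < 1) (hμ : ContinuousOn μ (closure Γ)) {x : Space m} (hx : x ∈ halfSpace m) :
    (IntegrableOn (layerDensity α n μ x) (ch.point '' Metric.ball 0 ch.ρ) (surfaceMeasure m) ↔
      IntegrableOn (fun y => √(1 + ‖ch.u y‖ ^ 2) * layerDensity α n μ x (ch.point y))
        (Metric.ball 0 ch.ρ)) ∧
    ∫ s in ch.point '' Metric.ball 0 ch.ρ, layerDensity α n μ x s ∂surfaceMeasure m =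
      ∫ y in Metric.ball 0 ch.ρ, √(1 + ‖ch.u y‖ ^ 2) * layerDensity α n μ x (ch.point y) := by
  have h1 := (h.aestronglyMeasurable_layerDensity hm hα hα₁ hμ hx).mono_measure
    (Measure.restrict_mono ch.image_point_subset le_rfl)
  have h2 := integral_graph ch.ι ch.norm_normal ch.inner_ι t Metric.isOpen_ball
    ch.hasStrictFDerivAt ch.continuousOn_u (f := layerDensity α n μ x)
  rw [finrank_euclideanSpace_fin] at h2
  exact h2 h1

theorem aestronglyMeasurable_parts (hm : 2 < m) (hα : 0 < α) (hα₁ : 2 * α < 1)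
    (hμ : ContinuousOn μ (closure Γ)) {x : Space m} (hx : x ∈ halfSpace m)
    (hxb : ch.base x ∈ Metric.ball 0 ch.ρ) :
    AEStronglyMeasurable (ch.leading α μ x) (volume.restrict (Metric.ball 0 ch.ρ)) ∧
    AEStronglyMeasurable (ch.curvaturePart α μ x) (volume.restrict (Metric.ball 0 ch.ρ)) ∧
    AEStronglyMeasurable (ch.lowerOrderPart α μ x) (volume.restrict (Metric.ball 0 ch.ρ)) := by
  have hE : Nontrivial (EuclideanSpace ℝ (Fin (m - 1))) :=
    Module.nontrivial_of_finrank_pos (R := ℝ) (by rw [finrank_euclideanSpace_fin]; omega)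
  refine ⟨?_, ?_, ?_⟩ <;>
    refine aestronglyMeasurable_of_continuousAt_off_point (c := ch.base x) measurableSet_ball
      fun y hy hne => continuousAt_of_tendsto_prod ?_
  · exact ch.tendsto_leading hm hα hα₁ hμ hx hy
  · exact ch.tendsto_curvaturePart hm hα hα₁ hμ hx hxb hy (ch.point_ne_of_ne_base hne)
  · exact ch.tendsto_lowerOrderPart hm hα hα₁ hμ hx hy (ch.point_ne_of_ne_base hne)

/-- The integral over the chart of the two weakly singular parts of the kernel is continuous up to
the surface. -/
theorem tendsto_integral_weaklySingularParts (h : IsLyapunovDomain Ω Γ₁ Γ n) (hm : 2 < m)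
    (hα : 0 < α) (hα₁ : 2 * α < 1) (hμ : ContinuousOn μ (closure Γ)) (ht : t ∈ halfSpace m) :
    (∀ᶠ x in 𝓝 t, IntegrableOn (ch.curvaturePart α μ x) (Metric.ball 0 ch.ρ) ∧
      IntegrableOn (ch.lowerOrderPart α μ x) (Metric.ball 0 ch.ρ)) ∧
    Tendsto (fun x => (∫ y in Metric.ball 0 ch.ρ, ch.curvaturePart α μ x y) +
        ∫ y in Metric.ball 0 ch.ρ, ch.lowerOrderPart α μ x y) (𝓝 t)
      (𝓝 ((∫ y in Metric.ball 0 ch.ρ, ch.curvaturePart α μ t y) +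
        ∫ y in Metric.ball 0 ch.ρ, ch.lowerOrderPart α μ t y)) := by
  have hm' : (3 : ℝ) ≤ m := by exact_mod_cast hm
  have hfr : (Module.finrank ℝ (EuclideanSpace ℝ (Fin (m - 1))) : ℝ) = m - 1 := by
    rw [finrank_euclideanSpace_fin, Nat.cast_sub (by omega), Nat.cast_one]
  have hE : Nontrivial (EuclideanSpace ℝ (Fin (m - 1))) :=
    Module.nontrivial_of_finrank_pos (R := ℝ) (by rw [finrank_euclideanSpace_fin]; omega)
  obtain ⟨M₀, hM₀, hb₀⟩ := exists_bound_weightedFactor (m := m) hα le_rfl (by linarith)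
    h.isCompact_closure hμ ht
  obtain ⟨M₁, hM₁, hb₁⟩ := exists_bound_weightedFactor (m := m) hα zero_le_one (by linarith)
    h.isCompact_closure hμ ht
  have hxb : ∀ᶠ x in 𝓝 t, ch.base x ∈ Metric.ball 0 ch.ρ :=
    ch.tendsto_base (Metric.ball_mem_nhds 0 ch.ρ_pos)
  have hxH : ∀ᶠ x in 𝓝 t, x ∈ halfSpace m := (isOpen_halfSpace m).mem_nhds ht
  have ht0 : 0 < t 0 := ht
  have hxR : ∀ᶠ x in 𝓝 t, x 0 ≤ t 0 + 1 :=
    (Continuous.tendsto (by fun_prop : Continuous fun z : Space m => z 0) t).eventually_le_const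
      (lt_add_one _)
  have hs₀ : (m : ℝ) - 1 - ch.l < Module.finrank ℝ (EuclideanSpace ℝ (Fin (m - 1))) := by
    rw [hfr]; linarith [ch.l_pos]
  have hs₁ : (m : ℝ) - 2 < Module.finrank ℝ (EuclideanSpace ℝ (Fin (m - 1))) := by
    rw [hfr]; linarith
  have bd₀ : ∀ᶠ x in 𝓝 t, ∀ y ∈ Metric.ball 0 ch.ρ, y ≠ ch.base x → |ch.curvaturePart α μ x y| ≤
      ch.C * (|kernelConst m α| * M₀) * ‖y - ch.base x‖ ^ (-((m : ℝ) - 1 - ch.l)) := by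
    filter_upwards [hb₀, hxb] with x h₀ hb y hy hne using ch.abs_curvaturePart_le h₀ hb hy hne
  have bd₁ : ∀ᶠ x in 𝓝 t, ∀ y ∈ Metric.ball 0 ch.ρ, y ≠ ch.base x →
      |ch.lowerOrderPart α μ x y| ≤
        2 * (t 0 + 1) * 2 * (|kernelConst m α| * M₁) * ‖y - ch.base x‖ ^ (-((m : ℝ) - 2)) := by
    filter_upwards [hb₁, hxH, hxR] with x h₁ hH hR y hy hne using
      ch.abs_lowerOrderPart_le hm hH hR h₁ hy hne
  have meas : ∀ᶠ x in 𝓝 t,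
      AEStronglyMeasurable (ch.curvaturePart α μ x) (volume.restrict (Metric.ball 0 ch.ρ)) ∧
      AEStronglyMeasurable (ch.lowerOrderPart α μ x) (volume.restrict (Metric.ball 0 ch.ρ)) := by
    filter_upwards [hxb, hxH] with x hb hH using
      (ch.aestronglyMeasurable_parts hm hα hα₁ hμ hH hb).2
  have htb := hxb.self_of_nhds
  refine ⟨?_, Tendsto.add ?_ ?_⟩
  · filter_upwards [bd₀, bd₁, meas, hxb] with x h₀ h₁ hms hb
    exact ⟨integrableOn_of_norm_le_rpow hs₀ hb hms.1 h₀,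
      integrableOn_of_norm_le_rpow hs₁ hb hms.2 h₁⟩
  · refine tendsto_integral_weaklySingular ch.ρ_pos
      (mul_nonneg ch.C_nonneg (by positivity)) hs₀ ch.tendsto_base (meas.mono fun x hx => hx.1) bd₀
      fun y hy hne => ch.tendsto_curvaturePart hm hα hα₁ hμ ht htb hy ?_
    exact ch.point_ne_of_ne_base (by rwa [ch.base_self])
  · refine tendsto_integral_weaklySingular ch.ρ_pos
      (by positivity) hs₁ ch.tendsto_base (meas.mono fun x hx => hx.2) bd₁
      fun y hy hne => ch.tendsto_lowerOrderPart hm hα hα₁ hμ ht hy ?_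
    exact ch.point_ne_of_ne_base (by rwa [ch.base_self])

/-- The limit of the Poisson-type term: the coefficient at the limit pole times the mass of the
kernel. -/
theorem leading_mul_integral (hm : 2 < m) (hα : 0 < α) (ht : t ∈ halfSpace m) :
    ch.leading α μ t 0 *
      ∫ z : EuclideanSpace ℝ (Fin (m - 1)), (1 + ‖z‖ ^ 2) ^ (-((m : ℝ) / 2)) =
        -(1 / 2) * μ t := by
  have h1 := kernelConst_mul_kernelFactor hm hα (r := t 0) ht
  rw [integral_one_add_norm_sq_rpow hm, leading, point_zero, weightedFactor, sub_self, norm_zero,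
    zero_pow two_ne_zero]
  linear_combination (-μ t) * h1

/-- The jump of the part of the double-layer potential that comes from a chart. -/
theorem tendsto_integral_near (h : IsLyapunovDomain Ω Γ₁ Γ n) (hm : 2 < m)
    (hα : 0 < α) (hα₁ : 2 * α < 1) (hμ : ContinuousOn μ (closure Γ)) (ht : t ∈ halfSpace m)
    {l : Filter (Space m)} [l.IsCountablyGenerated] (hl : l ≤ 𝓝 t) {ε : ℝ}
    (hε : ∀ᶠ x in l, ch.height x ≠ 0 ∧ -ch.height x = ε * |ch.height x|) :
    IntegrableOn (layerDensity α n μ t) (ch.point '' Metric.ball 0 ch.ρ) (surfaceMeasure m) ∧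
    Tendsto (fun x => ∫ s in ch.point '' Metric.ball 0 ch.ρ,
        layerDensity α n μ x s ∂surfaceMeasure m) l
      (𝓝 (-(ε / 2) * μ t + ∫ s in ch.point '' Metric.ball 0 ch.ρ,
        layerDensity α n μ t s ∂surfaceMeasure m)) := by
  have hm' : (3 : ℝ) ≤ m := by exact_mod_cast hm
  have hfr : (m : ℝ) = Module.finrank ℝ (EuclideanSpace ℝ (Fin (m - 1))) + 1 := by
    rw [finrank_euclideanSpace_fin, Nat.cast_sub (by omega), Nat.cast_one, sub_add_cancel]
  have hE : Nontrivial (EuclideanSpace ℝ (Fin (m - 1))) :=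
    Module.nontrivial_of_finrank_pos (R := ℝ) (by rw [finrank_euclideanSpace_fin]; omega)
  obtain ⟨hint, hlim⟩ := ch.tendsto_integral_weaklySingularParts h hm hα hα₁ hμ ht
  obtain ⟨M₀, hM₀, hb₀⟩ := exists_bound_weightedFactor (m := m) hα le_rfl (by linarith)
    h.isCompact_closure hμ ht
  have hxH : ∀ᶠ x in 𝓝 t, x ∈ halfSpace m := (isOpen_halfSpace m).mem_nhds ht
  have hxb : ∀ᶠ x in 𝓝 t, ch.base x ∈ Metric.ball 0 ch.ρ :=
    ch.tendsto_base (Metric.ball_mem_nhds 0 ch.ρ_pos)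
  have h0 : (0 : EuclideanSpace ℝ (Fin (m - 1))) ∈ Metric.ball 0 ch.ρ :=
    Metric.mem_ball_self ch.ρ_pos
  have hφ' : HasStrictFDerivAt ch.φ (0 : EuclideanSpace ℝ (Fin (m - 1)) →L[ℝ] ℝ) 0 := by
    have := ch.hasStrictFDerivAt 0 h0
    rwa [ch.u_zero, map_zero] at this
  obtain ⟨pint, plim⟩ := tendsto_integral_poisson (l := l) (p := m) (C := |kernelConst m α| * M₀)
    hfr ch.ρ_pos
    (fun y hy z hz => ch.lipschitz_φ hy hz) hφ' (ch.tendsto_base.mono_left hl)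
    (ch.tendsto_height.mono_left hl) (hε.mono fun x hx => hx.1) (G := ch.leading α μ)
    (G₀ := ch.leading α μ t 0)
    (hl (by filter_upwards [hxb, hxH] with x hb hH using
      (ch.aestronglyMeasurable_parts hm hα hα₁ hμ hH hb).1))
    (hl (by
      filter_upwards [hb₀] with x h₀ y hy
      rw [leading, abs_mul, abs_neg]
      exact mul_le_mul_of_nonneg_left (h₀ _ (subset_closure (ch.mem_surface y hy)))
        (abs_nonneg _)))
    ((ch.tendsto_leading hm hα hα₁ hμ ht h0).mono_left (Filter.prod_mono hl le_rfl))
  rw [ch.leading_mul_integral hm hα ht] at plim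
  -- At `x = t` the height is zero, so the Poisson-type term is absent from the direct value.
  have et : ∀ᵐ y ∂volume.restrict (Metric.ball 0 ch.ρ),
      √(1 + ‖ch.u y‖ ^ 2) * layerDensity α n μ t (ch.point y) =
        ch.curvaturePart α μ t y + ch.lowerOrderPart α μ t y := by
    filter_upwards [ae_restrict_mem measurableSet_ball, ae_restrict_of_ae
      (compl_mem_ae_iff.2 (measure_singleton (0 : EuclideanSpace ℝ (Fin (m - 1)))))] with y hy hy0
    have hne : ch.point y ≠ t := ch.point_ne_of_ne_base (by rwa [ch.base_self])
    rw [ch.sqrt_mul_layerDensity h hm hα ht hy hne, ch.height_self, neg_zero, zero_mul, zero_add]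
  have hgt := ch.integral_image_point h hm hα hα₁ hμ ht
  have hit := hint.self_of_nhds
  refine ⟨hgt.1.2 ((hit.1.add hit.2).congr (et.mono fun y hy => hy.symm)), ?_⟩
  rw [hgt.2, integral_congr_ae et, integral_add hit.1 hit.2]
  -- `plim` carries the factor `|height|` while the kernel carries `-height`; their quotient is the
  -- sign `ε` of the side.
  have hfin := (plim.const_mul ε).add (hlim.mono_left hl)
  rw [show ε * (-(1 / 2) * μ t) = -(ε / 2) * μ t by ring] at hfin
  refine hfin.congr' ?_
  filter_upwards [hl hint, hl hxH, pint, hε] with x hi hH hp hεx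
  have hpc : IntegrableOn (fun y => -ch.height x * ((‖y - ch.base x‖ ^ 2 +
      (ch.φ y - ch.φ (ch.base x) - ch.height x) ^ 2) ^ (-((m : ℝ) / 2)) * ch.leading α μ x y) +
        ch.curvaturePart α μ x y) (Metric.ball 0 ch.ρ) := (hp.const_mul _).add hi.1
  rw [(ch.integral_image_point h hm hα hα₁ hμ hH).2, ← mul_assoc, ← hεx.2,
    setIntegral_congr_fun measurableSet_ball fun y hy =>
      ch.sqrt_mul_layerDensity h hm hα hH hy (ch.point_ne hεx.1 y),
    integral_add hpc hi.2, integral_add (hp.const_mul _) hi.1,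
    integral_const_mul, add_assoc]

end GraphChart

/-! ### Assembly of the jump relations -/

/-- The jump relation on the side of the surface where the height over a chart has sign `-ε`. -/
theorem IsLyapunovDomain.tendsto_doubleLayer {m : ℕ} [NeZero m] {Ω Γ₁ Γ : Set (Space m)}
    {n : Space m → Space m} {μ : Space m → ℝ} {α : ℝ} (h : IsLyapunovDomain Ω Γ₁ Γ n)
    (hm : 2 < m) (hα : 0 < α) (hα₁ : 2 * α < 1) (hμ : ContinuousOn μ (closure Γ)) {t : Space m}
    (ht : t ∈ Γ) (ch : GraphChart Ω Γ n t) {l : Filter (Space m)} [l.IsCountablyGenerated]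
    (hl : l ≤ 𝓝 t) (hlΓ : ∀ᶠ x in l, x ∉ Γ) {ε : ℝ}
    (hε : ∀ᶠ x in l, ch.height x ≠ 0 ∧ -ch.height x = ε * |ch.height x|) :
    IntegrableOn (layerDensity α n μ t) Γ (surfaceMeasure m) ∧
      Tendsto (doubleLayer α Γ n μ) l
        (𝓝 (-(ε / 2) * μ t + ∫ s in Γ, layerDensity α n μ t s ∂surfaceMeasure m)) := by
  have htH := h.surface_subset ht
  obtain ⟨nint, nlim⟩ := ch.tendsto_integral_near h hm hα hα₁ hμ htH hl hε
  have hV := ch.image_point_subset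
  have hVm := ch.measurableSet_image_point
  set V := ch.point '' Metric.ball 0 ch.ρ with hVdef
  have hSm : MeasurableSet (Γ \ V) := h.measurableSet_surface.diff hVm
  -- The chart contains all of `Γ` within `δ` of `t`, so the remaining piece is treated as far from
  -- the pole.
  obtain ⟨δ, hδ, hcov⟩ := Metric.eventually_nhds_iff.1 ch.covers
  obtain ⟨fint, flim⟩ := h.tendsto_integral_far hm hα hα₁ hμ htH hSm sdiff_subset hδ
    fun s hs => by
      by_contra! h1
      obtain ⟨h2, h3⟩ := hcov h1 hs.1
      exact hs.2 ⟨_, h2, h3.symm⟩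
  have hΓ : V ∪ Γ \ V = Γ := union_sdiff_cancel hV
  have hsplit : ∀ x, IntegrableOn (layerDensity α n μ x) Γ (surfaceMeasure m) →
      (∫ s in V, layerDensity α n μ x s ∂surfaceMeasure m) +
        ∫ s in Γ \ V, layerDensity α n μ x s ∂surfaceMeasure m =
          ∫ s in Γ, layerDensity α n μ x s ∂surfaceMeasure m := by
    intro x hx
    rw [← setIntegral_union disjoint_sdiff_right hSm (hx.mono_set hV) (hx.mono_set sdiff_subset),
      hΓ]
  have hint : IntegrableOn (layerDensity α n μ t) Γ (surfaceMeasure m) := by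
    rw [← hΓ]
    exact nint.union fint.self_of_nhds
  refine ⟨hint, ?_⟩
  have hsum := nlim.add (flim.mono_left hl)
  rw [add_assoc, hsplit t hint] at hsum
  refine hsum.congr' ?_
  filter_upwards [hlΓ, hl ((isOpen_halfSpace m).mem_nhds htH)] with x hxΓ hxH
  exact hsplit x (h.integrableOn_layerDensity hm hα hα₁ hμ ⟨hxH, hxΓ⟩)
end DoubleLayer
theorem theorem3 (m : ℕ) [NeZero m] (hm : 2 < m) (α : ℝ) (hα₀ : 0 < 2 * α) (hα₁ : 2 * α < 1)
    (Ω Γ₁ Γ : Set (Space m)) (n : Space m → Space m) (hΩ : IsLyapunovDomain Ω Γ₁ Γ n)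
    (μ₁ : Space m → ℝ) (hμ₁ : ContinuousOn μ₁ (closure Γ)) :
    (∀ x ∈ halfSpace m \ Γ, IntegrableOn
      (fun ξ => ξ 0 ^ (2 * α) * μ₁ ξ * fderiv ℝ (fun η => q₁ α η x) ξ (n ξ)) Γ
      (surfaceMeasure m)) ∧
    ∀ t ∈ Γ,
      IntegrableOn (fun s => μ₁ s * K₁ α n s t) Γ (surfaceMeasure m) ∧
      Tendsto (doubleLayer α Γ n μ₁) (𝓝[Ω] t)
        (𝓝 (-(1 / 2) * μ₁ t + ∫ s in Γ, μ₁ s * K₁ α n s t ∂(surfaceMeasure m))) ∧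
      Tendsto (doubleLayer α Γ n μ₁) (𝓝[halfSpace m \ closure Ω] t)
        (𝓝 (1 / 2 * μ₁ t + ∫ s in Γ, μ₁ s * K₁ α n s t ∂(surfaceMeasure m))) := by
  have hα : 0 < α := by linarith
  have hΓfr : Γ ⊆ frontier Ω := by rw [hΩ.frontier_eq]; exact subset_union_right
  refine ⟨fun x hx => hΩ.integrableOn_layerDensity hm hα hα₁ hμ₁ hx, fun t ht => ?_⟩
  obtain ⟨ch⟩ := hΩ.exists_graphChart ht
  have hK : (fun s => μ₁ s * K₁ α n s t) = layerDensity α n μ₁ t := by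
    funext s
    rw [K₁, layerDensity]
    ring
  -- The outer normal points upwards in the chart: heights are negative inside, so `ε = 1`, and
  -- positive outside, so `ε = -1`.
  have hin : ∀ᶠ x in 𝓝[Ω] t, ch.height x ≠ 0 ∧ -ch.height x = 1 * |ch.height x| := by
    filter_upwards [nhdsWithin_le_nhds ch.inside, self_mem_nhdsWithin] with x hx hxΩ
    have h1 : ch.height x < 0 := sub_neg.2 (hx hxΩ)
    exact ⟨h1.ne, by rw [abs_of_neg h1, one_mul]⟩
  have hout : ∀ᶠ x in 𝓝[halfSpace m \ closure Ω] t,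
      ch.height x ≠ 0 ∧ -ch.height x = -1 * |ch.height x| := by
    filter_upwards [nhdsWithin_le_nhds ch.outside, self_mem_nhdsWithin] with x hx hxΩ
    have h1 : 0 < ch.height x := sub_pos.2 (hx hxΩ.2)
    exact ⟨h1.ne', by rw [abs_of_pos h1, neg_one_mul]⟩
  have hinΓ : ∀ᶠ x in 𝓝[Ω] t, x ∉ Γ := by
    filter_upwards [self_mem_nhdsWithin] with x hx hxΓ
    have h1 := hΓfr hxΓ
    rw [hΩ.isOpen.frontier_eq] at h1
    exact h1.2 hx
  have houtΓ : ∀ᶠ x in 𝓝[halfSpace m \ closure Ω] t, x ∉ Γ := by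
    filter_upwards [self_mem_nhdsWithin] with x hx hxΓ
    exact hx.2 (frontier_subset_closure (hΓfr hxΓ))
  obtain ⟨hint, hlim⟩ := hΩ.tendsto_doubleLayer hm hα hα₁ hμ₁ ht ch nhdsWithin_le_nhds hinΓ hin
  have hlim' := (hΩ.tendsto_doubleLayer hm hα hα₁ hμ₁ ht ch nhdsWithin_le_nhds houtΓ hout).2
  rw [neg_div, neg_neg] at hlim'
  simp only [hK]
  exact ⟨hint, hlim, hlim'⟩
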